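/- For a group $G$ and an automorphism $\phi$ of $G$, two elements $x,y\in G$ are called $\phi$-twisted conjugate if $y=g\,x\,\phi(g^{-1})$ for some $g\in G$; the equivalence classes of this relation are the $\phi$-twisted conjugacy classes. The group $G$ has the $R_\infty$-property if, for every automorphism $\phi$ of $G$, there are infinitely many $\phi$-twisted conjugacy classes. Theorem 3.1. For every integer $n\ge 2$, each of the groups $\mathrm{SL}(n,\mathbb{Z})$, $\mathrm{PSL}(n,\mathbb{Z})$, $\mathrm{GL}(n,\mathbb{Z})$ and $\mathrm{PGL}(n,\mathbb{Z})$ has the $R_\infty$-property. Here $\mathrm{PSL}(n,\mathbb{Z})$ and $\mathrm{PGL}(n,\mathbb{Z})$ denote the quotients of $\mathrm{SL}(n,\mathbb{Z})$ and $\mathrm{GL}(n,\mathbb{Z})$ by their centres. -/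

import Mathlib

open scoped MatrixGroups

/-- `x ∼_φ y` iff `y = g x φ(g⁻¹)` for some `g`: the orbit relation of the action
`g • x = g x φ(g⁻¹)` of `G` on itself, for an endomorphism `φ` of `G`. -/
def twistedConj {G : Type*} [Group G] (φ : G →* G) : Setoid G where
  r x y := ∃ g : G, y = g * x * φ g⁻¹
  iseqv := by
    refine ⟨fun x => ⟨1, by simp⟩, ?_, ?_⟩
    · rintro x y ⟨g, rfl⟩
      exact ⟨g⁻¹, by simp [mul_assoc]⟩
    · rintro x y z ⟨g, rfl⟩ ⟨h, rfl⟩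
      exact ⟨h * g, by simp [mul_assoc]⟩

/-- The set of `φ`-twisted conjugacy classes of `G`. -/
abbrev TwistedConjClasses {G : Type*} [Group G] (φ : G →* G) : Type _ :=
  Quotient (twistedConj φ)

/-- The `R_∞`-property: every automorphism has infinitely many twisted conjugacy classes. -/
def HasRInfty (G : Type*) [Group G] : Prop :=
  ∀ φ : G ≃* G, Infinite (TwistedConjClasses φ.toMonoidHom)

/-! Infinitely many classes are detected by a class invariant with infinitely many values. If `φ`
is, up to sign, `x ↦ g x g⁻¹` with `g ∈ GL(n, ℤ)`, then `h x φ(h⁻¹) g = ± h (x g) h⁻¹`, so `|tr(x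
g)|` is an invariant. If `φ` is `x ↦ g x⁻ᵀ g⁻¹`, then `x g` becomes `± h (x g) hᵀ`, and `|det(x g +
(x g)ᵀ)|` is an invariant. Both are unbounded, because `x g` runs through all matrices of
determinant `det g`. What remains is to know the automorphisms of `PSL(n, ℤ)`. The property lifts
along quotients by characteristic subgroups (from `PSL` to `SL`, from `PGL` to `GL`) and passes from
a characteristic subgroup of finite index to the whole group (from `PSL` to `PGL` for `n ≥ 3`).

For `n ≥ 3` (`IsSignHom.exists_conj`), an automorphism is lifted to a map of `SL(n, ℤ)` that is
multiplicative up to sign. Suitable powers of elementary matrices are commutators commuting with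
both factors, so their images become unipotent, up to sign, after a further power. A unipotent
representative of a sign class is unique, so the relations between these lifts hold exactly. An
invariant filtration shows that a power of the image of a highest root differs from `1` by rank at
most one, and every root is highest for some ordering of the indices. The rank-one operators `N i j`
satisfy `[N i j, N j k] = m N i k`, where one of the two products vanishes, always the same one. So
the `N i j / m` are matrix units, directly or after composing with the contragredient. They
determine the images of elementary matrices up to sign, hence are integral, and over the principal
ideal domain `ℤ` they are conjugate to the standard ones.

For `n = 2`, `PSL` is generated by `S`, of order 2, and `elliptic`, of order 3. Their images are
controlled by traces, and a ping-pong argument (`apply_zero_zero_of_closure`) leaves only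
conjugations by `GL(2, ℤ)`. `PGL(2, ℤ)` needs its own argument: it may have an automorphism sending
`s` to the class `v` of determinant `-1`, not preserving `PSL`. Up to inner automorphisms this is
the only alternative to the identity; being an involution, it has the invariant `|tr(x φ(x))|`. -/

/-! ### Twisted conjugacy classes -/

/-- A function that is constant on twisted conjugacy classes and takes infinitely many values
shows that there are infinitely many classes. -/
theorem infinite_twistedConjClasses_of_invariant {G α : Type*} [Group G] (φ : G →* G) (f : G → α)
    (hf : ∀ g x, f (g * x * φ g⁻¹) = f x) (hr : (Set.range f).Infinite) :
    Infinite (TwistedConjClasses φ) := by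
  let F : TwistedConjClasses φ → α := Quotient.lift f (by
    rintro x y ⟨g, rfl⟩
    exact (hf g x).symm)
  have : Infinite (Set.range f) := hr.to_subtype
  refine Infinite.of_surjective (β := Set.range f)
    (fun c => ⟨F c, by obtain ⟨x, rfl⟩ := Quotient.exists_rep c; exact ⟨x, rfl⟩⟩) ?_
  rintro ⟨_, x, rfl⟩
  exact ⟨Quotient.mk _ x, rfl⟩

theorem HasRInfty.of_mulEquiv {G H : Type*} [Group G] [Group H] (e : G ≃* H) (hG : HasRInfty G) :
    HasRInfty H := by
  intro φ
  have := hG ((e.trans φ).trans e.symm)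
  let F : TwistedConjClasses ((e.trans φ).trans e.symm).toMonoidHom →
      TwistedConjClasses φ.toMonoidHom :=
    Quotient.map e (by
      rintro x y ⟨g, rfl⟩
      exact ⟨e g, by simp⟩)
  refine Infinite.of_injective F ?_
  intro x y
  induction x using Quotient.inductionOn
  induction y using Quotient.inductionOn
  intro h
  obtain ⟨g, hg⟩ := Quotient.exact h
  refine Quotient.sound ⟨e.symm g, ?_⟩
  apply e.injective
  simpa using hg

theorem HasRInfty.of_quotient {G : Type*} [Group G] (N : Subgroup G) [N.Normal]
    [N.Characteristic] (h : HasRInfty (G ⧸ N)) : HasRInfty G := by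
  intro φ
  let ψ : (G ⧸ N) ≃* (G ⧸ N) := QuotientGroup.congr N N φ
    (Subgroup.characteristic_iff_map_eq.mp inferInstance φ)
  have := h ψ
  let F : TwistedConjClasses φ.toMonoidHom → TwistedConjClasses ψ.toMonoidHom :=
    Quotient.map (fun x => (x : G ⧸ N)) (by
      rintro x y ⟨g, rfl⟩
      exact ⟨(g : G ⧸ N), rfl⟩)
  refine Infinite.of_surjective F ?_
  intro c
  obtain ⟨x, rfl⟩ := Quotient.exists_rep c
  obtain ⟨y, rfl⟩ := QuotientGroup.mk_surjective x
  exact ⟨Quotient.mk _ y, rfl⟩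

/-- A `φ`-class of `G` meets `H` in at most `[G : H]` classes of the restriction `ψ`. If `z = g x
φ(g⁻¹)` and `z' = g' x φ(g'⁻¹)` lie in `H` and `g g'⁻¹ ∈ H`, then `g g'⁻¹` conjugates `z'` to `z` in
the twisted sense. So finitely many `φ`-classes would force finitely many `ψ`-classes. -/
theorem HasRInfty.of_subgroup {G : Type*} [Group G] (H : Subgroup G) [H.Characteristic]
    [H.FiniteIndex] (h : HasRInfty H) : HasRInfty G := by
  intro φ
  have hmap : H.map φ.toMonoidHom = H := Subgroup.characteristic_iff_map_eq.mp inferInstance φ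
  let ψ : H ≃* H := (φ.subgroupMap H).trans (MulEquiv.subgroupCongr hmap)
  have hψ : ∀ x : H, ((ψ x : H) : G) = φ x := fun x => rfl
  have hinf := h ψ
  by_contra hfin
  rw [not_infinite_iff_finite] at hfin
  let F : TwistedConjClasses ψ.toMonoidHom → TwistedConjClasses φ.toMonoidHom :=
    Quotient.map (fun x => (x : G)) (by
      rintro x y ⟨g, rfl⟩
      exact ⟨(g : G), rfl⟩)
  suffices Finite (TwistedConjClasses ψ.toMonoidHom) from not_finite (TwistedConjClasses ψ.toMonoidHom)
  refine Set.finite_univ_iff.mp (Set.Finite.of_finite_fibers F (Set.toFinite _) ?_)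
  rintro _ ⟨d, -, rfl⟩
  obtain ⟨x, rfl⟩ := Quotient.exists_rep d
  rw [Set.univ_inter]
  have key : ∀ d : F ⁻¹' {F (Quotient.mk _ x)}, ∃ (g : G) (z : H),
      d.1 = Quotient.mk _ z ∧ (z : G) = g * x * φ g⁻¹ := by
    rintro ⟨d, hd⟩
    obtain ⟨z, rfl⟩ := Quotient.exists_rep d
    obtain ⟨g, hg⟩ := Quotient.exact (Eq.symm hd)
    exact ⟨g, z, rfl, hg⟩
  choose g z hz hg using key
  refine Set.finite_coe_iff.mp ?_
  -- `G ⧸ H` consists of left cosets, so the coset `H g` is recorded through `g⁻¹`.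
  refine Finite.of_injective (β := G ⧸ H) (fun d => ((g d)⁻¹ : G)) ?_
  intro d e hde
  have h1 : g d * (g e)⁻¹ ∈ H := by simpa using QuotientGroup.eq.mp hde
  refine Subtype.ext ?_
  rw [hz, hz]
  symm
  apply Quotient.sound
  refine ⟨⟨_, h1⟩, Subtype.ext ?_⟩
  change (z d : G) = g d * (g e)⁻¹ * z e * φ (g d * (g e)⁻¹)⁻¹
  rw [hg, hg]
  simp [mul_assoc]

/-! ### Generation of `SL(n, ℤ)` by elementary matrices -/

namespace Matrix.SpecialLinearGroup

section Generation

variable {ι : Type*} [Fintype ι] [DecidableEq ι]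

theorem transvection_mul_apply {R : Type*} [CommRing R] {i j : ι} (hij : i ≠ j) (c : R)
    (A : SpecialLinearGroup ι R) (a b : ι) :
    (transvection hij c * A) a b = A a b + if a = i then c * A j b else 0 := by
  change (Matrix.transvection i j c * A.1) a b = _
  by_cases h : a = i
  · subst h
    rw [Matrix.transvection_mul_apply_same, if_pos rfl]
  · rw [Matrix.transvection_mul_apply_of_ne i j a b h, if_neg h, add_zero]

/-- The subgroup generated by the elementary matrices. -/
def elementarySubgroup (ι : Type*) [Fintype ι] [DecidableEq ι] (R : Type*) [CommRing R] :
    Subgroup (SpecialLinearGroup ι R) :=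
  Subgroup.closure {x | ∃ (i j : ι) (h : i ≠ j) (c : R), x = transvection h c}

theorem mem_elementarySubgroup_of_mul {R : Type*} [CommRing R] {i j : ι} (h : i ≠ j) (c : R)
    {A : SpecialLinearGroup ι R} (hA : transvection h c * A ∈ elementarySubgroup ι R) :
    A ∈ elementarySubgroup ι R :=
  ((elementarySubgroup ι R).mul_mem_cancel_left
    (Subgroup.subset_closure ⟨i, j, h, c, rfl⟩)).mp hA

/-- The columns of `A` with index outside `s` are those of the identity matrix. -/
def ColsStandard (s : Finset ι) (A : SpecialLinearGroup ι ℤ) : Prop :=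
  ∀ j ∉ s, ∀ i, A i j = (1 : Matrix ι ι ℤ) i j

theorem ColsStandard.transvection_mul {s : Finset ι} {A : SpecialLinearGroup ι ℤ}
    (hA : ColsStandard s A) {i j : ι} (h : i ≠ j) (hj : j ∈ s) (c : ℤ) :
    ColsStandard s (transvection h c * A) := by
  intro k hk a
  have hjk : j ≠ k := by rintro rfl; exact hk hj
  rw [transvection_mul_apply, hA k hk, hA k hk, Matrix.one_apply_ne hjk]
  simp

/-- A Bézout relation among the entries of column `p` in rows of `s`: `A⁻¹` also fixes the basis
vectors outside `s`, so its row `p` is supported in `s`. -/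
theorem ColsStandard.sum_mul_eq_one {s : Finset ι} {A : SpecialLinearGroup ι ℤ}
    (hA : ColsStandard s A) {p : ι} (hp : p ∈ s) : ∑ i ∈ s, A⁻¹ p i * A i p = 1 := by
  have hinv : ∀ j ∉ s, ∀ i, A⁻¹ i j = (1 : Matrix ι ι ℤ) i j := by
    intro j hj i
    have h1 : A.1 *ᵥ Pi.single j 1 = Pi.single j 1 := by
      ext a
      simp [hA j hj, Pi.single_apply, Matrix.one_apply]
    have h2 : (A⁻¹).1 *ᵥ Pi.single j 1 = Pi.single j 1 := by
      conv_lhs => rw [← h1]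
      rw [Matrix.mulVec_mulVec, ← coe_mul, inv_mul_cancel, coe_one, Matrix.one_mulVec]
    have := congrFun h2 i
    simpa [Pi.single_apply, Matrix.one_apply] using this
  have h1 : (A⁻¹ * A) p p = 1 := by simp
  rw [coe_mul, Matrix.mul_apply] at h1
  refine (Finset.sum_subset (Finset.subset_univ _) fun i _ hi => ?_).trans h1
  have : A⁻¹ p i = 0 := by
    rw [hinv i hi, Matrix.one_apply_ne]
    rintro rfl
    exact hi hp
  rw [this, zero_mul]

theorem ColsStandard.erase {s : Finset ι} {A : SpecialLinearGroup ι ℤ}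
    (hA : ColsStandard s A) {p : ι} (h : ∀ i, A i p = (1 : Matrix ι ι ℤ) i p) :
    ColsStandard (s.erase p) A := by
  intro j hj i
  by_cases hjp : j = p
  · rw [hjp, h]
  · exact hA j (fun hjs => hj (Finset.mem_erase.mpr ⟨hjp, hjs⟩)) i

/-- Euclidean algorithm on column `p` by row operations, with an inner induction on the sum of
absolute values of that column and an outer one on the set of columns still to be treated. -/
theorem ColsStandard.mem_elementarySubgroup {s : Finset ι} : ∀ {A : SpecialLinearGroup ι ℤ},
    ColsStandard s A → A ∈ elementarySubgroup ι ℤ := by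
  induction s using Finset.strongInduction with
  | H s ihs =>
  rcases s.eq_empty_or_nonempty with rfl | ⟨p, hp⟩
  · intro A hA
    have : A = 1 := by
      ext i j
      simpa using hA j (by simp) i
    rw [this]
    exact one_mem _
  have hstd : ∀ {A : SpecialLinearGroup ι ℤ}, ColsStandard s A →
      (∀ i, A i p = (1 : Matrix ι ι ℤ) i p) → A ∈ elementarySubgroup ι ℤ := fun hA h =>
    ihs (s.erase p) (Finset.erase_ssubset hp) (hA.erase h)
  suffices ∀ (N : ℕ) (A : SpecialLinearGroup ι ℤ), ColsStandard s A →
      ∑ i, (A i p).natAbs = N → A ∈ elementarySubgroup ι ℤ by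
    intro A hA
    exact this _ A hA rfl
  intro N
  induction N using Nat.strong_induction_on with
  | _ N ihN =>
  intro A hA hN
  -- The pivot row `j` lies in `s`, so the finished columns are untouched. The row `i` being reduced
  -- is arbitrary, so entries outside `s` are cleared too.
  by_cases hred : ∃ i j, i ≠ j ∧ j ∈ s ∧ A j p ≠ 0 ∧ (A j p).natAbs ≤ (A i p).natAbs
  · obtain ⟨i, j, hij, hj, hj0, hle⟩ := hred
    obtain ⟨c, hc⟩ : ∃ c : ℤ, (A i p + c * A j p).natAbs < (A i p).natAbs := by
      rcases le_total 0 (A i p) with h1 | h1 <;> rcases le_total 0 (A j p) with h2 | h2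
      · exact ⟨-1, by omega⟩
      · exact ⟨1, by omega⟩
      · exact ⟨1, by omega⟩
      · exact ⟨-1, by omega⟩
    refine mem_elementarySubgroup_of_mul hij c (ihN _ ?_ _ (hA.transvection_mul hij hj c) rfl)
    rw [← hN]
    refine Finset.sum_lt_sum (fun a _ => ?_) ⟨i, Finset.mem_univ _, ?_⟩
    · rw [transvection_mul_apply]
      split_ifs with h
      · subst h; exact hc.le
      · simp
    · rw [transvection_mul_apply, if_pos rfl]
      exact hc
  push Not at hred
  obtain ⟨r, hr, hr0⟩ : ∃ r ∈ s, A r p ≠ 0 := by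
    by_contra! h
    have := hA.sum_mul_eq_one hp
    rw [Finset.sum_eq_zero fun i hi => by rw [h i hi, mul_zero]] at this
    exact zero_ne_one this
  have huniq : ∀ i ∈ s, i ≠ r → A i p = 0 := by
    intro i hi hir
    by_contra h0
    have h1 := hred i r hir hr hr0
    have h2 := hred r i hir.symm hi h0
    omega
  have hunit : A r p = 1 ∨ A r p = -1 := by
    have := hA.sum_mul_eq_one hp
    rw [Finset.sum_eq_single_of_mem r hr fun i hi hir => by rw [huniq i hi hir, mul_zero]] at this
    exact Int.isUnit_iff.mp (IsUnit.of_mul_eq_one_right _ this)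
  have hcol : ∀ i, i ≠ r → A i p = 0 := by
    intro i hir
    have h1 := hred i r hir hr hr0
    omega
  by_cases hrp : r = p
  · subst hrp
    rcases hunit with h1 | h1
    · refine hstd hA fun i => ?_
      by_cases hi : i = r
      · rw [hi, h1, Matrix.one_apply_eq]
      · rw [hcol i hi, Matrix.one_apply_ne hi]
    · by_cases hq : ∃ q ∈ s, q ≠ r
      · obtain ⟨q, hq, hqr⟩ := hq
        -- On the entries in rows `(r, q)` these operations act as `(-1, 0) → (-1, -1) → (1, -1) →
        -- (1, 0)`.
        refine mem_elementarySubgroup_of_mul hqr 1 (mem_elementarySubgroup_of_mul hqr.symm (-2)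
          (mem_elementarySubgroup_of_mul hqr 1 (hstd (((hA.transvection_mul hqr hp 1).transvection_mul
            hqr.symm hq (-2)).transvection_mul hqr hp 1) fun i => ?_)))
        simp only [transvection_mul_apply, hqr.symm, if_true, if_false, h1, hcol q hqr]
        by_cases hi : i = r
        · subst hi
          simp [h1, hqr.symm]
        · by_cases hiq : i = q
          · subst hiq
            simp [hi, hcol i hi]
          · simp [hi, hiq, hcol i hi]
      -- With no second row available, `A` is diagonal with a single entry `-1`, against `det A =
      -- 1`.
      · exfalso
        push Not at hq
        have hdiag : A.1 = Matrix.diagonal fun i => A i i := by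
          ext i j
          by_cases hj : j = r
          · subst hj
            by_cases hi : i = j
            · rw [hi, Matrix.diagonal_apply_eq]
            · rw [Matrix.diagonal_apply_ne _ hi]; exact hcol i hi
          · have hjs : j ∉ s := fun h => hj (hq j h)
            by_cases hi : i = j
            · rw [hi, Matrix.diagonal_apply_eq]
            · rw [Matrix.diagonal_apply_ne _ hi]
              exact (hA j hjs i).trans (Matrix.one_apply_ne hi)
        have hdet := A.2
        rw [hdiag, Matrix.det_diagonal, Finset.prod_eq_single_of_mem r (Finset.mem_univ _), h1] at hdet
        · norm_num at hdet
        · intro j _ hj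
          exact (hA j (fun h => hj (hq j h)) j).trans (Matrix.one_apply_eq j)
  · have hpr : p ≠ r := fun h => hrp h.symm
    -- As `A r p = ±1`, adding `A r p` times row `r` to row `p` puts `(A r p)² = 1` in position `p`,
    -- which then clears row `r`.
    refine mem_elementarySubgroup_of_mul hpr (A r p) (mem_elementarySubgroup_of_mul hrp (-A r p)
      (hstd ((hA.transvection_mul hpr hr _).transvection_mul hrp hp _) fun i => ?_))
    simp only [transvection_mul_apply, if_true, hcol p hpr]
    have hsq : A r p * A r p = 1 := by rcases hunit with h | h <;> rw [h] <;> norm_num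
    by_cases hi : i = p
    · subst hi
      simp [hpr, hcol i hpr, hsq]
    · by_cases hir : i = r
      · subst hir
        simp [hi, hsq]
      · simp [hi, hir, hcol i hir]

theorem transvection_zpow {i j : ι} (h : i ≠ j) (c : ℤ) :
    (transvection h (1 : ℤ)) ^ c = transvection h c := by
  have key : ∀ k : ℕ, (transvection h (1 : ℤ)) ^ k = transvection h (k : ℤ) := by
    intro k
    induction k with
    | zero => simp
    | succ k ih => rw [pow_succ, ih, ← transvection_add]; push_cast; rfl
  obtain ⟨k, rfl | rfl⟩ := c.eq_nat_or_neg
  · rw [_root_.zpow_natCast, key]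
  · rw [_root_.zpow_neg, _root_.zpow_natCast, key, transvection_inv]

/-- `SL(ι, ℤ)` is generated by the elementary matrices `1 + E i j`. -/
theorem closure_transvection_one :
    Subgroup.closure {x : SpecialLinearGroup ι ℤ | ∃ (i j : ι) (h : i ≠ j), x = transvection h 1} =
      ⊤ := by
  rw [eq_top_iff]
  intro A _
  have hA : A ∈ elementarySubgroup ι ℤ :=
    ColsStandard.mem_elementarySubgroup (s := Finset.univ) fun j hj => absurd (Finset.mem_univ j) hj
  revert hA
  apply (Subgroup.closure_le _).mpr
  rintro _ ⟨i, j, h, c, rfl⟩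
  rw [← transvection_zpow, SetLike.mem_coe]
  refine Subgroup.zpow_mem _ (Subgroup.subset_closure ?_) c
  exact ⟨i, j, h, rfl⟩

end Generation

end Matrix.SpecialLinearGroup

/-! ### Commutators commuting with both factors are quasi-unipotent -/

open Polynomial in
-- The minimal polynomial splits into factors `X - a` with `a ^ k = 1`. Each divides `X ^ k - 1`, so
-- the product divides a power of it.
theorem Module.End.isNilpotent_pow_sub_one {K V : Type*} [Field K] [IsAlgClosed K] [AddCommGroup V]
    [Module K V] [FiniteDimensional K V] (Z : Module.End K V) (k : ℕ)
    (h : ∀ μ, Z.HasEigenvalue μ → μ ^ k = 1) : IsNilpotent (Z ^ k - 1) := by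
  have hdvd : ∀ s : Multiset K, (∀ a ∈ s, a ^ k = 1) →
      (s.map fun a => X - C a).prod ∣ (X ^ k - 1 : K[X]) ^ Multiset.card s := by
    intro s
    induction s using Multiset.induction_on with
    | empty => simp
    | cons a s ih =>
      intro hs
      rw [Multiset.map_cons, Multiset.prod_cons, Multiset.card_cons, pow_succ']
      refine mul_dvd_mul ?_ (ih fun b hb => hs b (Multiset.mem_cons_of_mem hb))
      rw [dvd_iff_isRoot]
      simp [hs a (Multiset.mem_cons_self a s)]
  have hp := (IsAlgClosed.splits (minpoly K Z)).eq_prod_roots_of_monic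
    (minpoly.monic (Algebra.IsIntegral.isIntegral Z))
  have h1 := hdvd (minpoly K Z).roots (by
    intro a ha
    exact h a (Module.End.hasEigenvalue_of_isRoot (isRoot_of_mem_roots ha)))
  rw [← hp] at h1
  obtain ⟨q, hq⟩ := h1
  refine ⟨Multiset.card (minpoly K Z).roots, ?_⟩
  have := congrArg (aeval Z) hq
  simpa [minpoly.aeval] using this

/-- `X` and `Y` preserve each eigenspace of `Z`, where `X Y = μ Y X`. Determinants there give `μ ^ d
= 1`, with `d` the dimension of the eigenspace, and `d` divides the factorial. -/
theorem Module.End.isNilpotent_pow_sub_one_of_commutator {K V : Type*} [Field K] [IsAlgClosed K]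
    [AddCommGroup V] [Module K V] [FiniteDimensional K V] {X Y Z : Module.End K V}
    (hX : Function.Injective X) (hY : Function.Injective Y)
    (h : X * Y = Z * Y * X) (hZX : Commute Z X) (hZY : Commute Z Y) :
    IsNilpotent (Z ^ (Module.finrank K V).factorial - 1) := by
  apply isNilpotent_pow_sub_one
  intro μ hμ
  set E := Z.eigenspace μ with hE
  have hXE : ∀ v ∈ E, X v ∈ E := by
    intro v hv
    rw [hE, Module.End.mem_eigenspace_iff] at hv ⊢
    rw [← Module.End.mul_apply, hZX.eq, Module.End.mul_apply, hv, map_smul]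
  have hYE : ∀ v ∈ E, Y v ∈ E := by
    intro v hv
    rw [hE, Module.End.mem_eigenspace_iff] at hv ⊢
    rw [← Module.End.mul_apply, hZY.eq, Module.End.mul_apply, hv, map_smul]
  have heq : X.restrict hXE * Y.restrict hYE = μ • (Y.restrict hYE * X.restrict hXE) := by
    ext ⟨v, hv⟩
    have h1 := congrArg (fun f : Module.End K V => f v) h
    have h2 := hYE _ (hXE v hv)
    rw [hE, Module.End.mem_eigenspace_iff] at h2
    simp only [Module.End.mul_apply] at h1
    simp [Module.End.mul_apply, LinearMap.restrict_apply, h1, h2]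
  have hdet : ∀ (A : Module.End K V) (hA : ∀ v ∈ E, A v ∈ E), Function.Injective A →
      LinearMap.det (A.restrict hA) ≠ 0 := by
    intro A hA hi h0
    have : Function.Injective (A.restrict hA) := by
      intro x y hxy
      exact Subtype.ext (hi (congrArg Subtype.val hxy))
    have h2 := LinearMap.bot_lt_ker_of_det_eq_zero h0
    rw [LinearMap.ker_eq_bot.mpr this] at h2
    exact lt_irrefl _ h2
  have h1 := congrArg LinearMap.det heq
  rw [map_mul, LinearMap.det_smul, map_mul, mul_comm (LinearMap.det (Y.restrict hYE))] at h1
  have h2 : μ ^ Module.finrank K E = 1 := by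
    have := mul_ne_zero (hdet X hXE hX) (hdet Y hYE hY)
    field_simp at h1
    exact (mul_right_cancel₀ this (by rw [one_mul]; linear_combination h1)).symm
  have hpos : 0 < Module.finrank K E := by
    have : Nontrivial E := (Submodule.nontrivial_iff_ne_bot).mpr hμ
    exact Module.finrank_pos
  obtain ⟨c, hc⟩ := Nat.dvd_factorial hpos (Submodule.finrank_le E)
  rw [hc, pow_mul, h2, one_pow]

theorem Matrix.isNilpotent_pow_sub_one_of_commutator {n : ℕ} {X Y Z : (Matrix (Fin n) (Fin n) ℚ)ˣ}
    (h : X * Y = Z * Y * X) (hZX : Commute Z X) (hZY : Commute Z Y) :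
    IsNilpotent ((Z : Matrix (Fin n) (Fin n) ℚ) ^ n.factorial - 1) := by
  let F : Matrix (Fin n) (Fin n) ℚ →+* Module.End ℂ (Fin n → ℂ) :=
    (Matrix.toLinAlgEquiv' (R := ℂ) (n := Fin n)).toRingEquiv.toRingHom.comp
      (algebraMap ℚ ℂ).mapMatrix
  have hF : Function.Injective F :=
    (Matrix.toLinAlgEquiv' (R := ℂ) (n := Fin n)).injective.comp
      (Matrix.map_injective (algebraMap ℚ ℂ).injective)
  have hinj : ∀ A : (Matrix (Fin n) (Fin n) ℚ)ˣ, Function.Injective (F A) := by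
    intro A
    have h1 : F ↑A⁻¹ * F A = 1 := by rw [← map_mul]; simp
    exact Function.LeftInverse.injective (g := F ↑A⁻¹) fun v => by
      rw [← Module.End.mul_apply, h1]; rfl
  rw [← IsNilpotent.map_iff hF, map_sub, map_pow, map_one]
  have := Module.End.isNilpotent_pow_sub_one_of_commutator (hinj X) (hinj Y) (Z := F Z)
    (by simp only [← map_mul, ← Units.val_mul, h])
    (by simp only [Commute, SemiconjBy, ← map_mul, ← Units.val_mul, hZX.eq])
    (by simp only [Commute, SemiconjBy, ← map_mul, ← Units.val_mul, hZY.eq])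
  simpa using this

/-! ### Unipotent operators satisfying the commutator relations of upper unitriangular matrices -/

section Unitriangular

variable {K V : Type*} [Field K] [AddCommGroup V] [Module K V]

theorem Module.End.mem_of_apply_mem [FiniteDimensional K V] {f : Module.End K V}
    (hf : Function.Injective f) {F : Submodule K V} (hF : ∀ v ∈ F, f v ∈ F) {x : V}
    (hx : f x ∈ F) : x ∈ F := by
  have hinj : Function.Injective (f.restrict hF) := fun a b hab =>
    Subtype.ext (hf (congrArg Subtype.val hab))
  obtain ⟨y, hy⟩ := LinearMap.injective_iff_surjective.mp hinj ⟨f x, hx⟩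
  have := hf (congrArg Subtype.val hy)
  exact this ▸ y.2

/-- A nilpotent operator preserving `F` and the elements outside `F` satisfying `P`
sends one of the latter into `F`. -/
theorem Module.End.exists_notMem_apply_mem {N : Module.End K V} (hN : IsNilpotent N)
    {F : Submodule K V} {P : V → Prop} (hP : ∀ v, P v → P (N v)) {v : V} (hv : v ∉ F)
    (hPv : P v) : ∃ w, w ∉ F ∧ P w ∧ N w ∈ F := by
  obtain ⟨k, hk⟩ := hN
  have hex : ∃ s, (N ^ s) v ∈ F := ⟨k, by simp [hk]⟩
  classical
  have hall : ∀ s, P ((N ^ s) v) := by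
    intro s
    induction s with
    | zero => simpa
    | succ s ih => rw [pow_succ', Module.End.mul_apply]; exact hP _ ih
  have hpos : Nat.find hex ≠ 0 := by
    intro h0
    have := Nat.find_spec hex
    rw [h0] at this
    exact hv (by simpa using this)
  obtain ⟨s, hs⟩ := Nat.exists_eq_succ_of_ne_zero hpos
  refine ⟨(N ^ s) v, Nat.find_min hex (by omega), hall s, ?_⟩
  rw [← Module.End.mul_apply, ← pow_succ', ← Nat.succ_eq_add_one, ← hs]
  exact Nat.find_spec hex

/-- Invertible operators `U i j` which for `i < j` are unipotent and satisfy the commutator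
relations of the `m`-th powers of the elementary matrices. -/
structure IsUnitriangularFamily {n : ℕ} (m : ℕ) (U : Fin n → Fin n → (Module.End K V)ˣ) :
    Prop where
  unip : ∀ i j, i < j → IsNilpotent ((U i j : Module.End K V) - 1)
  comm : ∀ i j k l, i < j → k < l → j ≠ k → i ≠ l → Commute (U i j) (U k l)
  comm_mul : ∀ i j k, i < j → j < k → U i j * U j k = U i k ^ m * U j k * U i j

variable {n m : ℕ} {U : Fin n → Fin n → (Module.End K V)ˣ}

theorem pow_apply_sub_mem {f : Module.End K V} {F : Submodule K V} (hF : ∀ v ∈ F, f v ∈ F)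
    {v : V} (hv : f v - v ∈ F) (s : ℕ) : (f ^ s) v - v ∈ F := by
  induction s with
  | zero => simp
  | succ s ih =>
    rw [pow_succ', Module.End.mul_apply]
    have := F.add_mem (hF _ ih) hv
    rwa [map_sub, sub_add_sub_cancel] at this

theorem pow_apply_mem {f : Module.End K V} {F : Submodule K V} (hF : ∀ v ∈ F, f v ∈ F)
    {v : V} (hv : v ∈ F) (s : ℕ) : (f ^ s) v ∈ F := by
  induction s with
  | zero => simpa
  | succ s ih => rw [pow_succ', Module.End.mul_apply]; exact hF _ ih

namespace IsUnitriangularFamily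

/-- A common fixed vector in `V / F`, as in Kolchin's theorem. The operators are treated one at a
time, and nilpotency of `U p q - 1` yields a vector fixed modulo `F` by `U p q` as well. -/
theorem exists_notMem (hU : IsUnitriangularFamily m U) {F : Submodule K V}
    (hF : ∀ i j, i < j → ∀ v ∈ F, (U i j : Module.End K V) v ∈ F) (hne : F ≠ ⊤) :
    ∃ v, v ∉ F ∧ ∀ i j, i < j → (U i j : Module.End K V) v - v ∈ F := by
  -- Order of treatment: rows from the top, each from right to left. The commutator of an earlier
  -- `(i, j)` with `(p, q)` is trivial unless `j = p`, and then it involves `(i, q)` with `i < p`,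
  -- treated earlier. So being fixed modulo `F` by the earlier operators survives `U p q`.
  let r : Fin n → Fin n → ℕ := fun i j => (finProdFinEquiv (i, Fin.rev j) : Fin (n * n))
  have hr : ∀ i j, r i j = Fin.rev j + n * i := fun i j => rfl
  have hinj : ∀ i j k l, r i j = r k l → i = k ∧ j = l := by
    intro i j k l h
    have := finProdFinEquiv.injective (Fin.ext h)
    simpa using this
  have key : ∀ t : ℕ, ∃ v, v ∉ F ∧
      ∀ i j, i < j → r i j < t → (U i j : Module.End K V) v - v ∈ F := by
    intro t
    induction t with
    | zero =>
      obtain ⟨v, hv⟩ := SetLike.exists_not_mem_of_ne_top F hne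
      exact ⟨v, hv, fun i j _ h => absurd h (Nat.not_lt_zero _)⟩
    | succ t ih =>
      obtain ⟨v, hv, hPv⟩ := ih
      by_cases hex : ∃ p q, p < q ∧ r p q = t
      swap
      · push Not at hex
        exact ⟨v, hv, fun i j hij h => hPv i j hij (lt_of_le_of_ne (Nat.lt_succ_iff.mp h) (hex i j hij))⟩
      obtain ⟨p, q, hpq, rfl⟩ := hex
      obtain ⟨w, hw, hPw, hNw⟩ := Module.End.exists_notMem_apply_mem (hU.unip p q hpq) (F := F)
        (P := fun v => ∀ i j, i < j → r i j < r p q → (U i j : Module.End K V) v - v ∈ F) (by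
          intro v hv i j hij hlt
          have hUv : (U i j : Module.End K V) ((U p q : Module.End K V) v) -
              (U p q : Module.End K V) v ∈ F := by
            by_cases hjp : j = p
            · subst hjp
              have hiq := hij.trans hpq
              have h1 := hU.comm_mul i j q hij hpq
              have h2 : U i j * U j q = U j q * (U i j * U i q ^ m) := by
                have c1 := (hU.comm i q j q hiq hpq (by omega) (by omega)).pow_left m
                have c2 := (hU.comm i q i j hiq hij (by omega) (by omega)).pow_left m
                rw [h1, c1.eq, mul_assoc, c2.eq]
              have h3 := congrArg (fun A : (Module.End K V)ˣ => (A : Module.End K V) v) h2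
              simp only [Units.val_mul, Units.val_pow_eq_pow_val, Module.End.mul_apply] at h3
              rw [h3, ← map_sub]
              apply hF j q hpq
              have h4 := hv i q hiq (by
                rw [hr, hr]
                have : i.val + 1 ≤ j.val := hij
                have h5 := Nat.mul_le_mul_left n this
                have h6 := (Fin.rev q).isLt
                rw [mul_add] at h5
                omega)
              have h5 := hF i j hij _ (pow_apply_sub_mem (hF i q hiq) h4 m)
              have h6 := F.add_mem h5 (hv i j hij hlt)
              rwa [map_sub, sub_add_sub_cancel] at h6
            · have hiq : i ≠ q := by
                rintro rfl
                rw [hr, hr] at hlt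
                have : p.val + 1 ≤ i.val := hpq
                have h5 := Nat.mul_le_mul_left n this
                have h6 := (Fin.rev i).isLt
                rw [mul_add] at h5
                omega
              have h1 := hU.comm i j p q hij hpq hjp hiq
              have h3 := congrArg (fun A : (Module.End K V)ˣ => (A : Module.End K V) v) h1.eq
              simp only [Units.val_mul, Module.End.mul_apply] at h3
              rw [h3, ← map_sub]
              exact hF p q hpq _ (hv i j hij hlt)
          have h7 := F.sub_mem hUv (hv i j hij hlt)
          simp only [LinearMap.sub_apply, Module.End.one_apply, map_sub]
          convert h7 using 1
          abel) hv hPv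
      refine ⟨w, hw, fun i j hij h => ?_⟩
      rcases Nat.lt_succ_iff_lt_or_eq.mp h with h | h
      · exact hPw i j hij h
      · obtain ⟨rfl, rfl⟩ := hinj _ _ _ _ h
        simpa using hNw
  obtain ⟨v, hv, h⟩ := key (n * n)
  exact ⟨v, hv, fun i j hij => h i j hij (Fin.isLt _)⟩

/-- The ascending filtration of `V` defined by a family of operators. -/
def filtration (U : Fin n → Fin n → (Module.End K V)ˣ) : ℕ → Submodule K V
  | 0 => ⊥
  | k + 1 => ⨅ (i : Fin n) (j : Fin n) (_ : i < j),
      (filtration U k).comap ((U i j : Module.End K V) - 1)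

theorem mem_filtration_succ {k : ℕ} {v : V} : v ∈ filtration U (k + 1) ↔
    ∀ i j, i < j → (U i j : Module.End K V) v - v ∈ filtration U k := by
  simp [filtration, Submodule.mem_iInf]

theorem filtration_le_succ (k : ℕ) : filtration U k ≤ filtration U (k + 1) := by
  induction k with
  | zero => simp [filtration]
  | succ k ih =>
    intro v hv
    rw [mem_filtration_succ] at hv ⊢
    exact fun i j hij => ih (hv i j hij)

theorem apply_mem_filtration {k : ℕ} {i j : Fin n} (hij : i < j) {v : V}
    (hv : v ∈ filtration U k) : (U i j : Module.End K V) v ∈ filtration U k := by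
  have := (filtration U k).add_mem (filtration_le_succ k hv |> fun h =>
    mem_filtration_succ.mp h i j hij) hv
  simpa using this

/-- By `exists_notMem` in the quotient, the filtration grows strictly until it is everything. -/
theorem le_finrank_filtration [FiniteDimensional K V] (hU : IsUnitriangularFamily m U) (k : ℕ)
    (hk : k ≤ Module.finrank K V) : k ≤ Module.finrank K (filtration U k) := by
  induction k with
  | zero => exact Nat.zero_le _
  | succ k ih =>
    by_cases htop : filtration U k = ⊤
    · have : filtration U (k + 1) = ⊤ := top_le_iff.mp (htop ▸ filtration_le_succ k)
      rw [this, finrank_top]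
      exact hk
    · obtain ⟨v, hv, h⟩ := hU.exists_notMem (fun i j hij v hv => apply_mem_filtration hij hv) htop
      have hlt : filtration U k < filtration U (k + 1) :=
        lt_of_le_of_ne (filtration_le_succ k) fun heq => hv (heq ▸ mem_filtration_succ.mpr h)
      have := Submodule.finrank_lt_finrank_of_lt hlt
      have := ih (by omega)
      omega

/-- A root of height `h + 1` should lower the filtration by `h + 1` steps, being an iterated
commutator of operators that lower it by one. Each commutator costs a factor `m` in the exponent,
hence `m ^ h`. -/
theorem pow_apply_sub_mem_filtration [FiniteDimensional K V] (hU : IsUnitriangularFamily m U)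
    (h : ℕ) : ∀ (i k : Fin n), k.val = i.val + (h + 1) → ∀ (l : ℕ) (v : V),
      v ∈ filtration U (l + (h + 1)) →
      ((U i k : Module.End K V) ^ (m ^ h)) v - v ∈ filtration U l := by
  induction h with
  | zero =>
    intro i k hik l v hv
    simpa using mem_filtration_succ.mp hv i k (by rw [Fin.lt_def]; omega)
  | succ h ih =>
    intro i k hik l v hv
    -- Splits off the simple root `(i, i + 1)`.
    let j : Fin n := ⟨i.val + 1, by omega⟩
    have hij : i < j := by rw [Fin.lt_def]; simp [j]
    have hjk : j < k := by rw [Fin.lt_def]; simp [j]; omega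
    have hik' := hij.trans hjk
    have hjk' : k.val = j.val + (h + 1) := by simp [j]; omega
    set a := m ^ h with ha
    have hrel : U i j * U j k ^ a = U i k ^ m ^ (h + 1) * (U j k ^ a * U i j) := by
      have h1 : U i j * U j k * (U i j)⁻¹ = U i k ^ m * U j k := by
        rw [hU.comm_mul i j k hij hjk, mul_inv_cancel_right]
      have h2 := congrArg (· ^ a) h1
      simp only [conj_pow] at h2
      have c1 := (hU.comm i k j k hik' hjk (by omega) (by omega)).pow_left m
      rw [c1.mul_pow, ← pow_mul, mul_inv_eq_iff_eq_mul] at h2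
      rw [h2, pow_succ', mul_assoc]
    have hW : Commute (U i k ^ m ^ (h + 1)) (U j k ^ a * U i j) :=
      ((((hU.comm i k j k hik' hjk (by omega) (by omega)).pow_right a).mul_right
        (hU.comm i k i j hik' hij (by omega) (by omega)))).pow_left _
    set W := U j k ^ a * U i j with hWdef
    have hWF : ∀ x ∈ filtration U l, (W : Module.End K V) x ∈ filtration U l := by
      intro x hx
      simp only [hWdef, Units.val_mul, Units.val_pow_eq_pow_val, Module.End.mul_apply]
      exact pow_apply_mem (fun v hv => apply_mem_filtration hjk hv) (apply_mem_filtration hij hx) a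
    have hWinj : Function.Injective (W : Module.End K V) :=
      Function.LeftInverse.injective (g := ((W⁻¹ : (Module.End K V)ˣ) : Module.End K V)) fun v => by
        rw [← Module.End.mul_apply, Units.inv_mul]; rfl
    -- After applying `W = y x`, with `x = U i j` and `y = U j k ^ a`, the claim concerns `x y v - y
    -- x v`, which equals `(x - 1)(y - 1) v - (y - 1)(x - 1) v`.
    refine Module.End.mem_of_apply_mem hWinj hWF ?_
    have e1 := congrArg (fun A : (Module.End K V)ˣ => (A : Module.End K V) v) hrel
    have e2 := congrArg (fun A : (Module.End K V)ˣ => (A : Module.End K V) v) hW.eq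
    simp only [Units.val_mul, Units.val_pow_eq_pow_val, Module.End.mul_apply] at e1 e2
    rw [map_sub, ← e2, ← e1]
    simp only [hWdef, Units.val_mul, Units.val_pow_eq_pow_val, Module.End.mul_apply]
    set x := (U i j : Module.End K V) with hx
    set y := (U j k : Module.End K V) ^ a with hy
    have h3 : y v - v ∈ filtration U (l + 1) :=
      ih j k hjk' (l + 1) v (by convert hv using 2; ring)
    have h4 : x v - v ∈ filtration U (l + (h + 1)) := mem_filtration_succ.mp hv i j hij
    have h5 := mem_filtration_succ.mp h3 i j hij
    have h6 := ih j k hjk' l _ h4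
    have h7 := (filtration U l).sub_mem h5 h6
    simp only [map_sub] at h7
    convert h7 using 1
    abel

/-- For the highest root, step `n - 1` of the filtration lies in the kernel and has dimension at
least `n - 1`. -/
theorem finrank_range_le_one [FiniteDimensional K V] (hU : IsUnitriangularFamily m U)
    (hn : Module.finrank K V = n) {i k : Fin n} (h : ℕ) (hi : i.val = 0) (hk : k.val = h + 1)
    (hkn : k.val + 1 = n) :
    Module.finrank K (LinearMap.range ((U i k : Module.End K V) ^ (m ^ h) - 1)) ≤ 1 := by
  have h1 := hU.le_finrank_filtration (h + 1) (by omega)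
  have h2 : filtration U (h + 1) ≤ LinearMap.ker ((U i k : Module.End K V) ^ (m ^ h) - 1) := by
    intro v hv
    have := hU.pow_apply_sub_mem_filtration h i k (by omega) 0 v (by simpa using hv)
    simpa [filtration] using this
  have h3 := Submodule.finrank_mono h2
  have h4 := LinearMap.finrank_range_add_finrank_ker ((U i k : Module.End K V) ^ (m ^ h) - 1)
  omega

end IsUnitriangularFamily

end Unitriangular

/-! ### Matrix units -/

namespace Matrix

section MatrixUnits

variable {n : ℕ} {R : Type*} [CommRing R] [IsDomain R] [IsPrincipalIdealRing R]

/-- Over a principal ideal domain, `n × n` matrix units in `Matrix (Fin n) (Fin n) R` are conjugate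
to the standard ones. -/
theorem exists_conj_single {E : Fin n → Fin n → Matrix (Fin n) (Fin n) R}
    (hE : ∀ i j k l, E i j * E k l = if j = k then E i l else 0) (o : Fin n) (h0 : E o o ≠ 0) :
    ∃ g : GL (Fin n) R, ∀ i j, E i j * g.val = g.val * single i j 1 := by
  classical
  let L : Submodule R (Fin n → R) := LinearMap.range (E o o).mulVecLin
  have hL : ∀ x ∈ L, E o o *ᵥ x = x := by
    rintro _ ⟨y, rfl⟩
    rw [mulVecLin_apply, mulVec_mulVec, hE, if_pos rfl]
  obtain ⟨a, ha, p, hp⟩ : ∃ a ∈ L, ∃ p, a p ≠ 0 := by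
    by_contra! h
    apply h0
    ext i j
    have := h (E o o *ᵥ Pi.single j 1) ⟨_, rfl⟩ i
    simpa using this
  -- The `p`-th coordinates of `L` form an ideal. A vector of `L` whose `p`-th coordinate generates
  -- it will turn out to generate `L`.
  obtain ⟨d, hd⟩ := (inferInstance : (L.map (LinearMap.proj p : (Fin n → R) →ₗ[R] R)).IsPrincipal)
  have hdmem : d ∈ L.map (LinearMap.proj p : (Fin n → R) →ₗ[R] R) := by
    rw [hd]; exact Submodule.mem_span_singleton_self d
  obtain ⟨x, hx, hxd⟩ := hdmem
  rw [LinearMap.proj_apply] at hxd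
  have hdvd : ∀ y ∈ L, ∃ c, y p = c * d := by
    intro y hy
    have : y p ∈ L.map (LinearMap.proj p : (Fin n → R) →ₗ[R] R) := ⟨y, hy, rfl⟩
    rw [hd, Submodule.mem_span_singleton] at this
    obtain ⟨c, hc⟩ := this
    exact ⟨c, hc.symm⟩
  have hd0 : d ≠ 0 := by
    rintro rfl
    obtain ⟨c, hc⟩ := hdvd a ha
    exact hp (by rw [hc, mul_zero])
  have hx0 : x ≠ 0 := by
    rintro rfl
    exact hd0 hxd.symm
  -- The conjugating matrix has columns `E i o x`; `E i j` sends column `j` to column `i` and kills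
  -- the others.
  let A : Matrix (Fin n) (Fin n) R := Matrix.of fun r i => (E i o *ᵥ x) r
  have hA : ∀ w, A *ᵥ w = ∑ i, w i • (E i o *ᵥ x) := by
    intro w
    ext r
    simp [A, mulVec, dotProduct, mul_comm]
  have hEA : ∀ i j w, E i j *ᵥ (A *ᵥ w) = w j • (E i o *ᵥ x) := by
    intro i j w
    rw [hA, mulVec_sum, Finset.sum_eq_single j]
    · rw [mulVec_smul, mulVec_mulVec, hE, if_pos rfl]
    · intro k _ hk
      rw [mulVec_smul, mulVec_mulVec, hE, if_neg hk.symm, zero_mulVec, smul_zero]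
    · simp
  have hdet : A.det ≠ 0 := by
    intro h
    obtain ⟨w, hw, hAw⟩ := exists_mulVec_eq_zero_iff.mpr h
    apply hw
    ext j
    have := hEA o j w
    rw [hAw, mulVec_zero, hL x hx] at this
    exact (smul_eq_zero.mp this.symm).resolve_right hx0
  -- The adjugate replaces the inverse: `det A • y` is a combination of the columns, and `E o o`
  -- makes it a multiple of `x`. A vanishing `p`-th coordinate kills the coefficient.
  have hinj : ∀ y ∈ L, y p = 0 → y = 0 := by
    intro y hy hyp
    have h1 := hEA o o (A.adjugate *ᵥ y)
    rw [mulVec_mulVec _ A, mul_adjugate, smul_mulVec, one_mulVec, mulVec_smul, hL y hy, hL x hx] at h1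
    have h2 := congrFun h1 p
    rw [Pi.smul_apply, Pi.smul_apply, hyp, smul_zero, hxd] at h2
    rw [(smul_eq_zero.mp h2.symm).resolve_right hd0, zero_smul] at h1
    exact (smul_eq_zero.mp h1).resolve_left hdet
  have hmul : ∀ y ∈ L, ∃ c : R, y = c • x := by
    intro y hy
    obtain ⟨c, hc⟩ := hdvd y hy
    refine ⟨c, sub_eq_zero.mp (hinj _ (L.sub_mem hy (L.smul_mem c hx)) ?_)⟩
    simp [hc, hxd]
  have hsum : ∑ i, E i i = 1 := by
    have h1 : (∑ i, E i i - 1) * A = 0 := by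
      refine ext_of_mulVec_single fun j => ?_
      rw [← mulVec_mulVec, sub_mulVec, one_mulVec, sum_mulVec, zero_mulVec]
      simp_rw [hEA]
      rw [← hA, sub_self]
    have h2 : (∑ i, E i i - 1) * (A * A.adjugate) = 0 := by rw [← mul_assoc, h1, zero_mul]
    rw [mul_adjugate, Matrix.mul_smul, mul_one] at h2
    exact sub_eq_zero.mp ((smul_eq_zero.mp h2).resolve_left hdet)
  have hsurj : Function.Surjective A.mulVec := by
    intro y
    have : ∀ i, ∃ c : R, E o i *ᵥ y = c • x := by
      intro i
      refine hmul _ ⟨E o i *ᵥ y, ?_⟩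
      rw [mulVecLin_apply, mulVec_mulVec, hE, if_pos rfl]
    choose c hc using this
    refine ⟨c, ?_⟩
    rw [hA]
    have h1 : ∀ i, c i • (E i o *ᵥ x) = E i i *ᵥ y := by
      intro i
      rw [← mulVec_smul, ← hc, mulVec_mulVec, hE, if_pos rfl]
    simp_rw [h1]
    rw [← sum_mulVec, hsum, one_mulVec]
  obtain ⟨g, hg⟩ := mulVec_surjective_iff_isUnit.mp hsurj
  refine ⟨g, fun i j => ?_⟩
  rw [hg]
  refine ext_of_mulVec_single fun k => ?_
  rw [← mulVec_mulVec, hEA, ← mulVec_mulVec, hA, Finset.sum_eq_single i]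
  · simp [Pi.single_apply, single_apply]
  · intro l _ hl
    simp [hl.symm]
  · simp

/-- A family `E i j`, `i ≠ j`, multiplying like off-diagonal matrix units extends to
a family of matrix units. -/
theorem exists_matrixUnits {S : Type*} [Ring S] (hn : 3 ≤ n) {N : Fin n → Fin n → S}
    (h1 : ∀ i j k, i ≠ j → j ≠ k → i ≠ k → N i j * N j k = N i k)
    (h0 : ∀ i j k l, i ≠ j → k ≠ l → j ≠ k → N i j * N k l = 0) :
    ∃ E : Fin n → Fin n → S, (∀ i j, i ≠ j → E i j = N i j) ∧
      ∀ i j k l, E i j * E k l = if j = k then E i l else 0 := by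
  have third : ∀ i j : Fin n, ∃ k, k ≠ i ∧ k ≠ j := by
    intro i j
    obtain ⟨k, -, hk⟩ := Finset.exists_mem_notMem_of_card_lt_card (s := {i, j}) (t := Finset.univ)
      (lt_of_le_of_lt Finset.card_le_two (by simp; omega))
    exact ⟨k, by simpa using hk⟩
  choose o ho using fun i => third i i
  have hdiag : ∀ i j k, i ≠ j → i ≠ k → N i j * N j i = N i k * N k i := by
    intro i j k hij hik
    by_cases hjk : j = k
    · rw [hjk]
    · rw [← h1 i k j hik (Ne.symm hjk) hij, mul_assoc, h1 k j i (Ne.symm hjk) hij.symm hik.symm]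
  have hself : ∀ i j, i ≠ j → N i j * N j i * N i j = N i j := by
    intro i j hij
    obtain ⟨k, hki, hkj⟩ := third i j
    rw [hdiag i j k hij hki.symm, mul_assoc, h1 k i j hki hij hkj, h1 i k j hki.symm hkj hij]
  -- `N i k * N k i` does not depend on `k ≠ i` (`hdiag`); `o i` is one choice of `k`.
  let E : Fin n → Fin n → S := fun i j => if i = j then N i (o i) * N (o i) i else N i j
  have hEne : ∀ i j, i ≠ j → E i j = N i j := fun i j h => if_neg h
  have hEeq : ∀ i j, i ≠ j → E i i = N i j * N j i := fun i j h => by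
    simp only [E, if_true]
    exact hdiag i (o i) j (ho i).1.symm h
  refine ⟨E, hEne, ?_⟩
  intro i j k l
  by_cases hjk : j = k
  · subst hjk
    rw [if_pos rfl]
    by_cases hij : i = j
    · subst hij
      by_cases hil : i = l
      · subst hil
        rw [hEeq i (o i) (ho i).1.symm, ← mul_assoc, hself _ _ (ho i).1.symm]
      · rw [hEeq i l hil, hEne i l hil, hself _ _ hil]
    · by_cases hjl : j = l
      · subst hjl
        rw [hEeq j i (Ne.symm hij), hEne i j hij, ← mul_assoc, hself _ _ hij]
      · by_cases hil : i = l
        · subst hil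
          rw [hEeq i j hij, hEne i j hij, hEne j i hjl]
        · rw [hEne i j hij, hEne j l hjl, hEne i l hil, h1 i j l hij hjl hil]
  · rw [if_neg hjk]
    -- Factoring an off-diagonal unit through a third index, and a diagonal one by definition,
    -- reduces the remaining vanishing products to `h0`.
    have hl : ∀ i j, ∃ (A : S) (b : Fin n), b ≠ j ∧ E i j = A * N b j := by
      intro i j
      by_cases hij : i = j
      · subst hij
        exact ⟨_, _, (ho i).1, hEeq i (o i) (ho i).1.symm⟩
      · obtain ⟨b, hbi, hbj⟩ := third i j
        exact ⟨N i b, b, hbj, by rw [hEne i j hij, h1 i b j hbi.symm hbj hij]⟩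
    have hr : ∀ k l, ∃ (B : S) (b : Fin n), b ≠ k ∧ E k l = N k b * B := by
      intro k l
      by_cases hkl : k = l
      · subst hkl
        exact ⟨_, _, (ho k).1, hEeq k (o k) (ho k).1.symm⟩
      · obtain ⟨b, hbk, hbl⟩ := third k l
        exact ⟨N b l, b, hbk, by rw [hEne k l hkl, h1 k b l hbk.symm hbl hkl]⟩
    obtain ⟨A, b, hb, hA⟩ := hl i j
    obtain ⟨B, c, hc, hB⟩ := hr k l
    rw [hA, hB, mul_assoc, ← mul_assoc (N b j), h0 b j k c hb hc.symm hjk, zero_mul, mul_zero]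

end MatrixUnits

end Matrix

/-! ### Equality up to sign -/

/-- Equality up to sign. -/
def SignEq {G : Type*} [Neg G] (a b : G) : Prop := a = b ∨ a = -b

namespace SignEq

theorem refl {G : Type*} [Neg G] (a : G) : SignEq a a := Or.inl rfl

theorem symm {G : Type*} [InvolutiveNeg G] {a b : G} (h : SignEq a b) : SignEq b a := by
  rcases h with rfl | rfl
  · exact Or.inl rfl
  · exact Or.inr (neg_neg b).symm

theorem trans {G : Type*} [InvolutiveNeg G] {a b c : G} (h : SignEq a b) (h' : SignEq b c) :
    SignEq a c := by
  rcases h with rfl | rfl <;> rcases h' with rfl | rfl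
  · exact Or.inl rfl
  · exact Or.inr rfl
  · exact Or.inr rfl
  · exact Or.inl (neg_neg c)

theorem mul {G : Type*} [Mul G] [HasDistribNeg G] {a b c d : G} (h : SignEq a b)
    (h' : SignEq c d) : SignEq (a * c) (b * d) := by
  rcases h with rfl | rfl <;> rcases h' with rfl | rfl
  · exact Or.inl rfl
  · exact Or.inr (mul_neg _ _)
  · exact Or.inr (neg_mul _ _)
  · exact Or.inl (neg_mul_neg _ _)

theorem pow {G : Type*} [Monoid G] [HasDistribNeg G] {a b : G} (h : SignEq a b) (k : ℕ) :
    SignEq (a ^ k) (b ^ k) := by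
  induction k with
  | zero => simpa using refl (1 : G)
  | succ k ih => rw [pow_succ, pow_succ]; exact ih.mul h

theorem inv {G : Type*} [Group G] [HasDistribNeg G] {a b : G} (h : SignEq a b) :
    SignEq a⁻¹ b⁻¹ := by
  rcases h with rfl | rfl
  · exact Or.inl rfl
  · exact Or.inr (by rw [inv_eq_iff_mul_eq_one]; simp)

theorem commute_sq {G : Type*} [Monoid G] [HasDistribNeg G] {a b : G}
    (h : SignEq (a * b) (b * a)) : Commute (a ^ 2) b := by
  rcases h with h | h
  · exact Commute.pow_left h 2
  · rw [Commute, SemiconjBy, sq, mul_assoc, h, mul_neg, ← mul_assoc, h, neg_mul, neg_neg, mul_assoc]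

end SignEq

/-! ### Unipotent units -/

section Unipotent

variable {S : Type*} [Ring S]

/-- A unit `y` such that `y - 1` is nilpotent. -/
def IsUnipotentUnit (y : Sˣ) : Prop := IsNilpotent ((y : S) - 1)

namespace IsUnipotentUnit

theorem conj {y : Sˣ} (hy : IsUnipotentUnit y) (h : Sˣ) : IsUnipotentUnit (h * y * h⁻¹) := by
  obtain ⟨k, hk⟩ := hy
  refine ⟨k, ?_⟩
  have h1 : ((h * y * h⁻¹ : Sˣ) : S) - 1 = h * ((y : S) - 1) * (h⁻¹ : Sˣ) := by
    simp [mul_sub, sub_mul]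
  rw [h1, Units.conj_pow, hk]
  simp

theorem mul {y z : Sˣ} (hy : IsUnipotentUnit y) (hz : IsUnipotentUnit z) (h : Commute y z) :
    IsUnipotentUnit (y * z) := by
  have hc : Commute (y : S) (z : S) := congrArg Units.val h.eq
  have h1 : ((y * z : Sˣ) : S) - 1 = ((y : S) - 1) * z + (z - 1) := by
    simp [sub_mul]
  rw [IsUnipotentUnit, h1]
  have hyz : Commute ((y : S) - 1) (z : S) := hc.sub_left (Commute.one_left _)
  refine Commute.isNilpotent_add ?_ (hyz.isNilpotent_mul_right hy) hz
  exact Commute.sub_right (hyz.mul_left (Commute.refl _)) (Commute.one_right _)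

theorem one : IsUnipotentUnit (1 : Sˣ) := by
  simp [IsUnipotentUnit]

theorem pow {y : Sˣ} (hy : IsUnipotentUnit y) (k : ℕ) : IsUnipotentUnit (y ^ k) := by
  induction k with
  | zero => simpa using one
  | succ k ih => rw [pow_succ]; exact ih.mul hy (Commute.pow_left (Commute.refl y) k)

theorem inv {y : Sˣ} (hy : IsUnipotentUnit y) : IsUnipotentUnit y⁻¹ := by
  have h1 : ((y⁻¹ : Sˣ) : S) - 1 = -((y⁻¹ : Sˣ) * ((y : S) - 1)) := by
    simp [mul_sub]
  rw [IsUnipotentUnit, h1]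
  have hc : Commute ((y⁻¹ : Sˣ) : S) ((y : S) - 1) :=
    Commute.sub_right (by simp [Commute, SemiconjBy]) (Commute.one_right _)
  exact (hc.isNilpotent_mul_left hy).neg

/-- If `y = -z`, then `-2 = (y - 1) + (z - 1)` would be a sum of commuting nilpotents, yet it is
invertible. This is what removes the sign ambiguity. -/
theorem eq_of_signEq [Algebra ℚ S] [Nontrivial S] {y z : Sˣ} (hy : IsUnipotentUnit y)
    (hz : IsUnipotentUnit z) (h : SignEq y z) : y = z := by
  rcases h with h | rfl
  · exact h
  · exfalso
    have h1 : IsNilpotent ((((-z : Sˣ) : S) - 1) + ((z : S) - 1)) := by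
      refine Commute.isNilpotent_add ?_ hy hz
      simp [Commute, SemiconjBy, mul_sub, sub_mul]
      abel
    have h2 : (((-z : Sˣ) : S) - 1) + ((z : S) - 1) = algebraMap ℚ S (-2) := by
      rw [map_neg, map_ofNat, Units.val_neg, ← one_add_one_eq_two]
      abel
    rw [h2] at h1
    exact h1.not_isUnit ((IsUnit.mk0 (-2 : ℚ) (by norm_num)).map (algebraMap ℚ S))

end IsUnipotentUnit

end Unipotent

/-! ### Relations between elementary matrices -/

namespace Matrix.SpecialLinearGroup

section

variable {ι : Type*} [Fintype ι] [DecidableEq ι] {R : Type*} [CommRing R]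

theorem transvection_commute {i j k l : ι} (hij : i ≠ j) (hkl : k ≠ l) (hjk : j ≠ k) (hil : i ≠ l)
    (a b : R) : transvection hij a * transvection hkl b = transvection hkl b * transvection hij a := by
  apply Subtype.ext
  simp only [coe_mul, transvection_coe, mul_add, add_mul, one_mul, mul_one,
    single_mul_single_of_ne _ _ _ _ hjk, single_mul_single_of_ne _ _ _ _ hil.symm, add_zero]
  abel

theorem transvection_mul_transvection {i j k : ι} (hij : i ≠ j) (hjk : j ≠ k) (hik : i ≠ k)
    (a b : R) : transvection hij a * transvection hjk b =
      transvection hik (a * b) * transvection hjk b * transvection hij a := by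
  apply Subtype.ext
  simp only [coe_mul, transvection_coe, mul_add, add_mul, one_mul, mul_one,
    single_mul_single_same, single_mul_single_of_ne _ _ _ _ hjk.symm,
    single_mul_single_of_ne _ _ _ _ hik.symm, add_zero]
  abel

theorem transvection_pow {i j : ι} (h : i ≠ j) (a : R) (k : ℕ) :
    transvection h a ^ k = transvection h (k * a) := by
  induction k with
  | zero => simp
  | succ k ih =>
    rw [pow_succ, ih, ← transvection_add]
    congr 1
    push_cast
    ring

theorem transvection_not_signEq_one {i j : ι} (h : i ≠ j) {a : R} (ha : a ≠ 0) :
    ¬ SignEq (transvection h a).1 1 := by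
  rintro (h1 | h1)
  all_goals
    have := congrFun (congrFun h1 i) j
    simp [transvection_coe, h] at this
    exact ha this

end

end Matrix.SpecialLinearGroup

/-! ### Maps `SL(n, ℤ) → SL(n, ℤ)` that are injective homomorphisms up to sign -/

open Matrix Matrix.SpecialLinearGroup

/-- A map `SL(n, ℤ) → SL(n, ℤ)` that is multiplicative and injective up to sign. -/
structure IsSignHom {n : ℕ} (Φ : SL(n, ℤ) → SL(n, ℤ)) : Prop where
  map_mul : ∀ x y, SignEq (Φ (x * y)).1 (Φ x * Φ y).1
  eq_one : ∀ x, SignEq (Φ x).1 1 → SignEq x.1 1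

namespace IsSignHom

variable {n : ℕ} {Φ : SL(n, ℤ) → SL(n, ℤ)}

/-- The value of a map `SL(n, ℤ) → SL(n, ℤ)`, regarded as a rational matrix. -/
noncomputable def rat (Φ : SL(n, ℤ) → SL(n, ℤ)) (x : SL(n, ℤ)) : GL (Fin n) ℚ := mapGL ℚ (Φ x)

theorem coe_rat (x : SL(n, ℤ)) : (rat Φ x).1 = (Φ x).1.map (Int.castRingHom ℚ) := rfl

theorem signEq_rat_of_signEq {x : SL(n, ℤ)} {y : SL(n, ℤ)} (h : SignEq (Φ x).1 y.1) :
    SignEq (rat Φ x) (mapGL ℚ y) := by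
  rcases h with h | h
  · left
    apply Units.ext
    rw [coe_rat, h]
    rfl
  · right
    apply Units.ext
    rw [coe_rat, h, Units.val_neg]
    ext i j
    simp

theorem rat_mul (hΦ : IsSignHom Φ) (x y : SL(n, ℤ)) :
    SignEq (rat Φ (x * y)) (rat Φ x * rat Φ y) := by
  have := signEq_rat_of_signEq (hΦ.map_mul x y)
  rwa [_root_.map_mul] at this

theorem signEq_one_of_rat (hΦ : IsSignHom Φ) {x : SL(n, ℤ)} (h : SignEq (rat Φ x) 1) :
    SignEq x.1 1 := by
  apply hΦ.eq_one
  have hinj := Matrix.map_injective (m := Fin n) (n := Fin n) (RingHom.injective_int (Int.castRingHom ℚ))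
  rcases h with h | h
  · left
    apply hinj
    change (Φ x).1.map (Int.castRingHom ℚ) = _
    rw [← coe_rat, h]
    ext i j
    simp [Matrix.one_apply]
  · right
    apply hinj
    change (Φ x).1.map (Int.castRingHom ℚ) = _
    rw [← coe_rat, h]
    ext i j
    simp [Matrix.one_apply]

theorem rat_one (hΦ : IsSignHom Φ) : SignEq (rat Φ 1) 1 := by
  have h := hΦ.rat_mul 1 1
  rw [mul_one] at h
  have h2 := (SignEq.refl (rat Φ 1)⁻¹).mul h
  rw [inv_mul_cancel, inv_mul_cancel_left] at h2
  exact h2.symm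

theorem rat_inv (hΦ : IsSignHom Φ) (x : SL(n, ℤ)) : SignEq (rat Φ x⁻¹) (rat Φ x)⁻¹ := by
  have h := (hΦ.rat_mul x x⁻¹).symm
  rw [mul_inv_cancel] at h
  have h2 := (SignEq.refl (rat Φ x)⁻¹).mul (h.trans hΦ.rat_one)
  rwa [inv_mul_cancel_left, mul_one] at h2

theorem rat_pow (hΦ : IsSignHom Φ) (x : SL(n, ℤ)) (k : ℕ) :
    SignEq (rat Φ (x ^ k)) (rat Φ x ^ k) := by
  induction k with
  | zero => simpa using hΦ.rat_one
  | succ k ih => rw [pow_succ, pow_succ]; exact (hΦ.rat_mul _ _).trans (ih.mul (SignEq.refl _))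

/-- `y` is a unipotent matrix equal to `Φ x` up to sign. -/
structure IsUnipotentLift (Φ : SL(n, ℤ) → SL(n, ℤ)) (x : SL(n, ℤ)) (y : GL (Fin n) ℚ) : Prop where
  unip : IsUnipotentUnit y
  signEq : SignEq y (rat Φ x)

namespace IsUnipotentLift

theorem unique [NeZero n] {x : SL(n, ℤ)} {y z : GL (Fin n) ℚ} (hy : IsUnipotentLift Φ x y)
    (hz : IsUnipotentLift Φ x z) : y = z :=
  hy.unip.eq_of_signEq hz.unip (hy.signEq.trans hz.signEq.symm)

theorem conj (hΦ : IsSignHom Φ) {x : SL(n, ℤ)} {y : GL (Fin n) ℚ} (hy : IsUnipotentLift Φ x y)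
    (h : SL(n, ℤ)) {w : GL (Fin n) ℚ} (hw : SignEq w (rat Φ h)) :
    IsUnipotentLift Φ (h * x * h⁻¹) (w * y * w⁻¹) where
  unip := hy.unip.conj w
  signEq := ((hw.mul hy.signEq).mul (hw.inv.trans (hΦ.rat_inv h).symm)).trans
    (((hΦ.rat_mul _ _).trans ((hΦ.rat_mul _ _).mul (SignEq.refl _))).symm)

/-- `y y' y⁻¹` and `y'` are unipotent lifts of the same element, so uniqueness turns a relation up
to sign into an exact one. -/
theorem commute [NeZero n] (hΦ : IsSignHom Φ) {x x' : SL(n, ℤ)} {y y' : GL (Fin n) ℚ}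
    (hy : IsUnipotentLift Φ x y) (hy' : IsUnipotentLift Φ x' y') (h : x * x' = x' * x) :
    Commute y y' := by
  have h1 := hy'.conj hΦ x hy.signEq
  rw [h, mul_inv_cancel_right] at h1
  exact mul_inv_eq_iff_eq_mul.mp (h1.unique hy')

theorem mul [NeZero n] (hΦ : IsSignHom Φ) {x x' : SL(n, ℤ)} {y y' : GL (Fin n) ℚ}
    (hy : IsUnipotentLift Φ x y) (hy' : IsUnipotentLift Φ x' y') (h : x * x' = x' * x) :
    IsUnipotentLift Φ (x * x') (y * y') where
  unip := hy.unip.mul hy'.unip (hy.commute hΦ hy' h)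
  signEq := (hy.signEq.mul hy'.signEq).trans (hΦ.rat_mul _ _).symm

theorem pow (hΦ : IsSignHom Φ) {x : SL(n, ℤ)} {y : GL (Fin n) ℚ}
    (hy : IsUnipotentLift Φ x y) (k : ℕ) : IsUnipotentLift Φ (x ^ k) (y ^ k) where
  unip := hy.unip.pow k
  signEq := (hy.signEq.pow k).trans (hΦ.rat_pow x k).symm

theorem inv (hΦ : IsSignHom Φ) {x : SL(n, ℤ)} {y : GL (Fin n) ℚ}
    (hy : IsUnipotentLift Φ x y) : IsUnipotentLift Φ x⁻¹ y⁻¹ where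
  unip := hy.unip.inv
  signEq := hy.signEq.inv.trans (hΦ.rat_inv x).symm

end IsUnipotentLift

/-- The images `X`, `Y` of the elementary matrices at `(i, j)`, `(j, k)` commute with the image `Z`
of that at `(i, k)` only up to sign; squaring repairs this. The commutator of `X²` and `Y²` is `W =
± Z⁴`, which commutes with both, so `W ^ n!` is unipotent. Hence the exponent `4 * n!`. -/
theorem exists_isUnipotentLift (hΦ : IsSignHom Φ) {i j k : Fin n} (hij : i ≠ j) (hjk : j ≠ k)
    (hik : i ≠ k) : ∃ y, IsUnipotentLift Φ (transvection hik ((4 * n.factorial : ℕ) : ℤ)) y := by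
  set X := rat Φ (transvection hij 1) with hX
  set Y := rat Φ (transvection hjk 1) with hY
  set Z := rat Φ (transvection hik 1) with hZ
  have hXZ : Commute (X ^ 2) Z := by
    apply SignEq.commute_sq
    refine (hΦ.rat_mul _ _).symm.trans ?_
    rw [transvection_commute hij hik hij.symm hik]
    exact hΦ.rat_mul _ _
  have hYZ : Commute (Y ^ 2) Z := by
    apply SignEq.commute_sq
    refine (hΦ.rat_mul _ _).symm.trans ?_
    rw [transvection_commute hjk hik hik.symm hjk]
    exact hΦ.rat_mul _ _
  have hrel : SignEq (X ^ 2 * Y ^ 2) (Z ^ 4 * Y ^ 2 * X ^ 2) := by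
    have h1 : (transvection hij (1 : ℤ)) ^ 2 * (transvection hjk (1 : ℤ)) ^ 2 =
        (transvection hik (1 : ℤ)) ^ 4 * (transvection hjk (1 : ℤ)) ^ 2 *
          (transvection hij (1 : ℤ)) ^ 2 := by
      simp only [transvection_pow]
      rw [transvection_mul_transvection hij hjk hik]
      norm_num
    refine (((hΦ.rat_mul _ _).trans ((hΦ.rat_pow _ _).mul (hΦ.rat_pow _ _))).symm).trans ?_
    rw [h1]
    exact (hΦ.rat_mul _ _).trans (((hΦ.rat_mul _ _).trans
      ((hΦ.rat_pow _ _).mul (hΦ.rat_pow _ _))).mul (hΦ.rat_pow _ _))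
  obtain ⟨W, hW, hWX, hWY, hWrel⟩ : ∃ W, SignEq W (Z ^ 4) ∧ Commute W (X ^ 2) ∧ Commute W (Y ^ 2) ∧
      X ^ 2 * Y ^ 2 = W * Y ^ 2 * X ^ 2 := by
    rcases hrel with h | h
    · exact ⟨Z ^ 4, Or.inl rfl, (hXZ.pow_right 4).symm, (hYZ.pow_right 4).symm, h⟩
    · exact ⟨-Z ^ 4, Or.inr rfl, (hXZ.pow_right 4).symm.neg_left, (hYZ.pow_right 4).symm.neg_left,
        by rw [h, neg_mul, neg_mul]⟩
  refine ⟨W ^ n.factorial, ?_, ?_⟩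
  · have := Matrix.isNilpotent_pow_sub_one_of_commutator hWrel hWX hWY
    simpa [IsUnipotentUnit] using this
  · refine (hW.pow _).trans ?_
    rw [← pow_mul]
    refine (hΦ.rat_pow _ _).symm.trans ?_
    rw [transvection_pow, mul_one]
    exact SignEq.refl _

/-- `T i j` are unipotent lifts of the images of the `m`-th powers of the elementary matrices. -/
def IsLiftFamily (Φ : SL(n, ℤ) → SL(n, ℤ)) (m : ℕ) (T : Fin n → Fin n → GL (Fin n) ℚ) : Prop :=
  ∀ i j (h : i ≠ j), IsUnipotentLift Φ (transvection h (m : ℤ)) (T i j)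

theorem exists_isLiftFamily (hΦ : IsSignHom Φ) (hn : 3 ≤ n) :
    ∃ m T, 0 < m ∧ IsLiftFamily Φ m T := by
  have : ∀ i j : Fin n, ∃ y : GL (Fin n) ℚ, ∀ h : i ≠ j,
      IsUnipotentLift Φ (transvection h ((4 * n.factorial : ℕ) : ℤ)) y := by
    intro i j
    by_cases h : i = j
    · exact ⟨1, fun h' => absurd h h'⟩
    · obtain ⟨k, -, hk⟩ := Finset.exists_mem_notMem_of_card_lt_card (s := {i, j})
        (t := Finset.univ) (lt_of_le_of_lt Finset.card_le_two (by simp; omega))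
      obtain ⟨hki, hkj⟩ : k ≠ i ∧ k ≠ j := by simpa using hk
      obtain ⟨y, hy⟩ := hΦ.exists_isUnipotentLift (Ne.symm hki) hkj h
      exact ⟨y, fun _ => hy⟩
  choose T hT using this
  exact ⟨_, T, by positivity, fun i j h => hT i j h⟩

namespace IsLiftFamily

variable {m : ℕ} {T : Fin n → Fin n → GL (Fin n) ℚ}

theorem commute [NeZero n] (hΦ : IsSignHom Φ) (hT : IsLiftFamily Φ m T) {i j k l : Fin n}
    (hij : i ≠ j) (hkl : k ≠ l) (hjk : j ≠ k) (hil : i ≠ l) : Commute (T i j) (T k l) :=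
  (hT i j hij).commute hΦ (hT k l hkl) (transvection_commute hij hkl hjk hil _ _)

/-- The commutator of the `m`-th powers at `(i, j)` and `(j, k)` is the `m²`-th power at `(i, k)`,
that is, the `m`-th power of its own `m`-th power. Uniqueness of unipotent lifts transports this. -/
theorem mul_eq [NeZero n] (hΦ : IsSignHom Φ) (hT : IsLiftFamily Φ m T) {i j k : Fin n}
    (hij : i ≠ j) (hjk : j ≠ k) (hik : i ≠ k) : T i j * T j k = T i k ^ m * T j k * T i j := by
  have h1 := (hT j k hjk).conj hΦ (transvection hij (m : ℤ)) (hT i j hij).signEq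
  have h2 := ((hT i k hik).pow hΦ m).mul hΦ (hT j k hjk) (by
    rw [transvection_pow]
    exact transvection_commute hik hjk hjk.symm hik _ _)
  have h3 : transvection hij (m : ℤ) * transvection hjk (m : ℤ) * (transvection hij (m : ℤ))⁻¹ =
      transvection hik (m : ℤ) ^ m * transvection hjk (m : ℤ) := by
    rw [transvection_pow, transvection_mul_transvection hij hjk hik, mul_inv_cancel_right]
  rw [h3] at h1
  exact mul_inv_eq_iff_eq_mul.mp (h1.unique h2)

theorem pow (hΦ : IsSignHom Φ) (hT : IsLiftFamily Φ m T) (k : ℕ) :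
    IsLiftFamily Φ (m * k) (fun i j => T i j ^ k) := by
  intro i j h
  have := (hT i j h).pow hΦ k
  rw [transvection_pow] at this
  convert this using 2
  push_cast
  ring

end IsLiftFamily

theorem exists_vecMulVec {A : Matrix (Fin n) (Fin n) ℚ}
    (hA : Module.finrank ℚ (LinearMap.range A.mulVecLin) ≤ 1) :
    ∃ a f : Fin n → ℚ, A = vecMulVec a f := by
  obtain ⟨v, hv⟩ := finrank_le_one_iff.mp hA
  have : ∀ j, ∃ c : ℚ, c • v.1 = A *ᵥ Pi.single j 1 := by
    intro j
    obtain ⟨c, hc⟩ := hv ⟨A *ᵥ Pi.single j 1, _, rfl⟩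
    exact ⟨c, congrArg Subtype.val hc⟩
  choose f hf using this
  refine ⟨v.1, f, ?_⟩
  ext i j
  have := congrFun (hf j) i
  simp only [Pi.smul_apply, smul_eq_mul, mulVec_single_one, col_apply] at this
  rw [vecMulVec_apply, ← this, mul_comm]

theorem exists_isLiftFamily_vecMulVec (hΦ : IsSignHom Φ) (hn : 3 ≤ n) :
    ∃ m T, 0 < m ∧ IsLiftFamily Φ m T ∧
      ∀ i j, i ≠ j → ∃ a f : Fin n → ℚ, (T i j).1 - 1 = vecMulVec a f := by
  have : NeZero n := ⟨by omega⟩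
  obtain ⟨m, T, hm, hT⟩ := hΦ.exists_isLiftFamily hn
  refine ⟨m * m ^ (n - 2), _, by positivity, hT.pow hΦ _, ?_⟩
  intro i j hij
  let z : Fin n := ⟨0, by omega⟩
  let l : Fin n := ⟨n - 1, by omega⟩
  have hzl : z ≠ l := by
    rw [Ne, Fin.ext_iff]
    simp [z, l]
    omega
  -- Reordering the indices by `σ` makes `(i, j)` the highest root, of height `n - 1`; its power
  -- with exponent `m ^ (n - 2)` is then `1` plus a matrix of rank at most one.
  obtain ⟨σ, hσi, hσj⟩ : ∃ σ : Equiv.Perm (Fin n), σ z = i ∧ σ l = j := by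
    refine ⟨(Equiv.swap z i).trans (Equiv.swap (Equiv.swap z i l) j), ?_, ?_⟩
    · rw [Equiv.trans_apply, Equiv.swap_apply_left]
      refine Equiv.swap_apply_of_ne_of_ne ?_ hij
      intro h
      apply hzl
      apply (Equiv.swap z i).injective
      rw [← h, Equiv.swap_apply_left]
    · rw [Equiv.trans_apply, Equiv.swap_apply_left]
  let e : Matrix (Fin n) (Fin n) ℚ ≃ₐ[ℚ] Module.End ℚ (Fin n → ℚ) := toLinAlgEquiv'
  let F : Matrix (Fin n) (Fin n) ℚ →* Module.End ℚ (Fin n → ℚ) := MonoidHomClass.toMonoidHom e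
  have hU : IsUnitriangularFamily m (fun a b => Units.map F (T (σ a) (σ b))) := by
    refine ⟨?_, ?_, ?_⟩
    · intro a b hab
      have := ((hT (σ a) (σ b) (σ.injective.ne hab.ne)).unip).map e
      rw [map_sub, map_one] at this
      exact this
    · intro a b c d hab hcd hbc had
      exact (hT.commute hΦ (σ.injective.ne hab.ne) (σ.injective.ne hcd.ne) (σ.injective.ne hbc)
        (σ.injective.ne had)).map _
    · intro a b c hab hbc
      have := congrArg (Units.map F) (hT.mul_eq hΦ (σ.injective.ne hab.ne)
        (σ.injective.ne hbc.ne) (σ.injective.ne (hab.trans hbc).ne))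
      simpa using this
  have h1 := hU.finrank_range_le_one (by simp) (i := z) (k := l) (n - 2) rfl
    (by simp [l]; omega) (by simp [l]; omega)
  rw [hσi, hσj] at h1
  apply exists_vecMulVec
  have h2 : ((T i j ^ m ^ (n - 2) : GL (Fin n) ℚ).1 - 1).mulVecLin =
      (e (T i j).1) ^ m ^ (n - 2) - 1 := by
    rw [← map_pow, ← map_one e, ← map_sub]
    rfl
  rw [h2]
  exact h1

end IsSignHom

/-! ### Families of rank one matrices satisfying the commutator relations -/

section RankOne

open Matrix

variable {n : ℕ}

theorem vecMulVec_eq_zero_or {K : Type*} [Field K] {a f : Fin n → K} (h : vecMulVec a f = 0) :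
    a = 0 ∨ f = 0 := by
  by_contra! hne
  obtain ⟨i, hi⟩ := Function.ne_iff.mp hne.1
  obtain ⟨j, hj⟩ := Function.ne_iff.mp hne.2
  have := congrFun (congrFun h i) j
  rw [vecMulVec_apply] at this
  exact mul_ne_zero hi hj this

/-- `x a fᵀ z` is the outer product of `x a` and `fᵀ z`, and over a field it vanishes only if one of
them does. -/
theorem mul_vecMulVec_mul_eq_zero {K : Type*} [Field K] {a f : Fin n → K}
    {x z : Matrix (Fin n) (Fin n) K} (h : x * vecMulVec a f * z = 0) :
    x * vecMulVec a f = 0 ∨ vecMulVec a f * z = 0 := by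
  rw [mul_vecMulVec, vecMulVec_mul] at h ⊢
  rcases vecMulVec_eq_zero_or h with h | h
  · left; rw [h, zero_vecMulVec]
  · right; rw [h, vecMulVec_zero]

theorem vecMulVec_mul_self_eq_zero {a f : Fin n → ℚ} (h : IsNilpotent (vecMulVec a f)) :
    vecMulVec a f * vecMulVec a f = 0 := by
  obtain ⟨k, hk⟩ := h
  induction k with
  | zero => 
    rw [pow_zero] at hk
    rw [← mul_one (vecMulVec a f * _), hk, mul_zero]
  | succ k ih =>
    rcases k with _ | k
    · rw [zero_add, pow_one] at hk
      rw [hk, mul_zero]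
    · rw [pow_succ, pow_succ] at hk
      rcases mul_vecMulVec_mul_eq_zero hk with h | h
      · exact ih (by rw [pow_succ, h])
      · exact h

/-- Writing `N`, `M` for the two matrices, `N M N = N² M = 0`, so `N M` or `M N` vanishes, and they
are equal. -/
theorem vecMulVec_mul_eq_zero_of_commute {a f b g : Fin n → ℚ}
    (ha : vecMulVec a f * vecMulVec a f = 0)
    (h : vecMulVec a f * vecMulVec b g = vecMulVec b g * vecMulVec a f) :
    vecMulVec a f * vecMulVec b g = 0 := by
  have h1 : vecMulVec a f * vecMulVec b g * vecMulVec a f = 0 := by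
    rw [mul_assoc, ← h, ← mul_assoc, ha, zero_mul]
  rcases mul_vecMulVec_mul_eq_zero h1 with h2 | h2
  · exact h2
  · rw [h, h2]

theorem one_add_pow_of_sq_eq_zero {S : Type*} [Ring S] {x : S} (h : x * x = 0) (k : ℕ) :
    (1 + x) ^ k = 1 + k * x := by
  induction k with
  | zero => simp
  | succ k ih =>
    have h1 : (1 + (k : S) * x) * (1 + x) = 1 + (k + 1) * x + k * (x * x) := by noncomm_ring
    rw [pow_succ, ih, h1, h, mul_zero, add_zero]
    push_cast
    rfl

/-- A property of ordered triples of distinct indices that is invariant under permutations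
and under replacing one index holds for all triples as soon as it holds for one. -/
theorem forall_triples {P : Fin n → Fin n → Fin n → Prop}
    (h1 : ∀ i j k, i ≠ j → j ≠ k → i ≠ k → P i j k → P i k j)
    (h2 : ∀ i j k, i ≠ j → j ≠ k → i ≠ k → P i j k → P j i k)
    (h3 : ∀ i j k l, i ≠ j → j ≠ k → i ≠ k → l ≠ i → l ≠ j → l ≠ k → P i j k → P i j l)
    {i j k : Fin n} (hij : i ≠ j) (hjk : j ≠ k) (hik : i ≠ k) (h : P i j k) :
    ∀ i' j' k', i' ≠ j' → j' ≠ k' → i' ≠ k' → P i' j' k' := by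
  -- `Q` quantifies over the third index, so that only pairs have to be moved around.
  let Q : Fin n → Fin n → Prop := fun i j => ∀ k, j ≠ k → i ≠ k → P i j k
  have hQ : ∀ i j k, i ≠ j → j ≠ k → i ≠ k → P i j k → Q i j := by
    intro i j k hij hjk hik h l hjl hil
    by_cases hkl : l = k
    · rwa [hkl]
    · exact h3 i j k l hij hjk hik hil.symm hjl.symm hkl h
  have hsymm : ∀ i j, i ≠ j → Q i j → Q j i := fun i j hij h k hik hjk =>
    h2 i j k hij hjk hik (h k hjk hik)
  have hright : ∀ i j j', i ≠ j → i ≠ j' → Q i j → Q i j' := by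
    intro i j j' hij hij' h
    by_cases hjj : j = j'
    · rwa [← hjj]
    · exact hQ i j' j hij' (Ne.symm hjj) hij (h1 i j j' hij hjj hij' (h j' hjj hij'))
  have h0 := hQ i j k hij hjk hik h
  intro i' j' k' hij' hjk' hik'
  refine (?_ : Q i' j') k' hjk' hik'
  by_cases hii : i' = i
  · subst hii
    exact hright _ j j' hij hij' h0
  · exact hright _ i j' hii hij' (hsymm _ _ (Ne.symm hii) (hright _ j i' hij (Ne.symm hii) h0))

/-- Elements `N i j`, `i ≠ j`, of a ring satisfying the commutator relations of multiples of
the off-diagonal matrix units, products of commuting ones being zero. -/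
structure IsRootFamily {S : Type*} [Ring S] [Algebra ℚ S] (c : ℚ) (N : Fin n → Fin n → S) :
    Prop where
  ne_zero : ∀ i j, i ≠ j → N i j ≠ 0
  mul_eq_zero : ∀ i j k l, i ≠ j → k ≠ l → j ≠ k → i ≠ l → N i j * N k l = 0
  comm : ∀ i j k, i ≠ j → j ≠ k → i ≠ k → N i j * N j k - N j k * N i j = c • N i k
  prime : ∀ i j, i ≠ j → ∀ x z, x * N i j * z = 0 → x * N i j = 0 ∨ N i j * z = 0

namespace IsRootFamily

variable {S : Type*} [Ring S] [Algebra ℚ S] {c : ℚ} {N : Fin n → Fin n → S}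

/-- Multiplying the commutator relation by `N i j` on the left leaves `N i j * N j k * N i j = 0`,
to which primality applies. -/
theorem mul_eq_zero_or (hN : IsRootFamily c N) {i j k : Fin n} (hij : i ≠ j) (hjk : j ≠ k)
    (hik : i ≠ k) : N j k * N i j = 0 ∨ N i j * N j k = 0 := by
  have h1 := congrArg (N i j * ·) (hN.comm i j k hij hjk hik)
  simp only [mul_sub, ← mul_assoc, hN.mul_eq_zero i j i j hij hij hij.symm hij, zero_mul,
    mul_smul_comm, hN.mul_eq_zero i j i k hij hik hij.symm hik, smul_zero, zero_sub,
    neg_eq_zero] at h1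
  exact (hN.prime j k hjk _ _ h1).symm

theorem mul_eq_smul (hN : IsRootFamily c N) {i j k : Fin n} (hij : i ≠ j) (hjk : j ≠ k)
    (hik : i ≠ k) (h : N j k * N i j = 0) : N i j * N j k = c • N i k := by
  have := hN.comm i j k hij hjk hik
  rwa [h, sub_zero] at this

theorem mul_eq_neg_smul (hN : IsRootFamily c N) {i j k : Fin n} (hij : i ≠ j) (hjk : j ≠ k)
    (hik : i ≠ k) (h : N i j * N j k = 0) : N j k * N i j = -(c • N i k) := by
  have := hN.comm i j k hij hjk hik
  rw [h, zero_sub] at this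
  rw [← this, neg_neg]

theorem smul_cancel (hc : c ≠ 0) {a b : S} (h : c • a = b) : a = c⁻¹ • b := by
  rw [← h, smul_smul, inv_mul_cancel₀ hc, one_smul]

theorem mul_ne_zero_of (hN : IsRootFamily c N) (hc : c ≠ 0) {i j k : Fin n} (hij : i ≠ j)
    (hjk : j ≠ k) (hik : i ≠ k) (h : N j k * N i j = 0) : N i j * N j k ≠ 0 := by
  rw [hN.mul_eq_smul hij hjk hik h]
  exact smul_ne_zero hc (hN.ne_zero i k hik)

/-- Otherwise `N i j` is a multiple of `N k j * N i k`, and `N i k` is one of `N i j * N j k`. Then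
`N i j * N j k` contains the factor `N j k * N j k = 0`, although it is a nonzero multiple of `N i
k`. `swap_left` is the mirror image. -/
theorem swap_right (hN : IsRootFamily c N) (hc : c ≠ 0) {i j k : Fin n} (hij : i ≠ j)
    (hjk : j ≠ k) (hik : i ≠ k) (h : N j k * N i j = 0) : N k j * N i k = 0 := by
  refine (hN.mul_eq_zero_or hik hjk.symm hij).resolve_right fun h' => ?_
  apply hN.mul_ne_zero_of hc hij hjk hik h
  have h1 := hN.mul_eq_neg_smul hik hjk.symm hij h'
  have h2 := smul_cancel hc (hN.mul_eq_smul hij hjk hik h).symm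
  have h3 : c • N i j = -(N k j * N i k) := by rw [h1, neg_neg]
  rw [smul_cancel hc h3, h2]
  simp only [mul_smul_comm, smul_mul_assoc, neg_mul, mul_assoc,
    hN.mul_eq_zero j k j k hjk hjk hjk.symm hjk, mul_zero, smul_zero, neg_zero]

theorem swap_left (hN : IsRootFamily c N) (hc : c ≠ 0) {i j k : Fin n} (hij : i ≠ j)
    (hjk : j ≠ k) (hik : i ≠ k) (h : N j k * N i j = 0) : N i k * N j i = 0 := by
  refine (hN.mul_eq_zero_or hij.symm hik hjk).resolve_right fun h' => ?_
  apply hN.mul_ne_zero_of hc hij hjk hik h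
  have h1 := hN.mul_eq_neg_smul hij.symm hik hjk h'
  have h2 := smul_cancel hc (hN.mul_eq_smul hij hjk hik h).symm
  have h3 : c • N j k = -(N i k * N j i) := by rw [h1, neg_neg]
  rw [smul_cancel hc h3, h2]
  simp only [mul_smul_comm, smul_mul_assoc, mul_neg, ← mul_assoc,
    hN.mul_eq_zero i j i j hij hij hij.symm hij, zero_mul, smul_zero, neg_zero]

/-- Otherwise `N j l * N i j` is a nonzero multiple of `N i l`, which kills `N j k`. Primality of `N
i j` then makes `N j l * N i j` or `N i j * N j k` vanish, and neither does. -/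
theorem replace_right (hN : IsRootFamily c N) (hc : c ≠ 0) {i j k l : Fin n} (hij : i ≠ j)
    (hjk : j ≠ k) (hik : i ≠ k) (hli : l ≠ i) (hlj : l ≠ j)
    (h : N j k * N i j = 0) : N j l * N i j = 0 := by
  refine (hN.mul_eq_zero_or hij hlj.symm hli.symm).resolve_right fun h' => ?_
  have h1 := hN.mul_eq_neg_smul hij hlj.symm hli.symm h'
  have h2 : N j l * N i j * N j k = 0 := by
    rw [h1, neg_mul, smul_mul_assoc, hN.mul_eq_zero i l j k hli.symm hjk hlj hik, smul_zero,
      neg_zero]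
  rcases hN.prime i j hij _ _ h2 with h3 | h3
  · rw [h1, neg_eq_zero] at h3
    exact smul_ne_zero hc (hN.ne_zero i l hli.symm) h3
  · exact hN.mul_ne_zero_of hc hij hjk hik h h3

/-- The alternatives correspond to conjugations and to contragredients. -/
theorem dichotomy (hN : IsRootFamily c N) (hc : c ≠ 0) :
    (∀ i j k, i ≠ j → j ≠ k → i ≠ k → N j k * N i j = 0) ∨
      (∀ i j k, i ≠ j → j ≠ k → i ≠ k → N i j * N j k = 0) := by
  by_cases h : ∃ i j k, i ≠ j ∧ j ≠ k ∧ i ≠ k ∧ N j k * N i j = 0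
  · obtain ⟨i, j, k, hij, hjk, hik, h⟩ := h
    left
    exact forall_triples (P := fun i j k => N j k * N i j = 0)
      (fun _ _ _ => hN.swap_right hc) (fun _ _ _ => hN.swap_left hc)
      (fun _ _ _ _ hij hjk hik hli hlj _ => hN.replace_right hc hij hjk hik hli hlj) hij hjk hik h
  · right
    push Not at h
    exact fun i j k hij hjk hik =>
      (hN.mul_eq_zero_or hij hjk hik).resolve_left (h i j k hij hjk hik)

end IsRootFamily

end RankOne

/-! ### Rank-one lifts satisfy the root relations -/

namespace IsSignHom

variable {n : ℕ} {Φ : SL(n, ℤ) → SL(n, ℤ)}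

theorem exists_isRootFamily (hΦ : IsSignHom Φ) (hn : 3 ≤ n) :
    ∃ m T, 0 < m ∧ IsLiftFamily Φ m T ∧ IsRootFamily (m : ℚ) (fun i j => (T i j).1 - 1) := by
  have : NeZero n := ⟨by omega⟩
  obtain ⟨m, T, hm, hT, hrank⟩ := hΦ.exists_isLiftFamily_vecMulVec hn
  have hsq : ∀ i j, i ≠ j → ((T i j).1 - 1) * ((T i j).1 - 1) = 0 := by
    intro i j hij
    obtain ⟨a, f, h⟩ := hrank i j hij
    have := (hT i j hij).unip
    rw [IsUnipotentUnit, h] at this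
    rw [h]
    exact vecMulVec_mul_self_eq_zero this
  have hzero : ∀ i j k l, i ≠ j → k ≠ l → j ≠ k → i ≠ l →
      ((T i j).1 - 1) * ((T k l).1 - 1) = 0 := by
    intro i j k l hij hkl hjk hil
    have h1 : (T i j).1 * (T k l).1 = (T k l).1 * (T i j).1 :=
      congrArg Units.val (hT.commute hΦ hij hkl hjk hil).eq
    obtain ⟨a, f, h⟩ := hrank i j hij
    obtain ⟨b, g, h'⟩ := hrank k l hkl
    have h2 := hsq i j hij
    have h3 : ((T i j).1 - 1) * ((T k l).1 - 1) = ((T k l).1 - 1) * ((T i j).1 - 1) := by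
      simp only [sub_mul, mul_sub, h1]
      simp only [one_mul, mul_one]
      abel
    rw [h, h'] at h3 ⊢
    rw [h] at h2
    exact vecMulVec_mul_eq_zero_of_commute h2 h3
  refine ⟨m, T, hm, hT, ?_, hzero, ?_, ?_⟩
  · intro i j hij h
    have h1 : T i j = 1 := Units.ext (sub_eq_zero.mp h)
    have h2 := (hT i j hij).signEq
    rw [h1] at h2
    exact transvection_not_signEq_one hij (by exact_mod_cast hm.ne') (hΦ.signEq_one_of_rat h2.symm)
  · intro i j k hij hjk hik
    have h1 := congrArg Units.val (hT.mul_eq hΦ hij hjk hik)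
    obtain ⟨x, hx⟩ : ∃ x, x = (T i j).1 - 1 := ⟨_, rfl⟩
    obtain ⟨y, hy⟩ : ∃ y, y = (T j k).1 - 1 := ⟨_, rfl⟩
    obtain ⟨z, hz⟩ : ∃ z, z = (T i k).1 - 1 := ⟨_, rfl⟩
    have hzz := hsq i k hik
    have hzy := hzero i k j k hik hjk hjk.symm hik
    have hzx := hzero i k i j hik hij hik.symm hij
    have hX := eq_add_of_sub_eq' hx.symm
    have hY := eq_add_of_sub_eq' hy.symm
    have hZ := eq_add_of_sub_eq' hz.symm
    simp only [Units.val_mul, Units.val_pow_eq_pow_val] at h1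
    simp only [← hx, ← hy, ← hz] at hzz hzy hzx ⊢
    rw [hX, hY, hZ, one_add_pow_of_sq_eq_zero hzz] at h1
    -- As `z` squares to zero and annihilates `x` and `y` from the left, the relation between the
    -- unipotent lifts becomes linear in `z`.
    have h2 : (1 + (m : Matrix (Fin n) (Fin n) ℚ) * z) * (1 + y) * (1 + x) =
        1 + x + y + y * x + m * z := by
      calc _ = 1 + x + y + y * x + m * z + m * (z * y) + m * (z * x) + m * (z * y) * x := by
            noncomm_ring
        _ = _ := by rw [hzy, hzx]; simp
    rw [h2] at h1
    have h3 : (m : ℚ) • z = (m : Matrix (Fin n) (Fin n) ℚ) * z := by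
      rw [← Nat.cast_smul_eq_nsmul ℚ m z |>.symm, nsmul_eq_mul]
    rw [h3]
    have h4 : x * y - y * x = (1 + x) * (1 + y) - (1 + x + y + y * x) := by noncomm_ring
    rw [h4, h1]
    abel
  · intro i j hij x z h
    obtain ⟨a, f, h'⟩ := hrank i j hij
    simp only [h'] at h ⊢
    exact mul_vecMulVec_mul_eq_zero h

end IsSignHom

/-! ### Recovering an integral conjugating matrix -/

namespace IsSignHom

variable {n : ℕ} {Φ : SL(n, ℤ) → SL(n, ℤ)}

theorem map_intCast_matrix_injective : Function.Injective
    (fun A : Matrix (Fin n) (Fin n) ℤ => A.map (Int.castRingHom ℚ)) :=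
  Matrix.map_injective (RingHom.injective_int (Int.castRingHom ℚ))

theorem map_one (hΦ : IsSignHom Φ) : SignEq (Φ 1).1 1 := by
  have h := hΦ.map_mul 1 1
  rw [mul_one, coe_mul] at h
  have h2 := (SignEq.refl ((Φ 1)⁻¹).1).mul h
  rw [← mul_assoc, ← coe_mul, inv_mul_cancel, coe_one, one_mul] at h2
  exact h2.symm

theorem map_mul_map_inv (hΦ : IsSignHom Φ) (x : SL(n, ℤ)) :
    SignEq ((Φ x⁻¹).1 * (Φ x).1) 1 := by
  have h := (hΦ.map_mul x⁻¹ x).symm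
  rw [inv_mul_cancel] at h
  exact h.trans hΦ.map_one

/-- A map that agrees up to sign with conjugation by `g` on a generating set does so everywhere. -/
theorem signEq_of_closure (hΦ : IsSignHom Φ) (g : Matrix (Fin n) (Fin n) ℤ) {s : Set SL(n, ℤ)}
    (hs : Subgroup.closure s = ⊤) (h : ∀ x ∈ s, SignEq ((Φ x).1 * g) (g * x.1)) (x : SL(n, ℤ)) :
    SignEq ((Φ x).1 * g) (g * x.1) := by
  have hx : x ∈ Subgroup.closure s := by rw [hs]; trivial
  induction hx using Subgroup.closure_induction with
  | mem x hx => exact h x hx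
  | one => simpa using hΦ.map_one.mul (SignEq.refl g)
  | mul x y _ _ hx hy =>
    refine ((hΦ.map_mul x y).mul (SignEq.refl g)).trans ?_
    rw [coe_mul, mul_assoc]
    refine ((SignEq.refl (Φ x).1).mul hy).trans ?_
    rw [← mul_assoc, coe_mul, ← mul_assoc]
    exact hx.mul (SignEq.refl _)
  | inv x _ hx =>
    have h1 : g = g * x.1 * (x⁻¹).1 := by
      rw [mul_assoc, ← coe_mul, mul_inv_cancel, coe_one, mul_one]
    have h2 : SignEq ((Φ x⁻¹).1 * g) ((Φ x⁻¹).1 * ((Φ x).1 * g * (x⁻¹).1)) := by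
      conv_lhs => rw [h1]
      exact (SignEq.refl _).mul (hx.symm.mul (SignEq.refl _))
    refine h2.trans ?_
    rw [mul_assoc (Φ x).1, ← mul_assoc]
    simpa using (hΦ.map_mul_map_inv x).mul (SignEq.refl (g * (x⁻¹).1))

theorem commute_inv_mul {S : Type*} [Monoid S] {y z : Sˣ} {A B : S} (hy : (y : S) * A = B * y)
    (hz : (z : S) * A = B * z) : Commute ((z⁻¹ * y : Sˣ) : S) A := by
  have h1 : ((z⁻¹ : Sˣ) : S) * B = A * (z⁻¹ : Sˣ) := by
    rw [Units.inv_mul_eq_iff_eq_mul, ← mul_assoc, hz, mul_assoc, Units.mul_inv, mul_one]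
  rw [Commute, SemiconjBy, Units.val_mul, mul_assoc, hy, ← mul_assoc, h1, mul_assoc]

theorem eq_smul_of_commute {E : Fin n → Fin n → Matrix (Fin n) (Fin n) ℚ} {g : GL (Fin n) ℚ}
    (hg : ∀ i j, E i j * g.1 = g.1 * single i j 1) {c : Matrix (Fin n) (Fin n) ℚ}
    (hc : ∀ i j, i ≠ j → Commute c (E i j)) : ∃ r : ℚ, c = r • 1 := by
  have h1 : ∀ i j, (g⁻¹).1 * E i j = single i j 1 * (g⁻¹).1 := by
    intro i j
    rw [Units.inv_mul_eq_iff_eq_mul, ← mul_assoc, ← hg, mul_assoc, Units.mul_inv, mul_one]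
  obtain ⟨r, hr⟩ := mem_range_scalar_of_commute_single (M := (g⁻¹).1 * c * g.1) (by
    intro i j hij
    rw [Commute, SemiconjBy, ← mul_assoc, ← mul_assoc, ← h1, mul_assoc _ (E i j), ← (hc i j hij).eq,
      ← mul_assoc, mul_assoc _ (E i j), hg, mul_assoc, mul_assoc, mul_assoc])
  refine ⟨r, ?_⟩
  have h2 : c = g.1 * ((g⁻¹).1 * c * g.1) * (g⁻¹).1 := by
    rw [mul_assoc (g⁻¹).1, ← mul_assoc g.1, Units.mul_inv, one_mul, mul_assoc, Units.mul_inv,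
      mul_one]
  rw [h2, ← hr, scalar_apply, ← smul_one_eq_diagonal, Matrix.mul_smul, mul_one, Matrix.smul_mul,
    Units.mul_inv]

/-- Only powers of elementary matrices have known images so far. The image `y` of an elementary
matrix itself and `z = 1 + E k l` conjugate these known images in the same way, so `z⁻¹ y` commutes
with all matrix units and is a scalar. Comparing determinants makes it `±1`. -/
theorem signEq_of_matrixUnits (hΦ : IsSignHom Φ) (hn : 3 ≤ n) {m : ℕ} (hm : 0 < m)
    {T : Fin n → Fin n → GL (Fin n) ℚ} (hT : IsLiftFamily Φ m T)
    {E : Fin n → Fin n → Matrix (Fin n) (Fin n) ℚ}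
    (hE : ∀ i j k l, E i j * E k l = if j = k then E i l else 0)
    (hTE : ∀ i j, i ≠ j → (T i j).1 = 1 + (m : ℚ) • E i j) {g : GL (Fin n) ℚ}
    (hg : ∀ i j, E i j * g.1 = g.1 * single i j 1) {k l : Fin n} (hkl : k ≠ l) :
    SignEq (rat Φ (transvection hkl 1)).1 (1 + E k l) := by
  have : NeZero n := ⟨by omega⟩
  have hm' : (m : ℚ) ≠ 0 := by exact_mod_cast hm.ne'
  set y := rat Φ (transvection hkl 1) with hy
  set z : GL (Fin n) ℚ := g * mapGL ℚ (transvection hkl (1 : ℤ)) * g⁻¹ with hz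
  have hzE : z.1 = 1 + E k l := by
    have h1 : (mapGL ℚ (transvection hkl (1 : ℤ))).1 = 1 + single k l 1 := by
      ext i j
      simp [transvection_coe, single_apply, Matrix.one_apply]
    rw [hz, Units.val_mul, Units.val_mul, h1, mul_add, mul_one, ← hg, add_mul, mul_assoc,
      Units.mul_inv, mul_one]
  have hEz : ∀ i j, E i j * E k l = if j = k then E i l else 0 := fun i j => hE i j k l
  have hzE' : ∀ i j, E k l * E i j = if l = i then E k j else 0 := fun i j => hE k l i j
  have hcancel : ∀ {A B C D : Matrix (Fin n) (Fin n) ℚ}, A + (m : ℚ) • B = C + (m : ℚ) • D → A = C →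
      B = D := by
    intro A B C D h1 h2
    rw [h2, add_right_inj] at h1
    exact smul_right_injective _ hm' h1
  have hconj : ∀ i j (hij : i ≠ j), ∀ {w : GL (Fin n) ℚ}, IsUnipotentLift Φ
      (transvection hkl 1 * transvection hij (m : ℤ) * (transvection hkl 1)⁻¹) w →
      y.1 * (T i j).1 = w.1 * y.1 := by
    intro i j hij w hw
    have h1 := (hT i j hij).conj hΦ (transvection hkl 1) (SignEq.refl _)
    exact congrArg Units.val (mul_inv_eq_iff_eq_mul.mp (h1.unique hw))
  -- Apart from the opposite root `(l, k)`, conjugation multiplies an elementary matrix by at most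
  -- one other. The opposite root is recovered below by factoring `E l k` through a third index.
  have hoff : ∀ i j, i ≠ j → ¬ (i = l ∧ j = k) → Commute (z⁻¹ * y).1 (E i j) := by
    intro i j hij hne
    by_cases hil : i = l
    · subst hil
      have hjk : j ≠ k := fun h => hne ⟨rfl, h⟩
      refine commute_inv_mul (B := E k j + E i j) ?_ ?_
      · have h1 := hconj i j hij (w := T k j * T i j) (by
          have := (hT k j hjk.symm).mul hΦ (hT i j hij)
            (transvection_commute hjk.symm hij hij.symm hjk.symm _ _)
          convert this using 1
          rw [transvection_mul_transvection hkl hij hjk.symm, one_mul, mul_inv_cancel_right])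
        rw [Units.val_mul, hTE k j hjk.symm, hTE i j hij] at h1
        have h2 : (1 + (m : ℚ) • E k j) * (1 + (m : ℚ) • E i j) =
            1 + (m : ℚ) • (E k j + E i j) := by
          rw [mul_add, mul_one, add_mul, one_mul, smul_mul_smul_comm, hE, if_neg hij.symm,
            smul_zero, add_zero, smul_add, add_assoc]
        rw [h2, mul_add, add_mul, mul_smul_comm, smul_mul_assoc] at h1
        exact hcancel h1 (by rw [mul_one, one_mul])
      · rw [hzE]
        simp only [mul_add, add_mul, one_mul, mul_one, hzE', hEz, if_neg hjk, if_true, add_zero]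
        abel
    · by_cases hjk : j = k
      · subst hjk
        refine commute_inv_mul (B := E i j - E i l) ?_ ?_
        · have h1 := hconj i j hij (w := (T i l)⁻¹ * T i j) (by
            have := ((hT i l hil).inv hΦ).mul hΦ (hT i j hij) (by
              rw [transvection_inv]
              exact transvection_commute hil hij (Ne.symm hil) hij _ _)
            convert this using 1
            have h3 := transvection_mul_transvection hij hkl hil (m : ℤ) 1
            rw [mul_one, mul_assoc] at h3
            rw [mul_inv_eq_iff_eq_mul, mul_assoc, h3, inv_mul_cancel_left])
          have h4 : ((T i l)⁻¹).1 = 1 - (m : ℚ) • E i l := by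
            apply Units.inv_eq_of_mul_eq_one_right
            rw [hTE i l hil, mul_sub, mul_one, add_mul, one_mul, smul_mul_smul_comm, hE,
              if_neg (Ne.symm hil), smul_zero, add_zero, add_sub_cancel_right]
          have h5 : (1 - (m : ℚ) • E i l) * (1 + (m : ℚ) • E i j) =
              1 + (m : ℚ) • (E i j - E i l) := by
            rw [mul_add, mul_one, sub_mul, one_mul, smul_mul_smul_comm, hE, if_neg (Ne.symm hil),
              smul_zero, sub_zero, smul_sub]
            abel
          rw [Units.val_mul, h4, hTE i j hij, h5, mul_add, add_mul, mul_smul_comm,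
            smul_mul_assoc] at h1
          exact hcancel h1 (by rw [mul_one, one_mul])
        · rw [hzE]
          simp only [mul_add, add_mul, sub_mul, one_mul, mul_one, hzE', hEz, if_neg (Ne.symm hil),
            if_neg hkl.symm, if_true, add_zero, sub_zero]
          abel
      · refine commute_inv_mul (B := E i j) ?_ ?_
        · have h1 := hconj i j hij (w := T i j) (by
            convert hT i j hij using 1
            rw [transvection_commute hkl hij (Ne.symm hil) (Ne.symm hjk), mul_inv_cancel_right])
          rw [hTE i j hij, mul_add, add_mul, mul_smul_comm, smul_mul_assoc] at h1
          exact hcancel h1 (by rw [mul_one, one_mul])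
        · rw [hzE, add_mul, mul_add, hzE', hEz, if_neg (Ne.symm hil), if_neg hjk]
          simp
  have hall : ∀ i j, i ≠ j → Commute (z⁻¹ * y).1 (E i j) := by
    intro i j hij
    by_cases h : i = l ∧ j = k
    · obtain ⟨rfl, rfl⟩ := h
      obtain ⟨p, -, hp⟩ := Finset.exists_mem_notMem_of_card_lt_card (s := {i, j})
        (t := Finset.univ) (lt_of_le_of_lt Finset.card_le_two (by simp; omega))
      obtain ⟨hpi, hpj⟩ : p ≠ i ∧ p ≠ j := by simpa using hp
      have h1 : E i j = E i p * E p j := by rw [hE, if_pos rfl]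
      rw [h1]
      exact (hoff i p hpi.symm fun h => hpj h.2).mul_right (hoff p j hpj fun h => hpi h.1)
    · exact hoff i j hij h
  obtain ⟨r, hr⟩ := eq_smul_of_commute hg hall
  have hyz : y.1 = r • z.1 := by
    have : y.1 = z.1 * (z⁻¹ * y).1 := by rw [← Units.val_mul, mul_inv_cancel_left]
    rw [this, hr, Matrix.mul_smul, mul_one]
  have hdet1 : ∀ x : SL(n, ℤ), (mapGL ℚ x).1.det = 1 := by
    intro x
    change (x.1.map (Int.castRingHom ℚ)).det = 1
    rw [← RingHom.mapMatrix_apply, ← RingHom.map_det, x.2, _root_.map_one]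
  have hdet := congrArg Matrix.det hyz
  rw [det_smul, hz, Units.val_mul, Units.val_mul, det_mul_right_comm, Units.mul_inv, det_mul,
    det_one, one_mul, hdet1, mul_one, hy, rat, hdet1 (Φ _), Fintype.card_fin] at hdet
  have hr1 : |r| = 1 := by
    refine (pow_eq_one_iff_of_nonneg (abs_nonneg r) (by omega : n ≠ 0)).mp ?_
    rw [← abs_pow, ← hdet, abs_one]
  rw [← hzE]
  rcases (abs_eq zero_le_one).mp hr1 with h | h
  · left; rw [hyz, h, one_smul]
  · right; rw [hyz, h, neg_smul, one_smul]

/-- With this orientation the `N i j / m` are off-diagonal matrix units over `ℚ`. They are integral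
because `1 + E i j` is `±` an integral matrix and each diagonal unit is a product of two
off-diagonal ones. Hence `exists_conj_single` can be applied over `ℤ`. -/
theorem exists_conj_of_isRootFamily (hΦ : IsSignHom Φ) (hn : 3 ≤ n) {m : ℕ} (hm : 0 < m)
    {T : Fin n → Fin n → GL (Fin n) ℚ} (hT : IsLiftFamily Φ m T)
    (hN : IsRootFamily (m : ℚ) (fun i j => (T i j).1 - 1))
    (hA : ∀ i j k, i ≠ j → j ≠ k → i ≠ k → ((T j k).1 - 1) * ((T i j).1 - 1) = 0) :
    ∃ g : GL (Fin n) ℤ, ∀ x, SignEq ((Φ x).1 * g.1) (g.1 * x.1) := by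
  have hm' : (m : ℚ) ≠ 0 := by exact_mod_cast hm.ne'
  obtain ⟨E, hEN, hE⟩ := exists_matrixUnits hn (N := fun i j => (m : ℚ)⁻¹ • ((T i j).1 - 1))
    (by
      intro i j k hij hjk hik
      have := hN.mul_eq_smul hij hjk hik (hA i j k hij hjk hik)
      simp only [smul_mul_smul_comm, this, smul_smul]
      congr 1
      field_simp)
    (by
      intro i j k l hij hkl hjk
      have : ((T i j).1 - 1) * ((T k l).1 - 1) = 0 := by
        by_cases hil : i = l
        · subst hil
          exact hA k i j hkl hij (Ne.symm hjk)
        · exact hN.mul_eq_zero i j k l hij hkl hjk hil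
      simp only [smul_mul_smul_comm, this, smul_zero])
  have hTE : ∀ i j, i ≠ j → (T i j).1 = 1 + (m : ℚ) • E i j := by
    intro i j hij
    rw [hEN i j hij, smul_smul, mul_inv_cancel₀ hm', one_smul, add_sub_cancel]
  let o : Fin n := ⟨0, by omega⟩
  let o' : Fin n := ⟨1, by omega⟩
  have hoo : o ≠ o' := by simp [o, o', Fin.ext_iff]
  have ho : E o o ≠ 0 := by
    intro h
    have h1 : E o o' = 0 := by
      have := hE o o o o'
      rw [if_pos rfl, h, zero_mul] at this
      exact this.symm
    have h2 := hTE o o' hoo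
    rw [h1, smul_zero, add_zero] at h2
    exact hN.ne_zero o o' hoo (sub_eq_zero.mpr h2)
  obtain ⟨g₀, hg₀⟩ := exists_conj_single hE o ho
  have hrec := fun {k l : Fin n} (hkl : k ≠ l) => hΦ.signEq_of_matrixUnits hn hm hT hE hTE hg₀ hkl
  have hoff : ∀ i j, i ≠ j → ∃ A : Matrix (Fin n) (Fin n) ℤ,
      (Int.castRingHom ℚ).mapMatrix A = E i j := by
    intro i j hij
    have h1 : (Int.castRingHom ℚ).mapMatrix (Φ (transvection hij 1)).1 =
      (rat Φ (transvection hij 1)).1 := rfl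
    rcases hrec hij with h | h
    · refine ⟨(Φ (transvection hij 1)).1 - 1, ?_⟩
      rw [map_sub, _root_.map_one, h1, h, add_sub_cancel_left]
    · refine ⟨-(Φ (transvection hij 1)).1 - 1, ?_⟩
      rw [map_sub, map_neg, _root_.map_one, h1, h, neg_neg, add_sub_cancel_left]
  have hint : ∀ i j, ∃ A : Matrix (Fin n) (Fin n) ℤ,
      (Int.castRingHom ℚ).mapMatrix A = E i j := by
    intro i j
    by_cases hij : i = j
    · subst hij
      obtain ⟨k, hk⟩ : ∃ k, i ≠ k := by
        by_cases h : i = o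
        · exact ⟨o', h ▸ hoo⟩
        · exact ⟨o, h⟩
      obtain ⟨A, hA⟩ := hoff i k hk
      obtain ⟨B, hB⟩ := hoff k i hk.symm
      exact ⟨A * B, by rw [_root_.map_mul, hA, hB, hE, if_pos rfl]⟩
    · exact hoff i j hij
  choose F hF using hint
  have hinj : Function.Injective ((Int.castRingHom ℚ).mapMatrix (m := Fin n)) :=
    map_intCast_matrix_injective
  obtain ⟨g, hg⟩ := exists_conj_single (E := F) (by
    intro i j k l
    apply hinj
    rw [_root_.map_mul, hF, hF, hE]
    split_ifs
    · rw [hF]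
    · rw [map_zero]) o (by
    intro h
    apply ho
    rw [← hF, h, map_zero])
  refine ⟨g, hΦ.signEq_of_closure g.1 closure_transvection_one ?_⟩
  rintro _ ⟨i, j, hij, rfl⟩
  have h1 : SignEq (Φ (transvection hij 1)).1 (1 + F i j) := by
    rcases hrec hij with h | h
    · left
      apply hinj
      rw [map_add, _root_.map_one, hF]
      exact h
    · right
      apply hinj
      rw [map_neg, map_add, _root_.map_one, hF]
      exact h
  have h2 : g.1 * (transvection hij (1 : ℤ)).1 = (1 + F i j) * g.1 := by
    rw [transvection_coe, mul_add, add_mul, mul_one, one_mul, hg]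
  rw [h2]
  exact h1.mul (SignEq.refl _)

/-- The inverse of the transpose. -/
def contragredient (x : SL(n, ℤ)) : SL(n, ℤ) := (x⁻¹).transpose

theorem contragredient_mul (x y : SL(n, ℤ)) :
    contragredient (x * y) = contragredient x * contragredient y := by
  apply Subtype.ext
  simp only [contragredient, _root_.mul_inv_rev, coe_transpose, coe_mul, transpose_mul]

theorem contragredient_contragredient (x : SL(n, ℤ)) :
    contragredient (contragredient x) = x := by
  have h1 : contragredient x * x.transpose = 1 := by
    apply Subtype.ext
    rw [contragredient, coe_mul, coe_transpose, coe_transpose, ← transpose_mul, ← coe_mul,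
      mul_inv_cancel, coe_one, transpose_one]
  rw [contragredient, inv_eq_of_mul_eq_one_right h1]
  apply Subtype.ext
  simp

theorem contragredient_transvection {i j : Fin n} (hij : i ≠ j) (c : ℤ) :
    contragredient (transvection hij c) = (transvection hij.symm c)⁻¹ := by
  rw [contragredient, transvection_inv, transvection_inv]
  apply Subtype.ext
  rw [coe_transpose, transvection_coe, transvection_coe, transpose_add, transpose_one,
    transpose_single]

theorem comp_contragredient (hΦ : IsSignHom Φ) : IsSignHom (fun x => Φ (contragredient x)) where
  map_mul x y := by
    rw [contragredient_mul]
    exact hΦ.map_mul _ _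
  eq_one x hx := by
    have h1 := hΦ.eq_one _ hx
    rw [contragredient, coe_transpose] at h1
    have h2 : SignEq (x⁻¹).1 1 := by
      rcases h1 with h | h
      · left; rw [← transpose_transpose (x⁻¹).1, h, transpose_one]
      · right; rw [← transpose_transpose (x⁻¹).1, h, transpose_neg, transpose_one]
    have h3 := (SignEq.refl x.1).mul h2
    rw [← coe_mul, mul_inv_cancel, mul_one, coe_one] at h3
    exact h3.symm

/-- Injective homomorphisms up to sign `SL(n, ℤ) → SL(n, ℤ)`, `n ≥ 3`, are up to sign given by
`x ↦ g x g⁻¹` or `x ↦ g x⁻ᵀ g⁻¹` with `g ∈ GL(n, ℤ)`. -/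
theorem exists_conj (hΦ : IsSignHom Φ) (hn : 3 ≤ n) : ∃ g : GL (Fin n) ℤ,
    (∀ x, SignEq ((Φ x).1 * g.1) (g.1 * x.1)) ∨
      (∀ x, SignEq ((Φ x).1 * g.1) (g.1 * (contragredient x).1)) := by
  obtain ⟨m, T, hm, hT, hN⟩ := hΦ.exists_isRootFamily hn
  rcases hN.dichotomy (by exact_mod_cast hm.ne') with h | h
  · obtain ⟨g, hg⟩ := hΦ.exists_conj_of_isRootFamily hn hm hT hN h
    exact ⟨g, Or.inl hg⟩
  -- In the other orientation, precompose with the contragredient. The lifts become `(T j i)⁻¹`, and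
  -- exchanging the indices reverses the order of the vanishing products.
  · have hinv : ∀ i j, i ≠ j → ((T j i)⁻¹).1 - 1 = -((T j i).1 - 1) := by
      intro i j hij
      have h1 := hN.mul_eq_zero j i j i hij.symm hij.symm hij hij.symm
      have h2 : (T j i).1 * (1 - ((T j i).1 - 1)) = 1 := by
        have : (T j i).1 * (1 - ((T j i).1 - 1)) = 1 - ((T j i).1 - 1) * ((T j i).1 - 1) := by
          noncomm_ring
        rw [this, h1, sub_zero]
      rw [Units.inv_eq_of_mul_eq_one_right h2]
      abel
    have hT' : IsLiftFamily (fun x => Φ (contragredient x)) m (fun i j => (T j i)⁻¹) := by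
      intro i j hij
      have := (hT j i hij.symm).inv hΦ
      refine ⟨this.unip, ?_⟩
      have h2 := this.signEq
      rw [← contragredient_transvection hij] at h2
      exact h2
    obtain ⟨g, hg⟩ := hΦ.comp_contragredient.exists_conj_of_isRootFamily hn hm hT' (by
      refine ⟨?_, ?_, ?_, ?_⟩
      · intro i j hij
        simp only [hinv i j hij]
        exact neg_ne_zero.mpr (hN.ne_zero j i hij.symm)
      · intro i j k l hij hkl hjk hil
        simp only [hinv i j hij, hinv k l hkl, neg_mul_neg]
        exact hN.mul_eq_zero j i l k hij.symm hkl.symm hil hjk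
      · intro i j k hij hjk hik
        have := hN.comm k j i hjk.symm hij.symm hik.symm
        simp only [hinv i j hij, hinv j k hjk, hinv i k hik, neg_mul_neg, smul_neg, ← this]
        abel
      · intro i j hij x z h
        simp only [hinv i j hij, mul_neg, neg_mul, neg_eq_zero] at h ⊢
        exact hN.prime j i hij.symm x z h) (by
      intro i j k hij hjk hik
      simp only [hinv i j hij, hinv j k hjk, neg_mul_neg]
      exact h k j i hjk.symm hij.symm hik.symm)
    refine ⟨g, Or.inr fun x => ?_⟩
    have := hg (contragredient x)
    rwa [contragredient_contragredient] at this

end IsSignHom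

/-! ### From classifications up to sign to twisted conjugacy classes -/

section Invariants

variable {n : ℕ}

theorem mk_eq_mk_iff_signEq (hn : n ≠ 0) {x y : SL(n, ℤ)} :
    (QuotientGroup.mk x : PSL(n, ℤ)) = QuotientGroup.mk y ↔ SignEq x.1 y.1 := by
  rw [QuotientGroup.eq, mem_center_iff, Fintype.card_fin]
  constructor
  · rintro ⟨r, hr, h⟩
    have h1 : y.1 = x.1 * scalar (Fin n) r := by
      rw [h, ← coe_mul, mul_inv_cancel_left]
    have hr' : r = 1 ∨ r = -1 := Int.isUnit_iff.mp (IsUnit.of_pow_eq_one hr hn)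
    rcases hr' with rfl | rfl
    · left; simp [h1]
    · right; simp [h1]
  · rintro (h | h)
    · exact ⟨1, one_pow n, by rw [Subtype.ext h, inv_mul_cancel]; simp⟩
    · refine ⟨-1, ?_, ?_⟩
      · have := congrArg Matrix.det h
        rw [det_neg, x.2, y.2, Fintype.card_fin, mul_one] at this
        exact this.symm
      · have h1 : y.1 = -x.1 := by rw [h, neg_neg]
        rw [coe_mul, h1, mul_neg, ← coe_mul, inv_mul_cancel]
        simp

/-- A map lifting an automorphism of `PSL(n, ℤ)` is an injective homomorphism up to sign. -/
theorem isSignHom_of_lift (hn : n ≠ 0) (φ : PSL(n, ℤ) ≃* PSL(n, ℤ)) {Φ : SL(n, ℤ) → SL(n, ℤ)}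
    (hΦ : ∀ x : SL(n, ℤ), (QuotientGroup.mk (Φ x) : PSL(n, ℤ)) = φ (QuotientGroup.mk x)) :
    IsSignHom Φ where
  map_mul x y := by
    rw [← mk_eq_mk_iff_signEq hn, hΦ, QuotientGroup.mk_mul, QuotientGroup.mk_mul, map_mul, hΦ, hΦ]
  eq_one x hx := by
    rw [← coe_one, ← mk_eq_mk_iff_signEq hn] at hx ⊢
    rw [hΦ, QuotientGroup.mk_one, ← map_one φ] at hx
    exact φ.injective hx

/-- As `F` ignores signs, its invariance can be checked on representatives in `SL(n, ℤ)`, although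
`Φ` is not a homomorphism. -/
theorem infinite_twistedConjClasses_PSL (hn : n ≠ 0) (φ : PSL(n, ℤ) ≃* PSL(n, ℤ))
    {Φ : SL(n, ℤ) → SL(n, ℤ)}
    (hΦ : ∀ x : SL(n, ℤ), (QuotientGroup.mk (Φ x) : PSL(n, ℤ)) = φ (QuotientGroup.mk x))
    (F : Matrix (Fin n) (Fin n) ℤ → ℕ) (hneg : ∀ A, F (-A) = F A)
    (hF : ∀ h x : SL(n, ℤ), F (h * x * Φ h⁻¹).1 = F x.1)
    (hinf : (Set.range fun x : SL(n, ℤ) => F x.1).Infinite) :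
    Infinite (TwistedConjClasses φ.toMonoidHom) := by
  have hsign : ∀ {x y : SL(n, ℤ)}, (QuotientGroup.mk x : PSL(n, ℤ)) = QuotientGroup.mk y →
      F x.1 = F y.1 := by
    intro x y hxy
    rcases (mk_eq_mk_iff_signEq hn).mp hxy with h | h
    · rw [h]
    · rw [h, hneg]
  have hmk : ∀ x : SL(n, ℤ), F (Quotient.out (QuotientGroup.mk x : PSL(n, ℤ))).1 = F x.1 :=
    fun x => hsign (QuotientGroup.out_eq' _)
  refine infinite_twistedConjClasses_of_invariant _ (fun q => F (Quotient.out q).1) ?_ ?_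
  · intro h x
    obtain ⟨h, rfl⟩ := QuotientGroup.mk_surjective h
    obtain ⟨x, rfl⟩ := QuotientGroup.mk_surjective x
    have h1 : (QuotientGroup.mk h : PSL(n, ℤ)) * QuotientGroup.mk x *
        φ.toMonoidHom (QuotientGroup.mk h)⁻¹ = QuotientGroup.mk (h * x * Φ h⁻¹) := by
      rw [QuotientGroup.mk_mul, QuotientGroup.mk_mul, hΦ]
      rfl
    rw [h1, hmk, hmk, hF]
  · refine hinf.mono ?_
    rintro _ ⟨x, rfl⟩
    exact ⟨QuotientGroup.mk x, hmk x⟩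

/-- A family of integral matrices of determinant `d`. -/
def detFamily (m : ℕ) (d k : ℤ) : Matrix (Fin (2 + m)) (Fin (2 + m)) ℤ :=
  reindex finSumFinEquiv finSumFinEquiv (fromBlocks !![1, k; 1, k + d] 0 0 1)

theorem det_detFamily (m : ℕ) (d k : ℤ) : (detFamily m d k).det = d := by
  rw [detFamily, det_reindex_self, det_fromBlocks_zero₂₁, det_one, det_fin_two_of]
  ring

theorem trace_detFamily (m : ℕ) (d k : ℤ) : (detFamily m d k).trace = 1 + k + d + m := by
  have h : ∀ A : Matrix (Fin 2 ⊕ Fin m) (Fin 2 ⊕ Fin m) ℤ,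
      (reindex finSumFinEquiv finSumFinEquiv A).trace = A.trace := by
    intro A
    simp only [trace, diag_apply, reindex_apply, submatrix_apply]
    exact Equiv.sum_comp finSumFinEquiv.symm fun i => A i i
  rw [detFamily, h]
  simp [trace, Fintype.sum_sum_type]
  ring

/-- The first block gives `4 (k + d) - (k + 1)² = 4 d - (k - 1)²`; each further diagonal entry
contributes a factor `2`. -/
theorem det_detFamily_add_transpose (m : ℕ) (d k : ℤ) :
    (detFamily m d k + (detFamily m d k)ᵀ).det = (4 * d - (k - 1) ^ 2) * 2 ^ m := by
  have h : detFamily m d k + (detFamily m d k)ᵀ = reindex finSumFinEquiv finSumFinEquiv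
      (fromBlocks (!![1, k; 1, k + d] + !![1, k; 1, k + d]ᵀ) 0 0 (1 + 1)) := by
    have hadd : ∀ A B : Matrix (Fin 2 ⊕ Fin m) (Fin 2 ⊕ Fin m) ℤ,
        reindex finSumFinEquiv finSumFinEquiv A + reindex finSumFinEquiv finSumFinEquiv B =
          reindex finSumFinEquiv finSumFinEquiv (A + B) := fun _ _ => rfl
    rw [detFamily, transpose_reindex, fromBlocks_transpose, transpose_one, transpose_zero,
      transpose_zero, hadd, fromBlocks_add, add_zero, add_zero]
  have h2 : (1 + 1 : Matrix (Fin m) (Fin m) ℤ) = (2 : ℤ) • 1 := (two_smul ℤ 1).symm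
  rw [h, det_reindex_self, det_fromBlocks_zero₂₁, h2, det_smul, det_one, mul_one, Fintype.card_fin,
    det_fin_two]
  simp
  ring

theorem exists_mul_eq_of_det_eq (g : GL (Fin n) ℤ) {M : Matrix (Fin n) (Fin n) ℤ}
    (hM : M.det = g.1.det) : ∃ x : SL(n, ℤ), x.1 * g.1 = M := by
  refine ⟨⟨M * (g⁻¹).1, ?_⟩, ?_⟩
  · rw [det_mul, hM, ← det_mul, Units.mul_inv, det_one]
  · rw [mul_assoc, Units.inv_mul, mul_one]

theorem det_eq_one_or (g : GL (Fin n) ℤ) : g.1.det = 1 ∨ g.1.det = -1 :=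
  Int.isUnit_iff.mp ((isUnit_iff_isUnit_det _).mp g.isUnit)

theorem infinite_range_trace_mul (hn : 2 ≤ n) (g : GL (Fin n) ℤ) :
    (Set.range fun x : SL(n, ℤ) => (x.1 * g.1).trace.natAbs).Infinite := by
  obtain ⟨m, rfl⟩ := Nat.exists_eq_add_of_le hn
  refine Set.infinite_of_injective_forall_mem
    (f := fun k : ℕ => (1 + (k : ℤ) + g.1.det + m).natAbs) ?_ ?_
  · intro k l h
    simp only at h
    rcases det_eq_one_or g with h1 | h1 <;> rw [h1] at h <;> omega
  · intro k
    obtain ⟨x, hx⟩ := exists_mul_eq_of_det_eq g (det_detFamily m g.1.det k)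
    exact ⟨x, by simp only [hx, trace_detFamily]⟩

theorem infinite_range_det_add_transpose (hn : 2 ≤ n) (g : GL (Fin n) ℤ) :
    (Set.range fun x : SL(n, ℤ) => (x.1 * g.1 + (x.1 * g.1)ᵀ).det.natAbs).Infinite := by
  obtain ⟨m, rfl⟩ := Nat.exists_eq_add_of_le hn
  refine Set.infinite_of_injective_forall_mem
    -- The shift by `3` turns the square into `(k + 2)² ≥ 4`, so `4 * det g - (k + 2)²` never
    -- changes sign and its absolute value is injective in `k`.
    (f := fun k : ℕ => ((4 * g.1.det - ((k + 3 : ℤ) - 1) ^ 2) * 2 ^ m).natAbs) ?_ ?_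
  · intro k l h
    simp only [Int.natAbs_mul] at h
    have h2 := Nat.eq_of_mul_eq_mul_right (by simp) h
    rcases det_eq_one_or g with h1 | h1 <;> rw [h1] at h2
    all_goals
      have h3 : ∀ j : ℕ, ((j : ℤ) + 3 - 1) ^ 2 = ((j + 2) ^ 2 : ℕ) := by
        intro j; push_cast; ring
      rw [h3, h3] at h2
      have h4 : ∀ j : ℕ, 4 ≤ (j + 2) ^ 2 := fun j =>
        Nat.pow_le_pow_left (by omega : 2 ≤ j + 2) 2
      have := h4 k
      have := h4 l
      have h5 : (k + 2) ^ 2 = (l + 2) ^ 2 := by omega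
      have := Nat.pow_left_injective (by norm_num : 2 ≠ 0) h5
      omega
  · intro k
    obtain ⟨x, hx⟩ := exists_mul_eq_of_det_eq g (det_detFamily m g.1.det (k + 3))
    exact ⟨x, by simp only [hx, det_detFamily_add_transpose]⟩

theorem infinite_twistedConjClasses_of_conj (hn : 2 ≤ n) (φ : PSL(n, ℤ) ≃* PSL(n, ℤ))
    {Φ : SL(n, ℤ) → SL(n, ℤ)}
    (hΦ : ∀ x : SL(n, ℤ), (QuotientGroup.mk (Φ x) : PSL(n, ℤ)) = φ (QuotientGroup.mk x))
    (g : GL (Fin n) ℤ) (hg : ∀ x, SignEq ((Φ x).1 * g.1) (g.1 * x.1)) :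
    Infinite (TwistedConjClasses φ.toMonoidHom) := by
  refine infinite_twistedConjClasses_PSL (by omega) φ hΦ (fun A => (A * g.1).trace.natAbs) ?_ ?_
    (infinite_range_trace_mul hn g)
  · intro A
    simp only [neg_mul, trace_neg, Int.natAbs_neg]
  · intro h x
    -- Up to sign, twisted conjugation of `x` is ordinary conjugation of `x g` by `h`.
    have h1 : ((h * x).1 * (g.1 * (h⁻¹).1)).trace = (x.1 * g.1).trace := by
      rw [coe_mul, mul_assoc, trace_mul_comm, mul_assoc, mul_assoc, ← coe_mul, inv_mul_cancel,
        coe_one, mul_one]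
    simp only [coe_mul (h * x), mul_assoc (h * x).1]
    rcases hg h⁻¹ with h2 | h2
    · rw [h2, h1]
    · rw [h2, mul_neg, trace_neg, Int.natAbs_neg, h1]

theorem infinite_twistedConjClasses_of_contragredient (hn : 2 ≤ n) (φ : PSL(n, ℤ) ≃* PSL(n, ℤ))
    {Φ : SL(n, ℤ) → SL(n, ℤ)}
    (hΦ : ∀ x : SL(n, ℤ), (QuotientGroup.mk (Φ x) : PSL(n, ℤ)) = φ (QuotientGroup.mk x))
    (g : GL (Fin n) ℤ)
    (hg : ∀ x, SignEq ((Φ x).1 * g.1) (g.1 * (IsSignHom.contragredient x).1)) :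
    Infinite (TwistedConjClasses φ.toMonoidHom) := by
  have hneg : ∀ A : Matrix (Fin n) (Fin n) ℤ, (-A + (-A)ᵀ).det.natAbs = (A + Aᵀ).det.natAbs := by
    intro A
    rw [transpose_neg, ← neg_add, det_neg, Int.natAbs_mul]
    simp
  refine infinite_twistedConjClasses_PSL (by omega) φ hΦ
    (fun A => (A * g.1 + (A * g.1)ᵀ).det.natAbs) ?_ ?_ (infinite_range_det_add_transpose hn g)
  · intro A
    simp only [neg_mul, hneg]
  · intro h x
    set B := x.1 * g.1 with hB
    have h0 : (IsSignHom.contragredient h⁻¹).1 = h.1ᵀ := by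
      rw [IsSignHom.contragredient, inv_inv, coe_transpose]
    -- Here `x g` transforms like the Gram matrix of a bilinear form, so its symmetrization keeps
    -- its determinant under `h` of determinant one.
    have h1 : (h * x).1 * (g.1 * h.1ᵀ) = h.1 * B * h.1ᵀ := by
      rw [coe_mul, hB]
      simp only [mul_assoc]
    have h2 : (h.1 * B * h.1ᵀ + (h.1 * B * h.1ᵀ)ᵀ).det = (B + Bᵀ).det := by
      have : h.1 * B * h.1ᵀ + (h.1 * B * h.1ᵀ)ᵀ = h.1 * (B + Bᵀ) * h.1ᵀ := by
        rw [transpose_mul, transpose_mul, transpose_transpose, mul_add, add_mul, mul_assoc h.1 Bᵀ]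
      rw [this, det_mul, det_mul, det_transpose, h.2, one_mul, mul_one]
    simp only [coe_mul (h * x), mul_assoc (h * x).1]
    rcases hg h⁻¹ with h3 | h3
    · rw [h3, h0, h1, h2]
    · rw [h3, h0, mul_neg, h1, hneg, h2]

theorem exists_lift (φ : PSL(n, ℤ) ≃* PSL(n, ℤ)) : ∃ Φ : SL(n, ℤ) → SL(n, ℤ),
    ∀ x : SL(n, ℤ), (QuotientGroup.mk (Φ x) : PSL(n, ℤ)) = φ (QuotientGroup.mk x) :=
  ⟨fun x => Quotient.out (φ (QuotientGroup.mk x)), fun _ => QuotientGroup.out_eq' _⟩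

theorem hasRInfty_PSL_of_three_le (hn : 3 ≤ n) : HasRInfty PSL(n, ℤ) := by
  intro φ
  obtain ⟨Φ, hΦ⟩ := exists_lift φ
  obtain ⟨g, hg | hg⟩ := (isSignHom_of_lift (by omega) φ hΦ).exists_conj hn
  · exact infinite_twistedConjClasses_of_conj (by omega) φ hΦ g hg
  · exact infinite_twistedConjClasses_of_contragredient (by omega) φ hΦ g hg

/-! ### From `PSL` to `PGL` when `n ≥ 3` -/

theorem commutator_SL_eq_top (hn : 3 ≤ n) : commutator SL(n, ℤ) = ⊤ := by
  rw [eq_top_iff, ← closure_transvection_one, Subgroup.closure_le]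
  rintro _ ⟨i, j, hij, rfl⟩
  obtain ⟨k, -, hk⟩ := Finset.exists_mem_notMem_of_card_lt_card (s := {i, j})
    (t := Finset.univ) (lt_of_le_of_lt Finset.card_le_two (by simp; omega))
  obtain ⟨hki, hkj⟩ : k ≠ i ∧ k ≠ j := by simpa using hk
  have h := transvection_mul_transvection hki.symm hkj hij (1 : ℤ) 1
  rw [one_mul, mul_assoc, ← mul_inv_eq_iff_eq_mul, _root_.mul_inv_rev, ← mul_assoc] at h
  rw [← h, ← commutatorElement_def]
  exact Subgroup.commutator_mem_commutator (Subgroup.mem_top _) (Subgroup.mem_top _)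

theorem range_toPGL_eq_map_ker_det : (ProjectiveSpecialLinearGroup.toPGL (n := Fin n) (R := ℤ)).range =
    (GeneralLinearGroup.det (n := Fin n) (R := ℤ)).ker.map ProjGenLinGroup.mk := by
  ext q
  constructor
  · rintro ⟨p, rfl⟩
    obtain ⟨x, rfl⟩ := QuotientGroup.mk_surjective p
    refine ⟨toGL x, ?_, rfl⟩
    rw [SetLike.mem_coe, MonoidHom.mem_ker]
    apply Units.ext
    exact x.2
  · rintro ⟨g, hg, rfl⟩
    rw [SetLike.mem_coe, MonoidHom.mem_ker] at hg
    exact ⟨QuotientGroup.mk ⟨g.1, congrArg Units.val hg⟩, congrArg ProjGenLinGroup.mk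
      (Units.ext rfl : toGL ⟨g.1, congrArg Units.val hg⟩ = g)⟩

/-- Commutators in `GL` have determinant one, and `SL(n, ℤ)` is perfect for `n ≥ 3`. This
identification makes the image of `PSL` characteristic in `PGL`. -/
theorem range_toPGL_eq_commutator (hn : 3 ≤ n) :
    (ProjectiveSpecialLinearGroup.toPGL (n := Fin n) (R := ℤ)).range = commutator PGL(n, ℤ) := by
  apply le_antisymm
  · rintro _ ⟨p, rfl⟩
    obtain ⟨x, rfl⟩ := QuotientGroup.mk_surjective p
    have hx : x ∈ commutator SL(n, ℤ) := by rw [commutator_SL_eq_top hn]; trivial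
    have h1 : SpecialLinearGroup.toPGL x ∈ (commutator SL(n, ℤ)).map SpecialLinearGroup.toPGL :=
      ⟨x, hx, rfl⟩
    rw [commutator_def, Subgroup.map_commutator] at h1
    exact Subgroup.commutator_mono le_top le_top h1
  · rw [range_toPGL_eq_map_ker_det, commutator_def,
      ← (MonoidHom.range_eq_top.mpr ProjGenLinGroup.mk_surjective), MonoidHom.range_eq_map,
      ← Subgroup.map_commutator, ← commutator_def]
    exact Subgroup.map_mono (Abelianization.commutator_subset_ker _)

theorem hasRInfty_PGL_of_three_le (hn : 3 ≤ n) : HasRInfty PGL(n, ℤ) := by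
  have hrange := range_toPGL_eq_commutator hn
  have : (commutator PGL(n, ℤ)).FiniteIndex := by
    rw [← hrange, range_toPGL_eq_map_ker_det]
    have h1 : (GeneralLinearGroup.det (n := Fin n) (R := ℤ)).ker.FiniteIndex := inferInstance
    exact ⟨fun h => h1.index_ne_zero
      (Nat.eq_zero_of_zero_dvd (h ▸ Subgroup.index_map_dvd _ ProjGenLinGroup.mk_surjective))⟩
  apply HasRInfty.of_subgroup (commutator PGL(n, ℤ))
  exact (hasRInfty_PSL_of_three_le hn).of_mulEquiv
    ((MonoidHom.ofInjective ProjectiveSpecialLinearGroup.toPGL_injective).trans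
      (MulEquiv.subgroupCongr hrange))

end Invariants

/-! ### Elements of finite order in `SL(2, ℤ)` -/

section Torsion

/-- The off-diagonal entries of `M²` are those of `M` times the trace. A nonzero trace would make
`M` diagonal, hence `±1`. For the cube, below, the factor is `tr² - 1`. -/
theorem trace_eq_zero_of_sq {M : Matrix (Fin 2) (Fin 2) ℤ} (hdet : M.det = 1)
    (h2 : SignEq (M ^ 2) 1) (h1 : ¬ SignEq M 1) : M.trace = 0 := by
  rw [det_fin_two] at hdet
  rw [trace_fin_two]
  rcases h2 with h | h
  all_goals
    have e00 := congrFun (congrFun h 0) 0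
    have e01 := congrFun (congrFun h 0) 1
    have e10 := congrFun (congrFun h 1) 0
    have e11 := congrFun (congrFun h 1) 1
    simp only [sq, mul_apply, Fin.sum_univ_two, neg_apply, one_apply_eq, ne_eq, zero_ne_one,
      not_false_eq_true, one_apply_ne, one_ne_zero, neg_zero] at e00 e01 e10 e11
    by_contra ht
    have hb : M 0 1 = 0 := (mul_eq_zero.mp (show M 0 1 * (M 0 0 + M 1 1) = 0 by linarith)).resolve_right ht
    have hc : M 1 0 = 0 := (mul_eq_zero.mp (show M 1 0 * (M 0 0 + M 1 1) = 0 by linarith)).resolve_right ht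
    rw [hb, zero_mul, sub_zero] at hdet
    apply h1
    rcases Int.mul_eq_one_iff_eq_one_or_neg_one.mp hdet with ⟨ha, hd⟩ | ⟨ha, hd⟩
    · left
      ext i j
      fin_cases i <;> fin_cases j <;> simp [ha, hb, hc, hd]
    · right
      ext i j
      fin_cases i <;> fin_cases j <;> simp [ha, hb, hc, hd]

theorem trace_eq_one_or_of_cube {M : Matrix (Fin 2) (Fin 2) ℤ} (hdet : M.det = 1)
    (h3 : SignEq (M ^ 3) 1) (h1 : ¬ SignEq M 1) : M.trace = 1 ∨ M.trace = -1 := by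
  rw [det_fin_two] at hdet
  rw [trace_fin_two]
  have key : (M 0 0 + M 1 1) ^ 2 - 1 = 0 := by
    have hoff : (M 0 1 * ((M 0 0 + M 1 1) ^ 2 - 1) = 0) ∧ (M 1 0 * ((M 0 0 + M 1 1) ^ 2 - 1) = 0) := by
      rcases h3 with h | h
      all_goals
        have e01 := congrFun (congrFun h 0) 1
        have e10 := congrFun (congrFun h 1) 0
        simp only [pow_succ, pow_zero, one_mul, mul_apply, Fin.sum_univ_two, neg_apply, ne_eq,
          zero_ne_one, not_false_eq_true, one_apply_ne, one_ne_zero, neg_zero] at e01 e10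
        constructor
        · linear_combination e01 + M 0 1 * hdet
        · linear_combination e10 + M 1 0 * hdet
    by_contra ht
    have hb : M 0 1 = 0 := (mul_eq_zero.mp hoff.1).resolve_right ht
    have hc : M 1 0 = 0 := (mul_eq_zero.mp hoff.2).resolve_right ht
    rw [hb, zero_mul, sub_zero] at hdet
    apply h1
    rcases Int.mul_eq_one_iff_eq_one_or_neg_one.mp hdet with ⟨ha, hd⟩ | ⟨ha, hd⟩
    · left
      ext i j
      fin_cases i <;> fin_cases j <;> simp [ha, hb, hc, hd]
    · right
      ext i j
      fin_cases i <;> fin_cases j <;> simp [ha, hb, hc, hd]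
  exact sq_eq_one_iff.mp (sub_eq_zero.mp key)

/-- Elements of `SL(2, ℤ)` of trace `0` or `1` are conjugate to `!![0, -1; 1, t]` or
`!![0, 1; -1, t]`. -/
theorem exists_conj_of_trace {t : ℤ} (ht : t = 0 ∨ t = 1) (A : SL(2, ℤ)) (hA : A.1.trace = t) :
    ∃ h : SL(2, ℤ), (h * A * h⁻¹).1 = !![0, -1; 1, t] ∨ (h * A * h⁻¹).1 = !![0, 1; -1, t] := by
  suffices ∀ (N : ℕ) (A : SL(2, ℤ)), A.1.trace = t → (A 1 0).natAbs = N →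
      ∃ h : SL(2, ℤ), (h * A * h⁻¹).1 = !![0, -1; 1, t] ∨ (h * A * h⁻¹).1 = !![0, 1; -1, t] from
    this _ A hA rfl
  intro N
  induction N using Nat.strong_induction_on with
  | _ N ih =>
  intro A hA hN
  have hdet := A.2
  rw [det_fin_two] at hdet
  rw [trace_fin_two] at hA
  obtain ⟨a, ha⟩ : ∃ a, a = A 0 0 := ⟨_, rfl⟩
  obtain ⟨b, hb⟩ : ∃ b, b = A 0 1 := ⟨_, rfl⟩
  obtain ⟨c, hc⟩ : ∃ c, c = A 1 0 := ⟨_, rfl⟩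
  obtain ⟨d, hd⟩ : ∃ d, d = A 1 1 := ⟨_, rfl⟩
  have hAm : A.1 = !![a, b; c, d] := by
    rw [ha, hb, hc, hd]
    exact eta_fin_two A.1
  rw [← ha, ← hd] at hA
  rw [← ha, ← hb, ← hc, ← hd] at hdet
  rw [← hc] at hN
  have hconj : ∀ k : ℤ, (ModularGroup.T ^ k * A * (ModularGroup.T ^ k)⁻¹).1 =
      !![a + k * c, b + k * d - k * (a + k * c); c, d - k * c] := by
    intro k
    rw [← _root_.zpow_neg, coe_mul, coe_mul, ModularGroup.coe_T_zpow, ModularGroup.coe_T_zpow, hAm]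
    ext i j
    fin_cases i <;> fin_cases j <;> simp [mul_apply, Fin.sum_univ_two] <;> ring
  have hc0 : c ≠ 0 := by
    rintro rfl
    rw [mul_zero, sub_zero] at hdet
    rcases Int.mul_eq_one_iff_eq_one_or_neg_one.mp hdet with ⟨h1, h2⟩ | ⟨h1, h2⟩ <;> omega
  by_cases hc1 : c = 1 ∨ c = -1
  · refine ⟨ModularGroup.T ^ (-a * c), ?_⟩
    rw [hconj]
    rcases hc1 with rfl | rfl
    · left
      ext i j
      fin_cases i <;> fin_cases j <;> simp <;> linarith
    · right
      ext i j
      fin_cases i <;> fin_cases j <;> simp <;> linarith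
  -- Reduction as for binary quadratic forms: conjugation by `T ^ k` shifts `a` by `k c`. The
  -- quotient by `2 c` is chosen so that `2 (a + k c) - t` is a remainder minus `|c|`.
  · obtain ⟨k, hk⟩ : ∃ k : ℤ, |2 * (a + k * c) - t| ≤ |c| := by
      have h1 := Int.emod_nonneg (2 * a - t + |c|) (b := 2 * c) (by omega)
      have h2 := Int.emod_lt_abs (2 * a - t + |c|) (b := 2 * c) (by omega)
      have h3 := Int.emod_add_mul_ediv (2 * a - t + |c|) (2 * c)
      rw [abs_mul, abs_two] at h2
      refine ⟨-((2 * a - t + |c|) / (2 * c)), ?_⟩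
      rw [abs_le]
      constructor <;> linarith
    obtain ⟨A', hA'⟩ : ∃ A', A' = ModularGroup.T ^ k * A * (ModularGroup.T ^ k)⁻¹ := ⟨_, rfl⟩
    have hA'm := hconj k
    obtain ⟨a', ha'⟩ : ∃ a', a' = a + k * c := ⟨_, rfl⟩
    obtain ⟨b', hb'⟩ : ∃ b', b' = b + k * d - k * (a + k * c) := ⟨_, rfl⟩
    obtain ⟨d', hd'⟩ : ∃ d', d' = d - k * c := ⟨_, rfl⟩
    rw [← hA', ← hb', ← ha', ← hd'] at hA'm
    rw [← ha'] at hk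
    have hdet' : a' * d' - b' * c = 1 := by rw [ha', hb', hd']; linear_combination hdet
    have htr' : a' + d' = t := by rw [ha', hd']; linarith
    have hSm : (ModularGroup.S * A' * ModularGroup.S⁻¹).1 = !![d', -c; -b', a'] := by
      rw [ModularGroup.S_inv, coe_mul, coe_mul, coe_neg, ModularGroup.coe_S, hA'm]
      ext i j
      fin_cases i <;> fin_cases j <;> simp [mul_apply, Fin.sum_univ_two]
    have hlt : b'.natAbs < N := by
      rw [← hN]
      have hcabs : 2 ≤ |c| := by
        rcases abs_cases c with ⟨h1, h2⟩ | ⟨h1, h2⟩ <;> omega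
      have h1 : (2 * a' - t) ^ 2 ≤ |c| ^ 2 := by
        rw [← sq_abs]
        exact pow_le_pow_left₀ (abs_nonneg _) hk 2
      -- Trace and determinant give this identity; with `|2 a' - t| ≤ |c|` and `|c| ≥ 2` it forces
      -- `|b'| < |c|`. Conjugation by `S` then moves `-b'` into the lower left corner.
      have h2 : 4 * (b' * c) = t ^ 2 - (2 * a' - t) ^ 2 - 4 := by
        have : d' = t - a' := by linarith
        rw [this] at hdet'
        linear_combination (-4) * hdet'
      have ht2 : 0 ≤ t ^ 2 ∧ t ^ 2 ≤ 1 := by rcases ht with rfl | rfl <;> norm_num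
      have h3 : 4 * (|b'| * |c|) ≤ 4 + |c| ^ 2 := by
        rw [← abs_mul]
        have h4 : b' * c ≤ 0 := by nlinarith [sq_nonneg (2 * a' - t)]
        rw [abs_of_nonpos h4]
        linarith
      have h5 : |b'| < |c| := by
        by_contra! h6
        nlinarith
      have := Int.natCast_natAbs b'
      have := Int.natCast_natAbs c
      omega
    obtain ⟨h, hh⟩ := ih _ hlt (ModularGroup.S * A' * ModularGroup.S⁻¹)
      (by rw [hSm, trace_fin_two_of]; linarith)
      (by rw [show (ModularGroup.S * A' * ModularGroup.S⁻¹) 1 0 = -b' from congrFun (congrFun hSm 1) 0,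
        Int.natAbs_neg])
    refine ⟨h * ModularGroup.S * ModularGroup.T ^ k, ?_⟩
    have : h * ModularGroup.S * ModularGroup.T ^ k * A * (h * ModularGroup.S * ModularGroup.T ^ k)⁻¹ =
        h * (ModularGroup.S * A' * ModularGroup.S⁻¹) * h⁻¹ := by
      rw [hA']
      group
    rw [this]
    exact hh

end Torsion

/-! ### Ping-pong in `SL(2, ℤ)` -/

section PingPong

theorem signEq_coe_iff {x y : SL(2, ℤ)} : SignEq x.1 y.1 ↔ SignEq x y := by
  constructor
  · rintro (h | h)
    · exact Or.inl (Subtype.ext h)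
    · exact Or.inr (Subtype.ext h)
  · rintro (h | h)
    · exact Or.inl (congrArg Subtype.val h)
    · exact Or.inr (congrArg Subtype.val h)

theorem S_mul_S : ModularGroup.S * ModularGroup.S = (-1 : SL(2, ℤ)) := by
  rw [← mul_inv_cancel ModularGroup.S, ModularGroup.S_inv, mul_neg, neg_neg]

theorem S_mul_S_mul (w : SL(2, ℤ)) : ModularGroup.S * (ModularGroup.S * w) = -w := by
  rw [← mul_assoc, S_mul_S, neg_one_mul]

theorem cube_eq_neg_one {B : SL(2, ℤ)} (hB : B.1.trace = 1) : B * B * B = -1 := by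
  have hdet := B.2
  rw [det_fin_two] at hdet
  rw [trace_fin_two] at hB
  have hd : B.1 1 1 = 1 - B.1 0 0 := by linarith
  rw [hd] at hdet
  apply Subtype.ext
  rw [coe_mul, coe_mul, coe_neg]
  ext i j
  fin_cases i <;> fin_cases j <;> simp [Matrix.mul_apply, Fin.sum_univ_two, hd]
  · linear_combination (-B.1 0 0 - 1) * hdet
  · linear_combination (-B.1 0 1) * hdet
  · linear_combination (-B.1 1 0) * hdet
  · linear_combination (B.1 0 0 - 2) * hdet

/-- Reduced words in `S` and an element `B` of order 3 (up to sign) whose first letter is `S`,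
together with the empty word. -/
inductive ReducedWord (B : SL(2, ℤ)) : SL(2, ℤ) → Prop
  | one : ReducedWord B 1
  | S : ReducedWord B ModularGroup.S
  | mul {w : SL(2, ℤ)} : ReducedWord B w → ReducedWord B (ModularGroup.S * (B * w))
  | mul_inv {w : SL(2, ℤ)} : ReducedWord B w → ReducedWord B (ModularGroup.S * (B⁻¹ * w))

/-- Up to sign, every element of the subgroup generated by `S` and `B` is a reduced word. -/
theorem exists_reducedWord {B : SL(2, ℤ)} (hB : B * B * B = -1) {w : SL(2, ℤ)}
    (hw : w ∈ Subgroup.closure {ModularGroup.S, B}) :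
    ∃ v, ReducedWord B v ∧ (SignEq w v ∨ SignEq w (B * v) ∨ SignEq w (B⁻¹ * v)) := by
  have hBB : B * B = -B⁻¹ := by
    rw [eq_mul_inv_of_mul_eq hB, neg_one_mul]
  have hBB' : B⁻¹ * B⁻¹ = -B := by
    rw [← neg_mul_neg, ← hBB, ← mul_assoc, hB, neg_one_mul]
  have hmul : ∀ a {x y : SL(2, ℤ)}, SignEq x y → SignEq (a * x) (a * y) :=
    fun a _ _ h => (SignEq.refl a).mul h
  have hneg : ∀ x : SL(2, ℤ), SignEq (-x) x := fun x => Or.inr rfl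
  -- A new `S` in front either lengthens the word or, up to sign, cancels a leading `S`.
  have hS : ∀ {y : SL(2, ℤ)}, (∃ v, ReducedWord B v ∧
      (SignEq y v ∨ SignEq y (B * v) ∨ SignEq y (B⁻¹ * v))) → ∃ v, ReducedWord B v ∧
      (SignEq (ModularGroup.S * y) v ∨ SignEq (ModularGroup.S * y) (B * v) ∨
        SignEq (ModularGroup.S * y) (B⁻¹ * v)) := by
    rintro y ⟨v, hv, h | h | h⟩
    · have h1 := hmul ModularGroup.S h
      cases hv with
      | one => exact ⟨_, .S, .inl (by simpa using h1)⟩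
      | S => exact ⟨_, .one, .inl (by rw [S_mul_S] at h1; exact h1.trans (hneg 1))⟩
      | mul hu => exact ⟨_, hu, .inr (.inl (by rw [S_mul_S_mul] at h1; exact h1.trans (hneg _)))⟩
      | mul_inv hu =>
        exact ⟨_, hu, .inr (.inr (by rw [S_mul_S_mul] at h1; exact h1.trans (hneg _)))⟩
    · exact ⟨_, hv.mul, .inl (hmul _ h)⟩
    · exact ⟨_, hv.mul_inv, .inl (hmul _ h)⟩
  have hSinv : ∀ y : SL(2, ℤ), SignEq (ModularGroup.S⁻¹ * y) (ModularGroup.S * y) := fun y => by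
    rw [ModularGroup.S_inv, neg_mul]
    exact hneg _
  induction hw using Subgroup.closure_induction_left with
  | one => exact ⟨1, .one, .inl (SignEq.refl _)⟩
  | mul_left x hx y hy ih =>
    rcases hx with rfl | rfl
    · exact hS ih
    · obtain ⟨v, hv, h | h | h⟩ := ih
      · exact ⟨v, hv, .inr (.inl (hmul _ h))⟩
      · refine ⟨v, hv, .inr (.inr ((hmul _ h).trans ?_))⟩
        rw [← mul_assoc, hBB, neg_mul]
        exact hneg _
      · exact ⟨v, hv, .inl (by simpa using hmul x h)⟩
  | inv_mul_cancel x hx y hy ih =>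
    rcases hx with rfl | rfl
    · obtain ⟨v, hv, h⟩ := hS ih
      exact ⟨v, hv, h.imp (hSinv y).trans (Or.imp (hSinv y).trans (hSinv y).trans)⟩
    · obtain ⟨v, hv, h | h | h⟩ := ih
      · exact ⟨v, hv, .inr (.inr (hmul _ h))⟩
      · exact ⟨v, hv, .inl (by simpa using hmul x⁻¹ h)⟩
      · refine ⟨v, hv, .inr (.inl ((hmul _ h).trans ?_))⟩
        rw [← mul_assoc, hBB', neg_mul]
        exact hneg _

theorem coe_S_mul (w : SL(2, ℤ)) :
    (ModularGroup.S * w).1 = !![-w.1 1 0, -w.1 1 1; w.1 0 0, w.1 0 1] := by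
  rw [coe_mul, ModularGroup.coe_S, eta_fin_two w.1]
  ext i j
  fin_cases i <;> fin_cases j <;> simp [Matrix.mul_apply, Fin.sum_univ_two]

theorem SL2_coe_inv (w : SL(2, ℤ)) : (w⁻¹).1 = !![w.1 1 1, -w.1 0 1; -w.1 1 0, w.1 0 0] := by
  rw [coe_inv, adjugate_fin_two]

/-- In each column, the two entries are nonzero of the same sign. -/
def HasPosColumns (M : Matrix (Fin 2) (Fin 2) ℤ) : Prop := ∀ j, 0 < M 0 j * M 1 j

theorem HasPosColumns.neg {M : Matrix (Fin 2) (Fin 2) ℤ} (h : HasPosColumns M) :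
    HasPosColumns (-M) := fun j => by simpa using h j

theorem HasPosColumns.mul {P M : Matrix (Fin 2) (Fin 2) ℤ} (hP : ∀ i j, 0 < P i j)
    (hM : HasPosColumns M) : HasPosColumns (P * M) := by
  intro j
  simp only [Matrix.mul_apply, Fin.sum_univ_two]
  have h := hM j
  have h00 := hP 0 0
  have h01 := hP 0 1
  have h10 := hP 1 0
  have h11 := hP 1 1
  have : (P 0 0 * M 0 j + P 0 1 * M 1 j) * (P 1 0 * M 0 j + P 1 1 * M 1 j) =
      P 0 0 * P 1 0 * M 0 j ^ 2 + P 0 1 * P 1 1 * M 1 j ^ 2 +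
        (P 0 0 * P 1 1 + P 0 1 * P 1 0) * (M 0 j * M 1 j) := by ring
  rw [this]
  positivity

/-- The hypotheses force the lower row of `B` to be negative, so `S B` and `-S B⁻¹` have only
positive entries. Multiplication by such matrices preserves `HasPosColumns`. -/
theorem ReducedWord.eq_or_hasPosColumns {B : SL(2, ℤ)} (htr : B.1.trace = 1) (ha : 2 ≤ B.1 0 0)
    (hb : 0 < B.1 0 1) {w : SL(2, ℤ)} (hw : ReducedWord B w) :
    w = 1 ∨ w = ModularGroup.S ∨ HasPosColumns w.1 := by
  have hdet := B.2
  rw [det_fin_two] at hdet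
  rw [trace_fin_two] at htr
  have hc : B.1 1 0 < 0 := by
    by_contra! hc
    nlinarith [mul_nonneg hb.le hc]
  have hpos : ∀ {P : SL(2, ℤ)}, (∀ i j, 0 < P.1 i j) → ∀ {w : SL(2, ℤ)},
      (w = 1 ∨ w = ModularGroup.S ∨ HasPosColumns w.1) → HasPosColumns (P * w).1 := by
    rintro P hP w (rfl | rfl | h)
    · intro j
      rw [mul_one]
      exact mul_pos (hP 0 j) (hP 1 j)
    · rw [coe_mul, ModularGroup.coe_S]
      intro j
      fin_cases j
      · simpa [Matrix.mul_apply, Fin.sum_univ_two] using mul_pos (hP 0 1) (hP 1 1)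
      · simpa [Matrix.mul_apply, Fin.sum_univ_two] using mul_pos (hP 0 0) (hP 1 0)
    · rw [coe_mul]
      exact h.mul hP
  induction hw with
  | one => exact .inl rfl
  | S => exact .inr (.inl rfl)
  | mul _ ih =>
    refine .inr (.inr ?_)
    rw [← mul_assoc]
    refine hpos ?_ ih
    intro i j
    rw [coe_S_mul]
    fin_cases i <;> fin_cases j <;> simp <;> linarith
  | mul_inv _ ih =>
    refine .inr (.inr ?_)
    rw [← mul_assoc, ← neg_neg (ModularGroup.S * B⁻¹), neg_mul, coe_neg]
    refine (hpos ?_ ih).neg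
    intro i j
    rw [coe_neg, coe_S_mul, SL2_coe_inv]
    fin_cases i <;> fin_cases j <;> simp <;> linarith

/-- `T` and `S T` have a zero in their first column and are not `±1` or `±S`. A word starting with
`B` or `B⁻¹` becomes reduced after multiplying by `S`, hence the two cases. -/
theorem T_notMem_closure {B : SL(2, ℤ)} (htr : B.1.trace = 1) (ha : 2 ≤ B.1 0 0)
    (hb : 0 < B.1 0 1) : ModularGroup.T ∉ Subgroup.closure {ModularGroup.S, B} := by
  intro hT
  have hpos : ∀ {w : SL(2, ℤ)}, SignEq w ModularGroup.T ∨ SignEq w (ModularGroup.S * ModularGroup.T) →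
      ¬ ReducedWord B w := by
    intro w hw hR
    have h := hR.eq_or_hasPosColumns htr ha hb
    rcases hw with (rfl | rfl) | (rfl | rfl) <;> rcases h with h | h | h
    all_goals first | exact absurd (congrArg Subtype.val h) (by decide) | skip
    all_goals
      have := h 0
      revert this
      decide
  obtain ⟨v, hv, h | h | h⟩ := exists_reducedWord (cube_eq_neg_one htr) hT
  · exact hpos (.inl h.symm) hv
  · exact hpos (.inr ((SignEq.refl ModularGroup.S).mul h.symm)) hv.mul
  · exact hpos (.inr ((SignEq.refl ModularGroup.S).mul h.symm)) hv.mul_inv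

/-- If `S` and a matrix `B` of trace `1` generate `SL(2, ℤ)`, then the diagonal entries of `B` are
`0` and `1`. -/
theorem apply_zero_zero_of_closure {B : SL(2, ℤ)} (htr : B.1.trace = 1)
    (h : Subgroup.closure {ModularGroup.S, B} = ⊤) : B.1 0 0 = 0 ∨ B.1 0 0 = 1 := by
  have hdet := B.2
  rw [det_fin_two] at hdet
  have htr' := htr
  rw [trace_fin_two] at htr'
  have hd : B.1 1 1 = 1 - B.1 0 0 := by linarith
  have hb : B.1 0 1 ≠ 0 := by
    intro hb
    rw [hb, hd] at hdet
    nlinarith [sq_nonneg (2 * B.1 0 0 - 1)]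
  have hc : (0 < B.1 0 1 → B.1 1 0 < 0) ∧ (B.1 0 1 < 0 → 0 < B.1 1 0) := by
    have h1 : B.1 0 1 * B.1 1 0 < 0 := by rw [hd] at hdet; nlinarith [sq_nonneg (2 * B.1 0 0 - 1)]
    constructor
    · intro h2; by_contra! h3; nlinarith [mul_nonneg h2.le h3]
    · intro h2; by_contra! h3; nlinarith [mul_nonneg_of_nonpos_of_nonpos h2.le h3]
  have key : ∀ B' : SL(2, ℤ), B'.1.trace = 1 → 2 ≤ B'.1 0 0 → 0 < B'.1 0 1 →
      B ∈ Subgroup.closure {ModularGroup.S, B'} → False := by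
    intro B' h1 h2 h3 h4
    refine T_notMem_closure h1 h2 h3 ?_
    have : Subgroup.closure {ModularGroup.S, B} ≤ Subgroup.closure {ModularGroup.S, B'} := by
      rw [Subgroup.closure_le]
      rintro _ (rfl | rfl)
      · exact Subgroup.subset_closure (by simp)
      · exact h4
    exact this (h ▸ Subgroup.mem_top _)
  have hmemS : ∀ B' : SL(2, ℤ), ModularGroup.S ∈ Subgroup.closure {ModularGroup.S, B'} :=
    fun _ => Subgroup.subset_closure (by simp)
  have hmemB : ∀ B' : SL(2, ℤ), B' ∈ Subgroup.closure {ModularGroup.S, B'} :=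
    fun _ => Subgroup.subset_closure (by simp)
  have hconj : (ModularGroup.S * B * ModularGroup.S⁻¹).1 =
      !![B.1 1 1, -B.1 1 0; -B.1 0 1, B.1 0 0] := by
    rw [coe_mul, coe_S_mul, ModularGroup.S_inv, coe_neg, ModularGroup.coe_S]
    ext i j
    fin_cases i <;> fin_cases j <;> simp [Matrix.mul_apply, Fin.sum_univ_two]
  have hconj' : (ModularGroup.S * B⁻¹ * ModularGroup.S⁻¹).1 = B.1ᵀ := by
    rw [coe_mul, coe_S_mul, ModularGroup.S_inv, coe_neg, ModularGroup.coe_S, SL2_coe_inv]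
    ext i j
    fin_cases i <;> fin_cases j <;> simp [Matrix.mul_apply, Fin.sum_univ_two]
  by_contra! hne
  -- If the diagonal is not `{0, 1}`, then `B`, `B⁻¹`, or the conjugate by `S` of one of them has
  -- upper left entry at least `2` and positive upper right entry, and generates the same group with
  -- `S`.
  rcases lt_or_gt_of_ne hb with hb | hb <;> rcases le_or_gt 2 (B.1 0 0) with ha | ha
  · refine key (ModularGroup.S * B⁻¹ * ModularGroup.S⁻¹) ?_ ?_ ?_ ?_
    · rw [hconj', trace_transpose, htr]
    · rw [hconj']; exact ha
    · rw [hconj']; exact hc.2 hb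
    · set C := ModularGroup.S * B⁻¹ * ModularGroup.S⁻¹ with hC
      have : B = ModularGroup.S⁻¹ * C⁻¹ * ModularGroup.S := by rw [hC]; group
      rw [this]
      exact mul_mem (mul_mem (inv_mem (hmemS _)) (inv_mem (hmemB _))) (hmemS _)
  · refine key B⁻¹ ?_ ?_ ?_ ?_
    · rw [SL2_coe_inv, trace_fin_two_of]; linarith
    · rw [SL2_coe_inv]; simp; omega
    · rw [SL2_coe_inv]; simp; omega
    · simpa using inv_mem (hmemB B⁻¹)
  · exact key B htr ha hb (hmemB B)
  · refine key (ModularGroup.S * B * ModularGroup.S⁻¹) ?_ ?_ ?_ ?_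
    · rw [hconj, trace_fin_two_of]; linarith
    · rw [hconj]; simp; omega
    · rw [hconj]; simpa using hc.1 hb
    · set C := ModularGroup.S * B * ModularGroup.S⁻¹ with hC
      have : B = ModularGroup.S⁻¹ * C * ModularGroup.S := by rw [hC]; group
      rw [this]
      exact mul_mem (mul_mem (inv_mem (hmemS _)) (hmemB _)) (hmemS _)

end PingPong

/-! ### The group `PSL(2, ℤ)` -/

section PSLTwo

/-- The element `!![0, -1; 1, 1]` of `SL(2, ℤ)`, of order 6. -/
def elliptic : SL(2, ℤ) := ModularGroup.S * ModularGroup.T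

theorem coe_elliptic : elliptic.1 = !![0, -1; 1, 1] := by decide

theorem closure_S_elliptic : Subgroup.closure {ModularGroup.S, elliptic} = ⊤ := by
  rw [eq_top_iff, ← SpecialLinearGroup.SL2Z_generators, Subgroup.closure_le]
  have hS : ModularGroup.S ∈ Subgroup.closure {ModularGroup.S, elliptic} :=
    Subgroup.subset_closure (by simp)
  rintro _ (rfl | rfl)
  · exact hS
  · have h : ModularGroup.T = ModularGroup.S⁻¹ * elliptic := by rw [elliptic, inv_mul_cancel_left]
    rw [h]
    exact mul_mem (inv_mem hS) (Subgroup.subset_closure (by simp))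

/-- An automorphism of `SL(2, ℤ)` up to sign. -/
structure IsSignAut (Φ : SL(2, ℤ) → SL(2, ℤ)) : Prop extends IsSignHom Φ where
  neg : ∀ x, SignEq (Φ (-x)) (Φ x)
  surj : ∀ y, ∃ x, SignEq (Φ x) y

namespace IsSignAut

variable {Φ : SL(2, ℤ) → SL(2, ℤ)}

theorem mul (hΦ : IsSignAut Φ) (x y : SL(2, ℤ)) : SignEq (Φ (x * y)) (Φ x * Φ y) :=
  signEq_coe_iff.mp (hΦ.map_mul x y)

theorem map_one (hΦ : IsSignAut Φ) : SignEq (Φ 1) 1 :=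
  signEq_coe_iff.mp hΦ.toIsSignHom.map_one

theorem map_neg_one (hΦ : IsSignAut Φ) : SignEq (Φ (-1)) 1 :=
  (hΦ.neg 1).trans hΦ.map_one

theorem conj (hΦ : IsSignAut Φ) (h : SL(2, ℤ)) : IsSignAut fun x => h * Φ x * h⁻¹ where
  map_mul x y := by
    rw [signEq_coe_iff, show h * Φ x * h⁻¹ * (h * Φ y * h⁻¹) = h * (Φ x * Φ y) * h⁻¹ by group]
    exact ((SignEq.refl h).mul (hΦ.mul x y)).mul (SignEq.refl h⁻¹)
  eq_one x hx := by
    rw [← coe_one, signEq_coe_iff] at hx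
    have h1 := ((SignEq.refl h⁻¹).mul hx).mul (SignEq.refl h)
    apply hΦ.eq_one
    rw [show h⁻¹ * (h * Φ x * h⁻¹) * h = Φ x by group, mul_one, inv_mul_cancel] at h1
    rw [← coe_one, signEq_coe_iff]
    exact h1
  neg x := ((SignEq.refl h).mul (hΦ.neg x)).mul (SignEq.refl h⁻¹)
  surj y := by
    obtain ⟨x, hx⟩ := hΦ.surj (h⁻¹ * y * h)
    refine ⟨x, ?_⟩
    rw [show y = h * (h⁻¹ * y * h) * h⁻¹ by group]
    exact ((SignEq.refl h).mul hx).mul (SignEq.refl h⁻¹)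

theorem closure_eq_top (hΦ : IsSignAut Φ) {B : SL(2, ℤ)}
    (hA : SignEq (Φ ModularGroup.S) ModularGroup.S) (hB : SignEq (Φ elliptic) B) :
    Subgroup.closure {ModularGroup.S, B} = ⊤ := by
  have hS : ModularGroup.S ∈ Subgroup.closure {ModularGroup.S, B} :=
    Subgroup.subset_closure (by simp)
  have hneg : -1 ∈ Subgroup.closure {ModularGroup.S, B} := S_mul_S ▸ mul_mem hS hS
  have hsign : ∀ {x y : SL(2, ℤ)}, SignEq x y → y ∈ Subgroup.closure {ModularGroup.S, B} →
      x ∈ Subgroup.closure {ModularGroup.S, B} := by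
    rintro x y (rfl | rfl) hy
    · exact hy
    · rw [← neg_one_mul]
      exact mul_mem hneg hy
  have hmem : ∀ x, Φ x ∈ Subgroup.closure {ModularGroup.S, B} := by
    intro x
    have hx : x ∈ Subgroup.closure {ModularGroup.S, elliptic} :=
      closure_S_elliptic ▸ Subgroup.mem_top x
    induction hx using Subgroup.closure_induction with
    | mem x hx =>
      rcases hx with rfl | rfl
      · exact hsign hA hS
      · exact hsign hB (Subgroup.subset_closure (by simp))
    | one => exact hsign hΦ.map_one (one_mem _)
    | mul x y _ _ hx hy => exact hsign (hΦ.mul x y) (mul_mem hx hy)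
    | inv x _ hx =>
      have h1 := (hΦ.mul x x⁻¹).symm
      rw [mul_inv_cancel] at h1
      have h2 := (SignEq.refl (Φ x)⁻¹).mul (h1.trans hΦ.map_one)
      rw [inv_mul_cancel_left, mul_one] at h2
      exact hsign h2 (inv_mem hx)
  rw [eq_top_iff]
  intro y _
  obtain ⟨x, hx⟩ := hΦ.surj y
  exact hsign hx.symm (hmem x)

/-- The constraints leave four matrices `B`. Each is, up to sign, a conjugate of `elliptic` by an
element of `GL(2, ℤ)` that commutes with `S` up to sign. -/
theorem exists_conj_of_S (hΦ : IsSignAut Φ) (hS : SignEq (Φ ModularGroup.S) ModularGroup.S) :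
    ∃ g : GL (Fin 2) ℤ, ∀ x, SignEq ((Φ x).1 * g.1) (g.1 * x.1) := by
  obtain ⟨B, hB, htr⟩ : ∃ B, SignEq (Φ elliptic) B ∧ B.1.trace = 1 := by
    have hU : elliptic ^ 3 = -1 := by decide
    have h3 : SignEq ((Φ elliptic).1 ^ 3) 1 := by
      have h1 := ((hΦ.mul _ _).trans ((hΦ.mul elliptic elliptic).mul (SignEq.refl (Φ elliptic)))).symm
      rw [← pow_three', ← pow_three', hU] at h1
      exact signEq_coe_iff.mpr (h1.trans hΦ.map_neg_one)
    have h1 : ¬ SignEq (Φ elliptic).1 1 := by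
      intro h
      rcases hΦ.eq_one _ h with h | h <;> revert h <;> decide
    rcases trace_eq_one_or_of_cube (Φ elliptic).2 h3 h1 with h | h
    · exact ⟨_, SignEq.refl _, h⟩
    · exact ⟨-Φ elliptic, Or.inr (neg_neg _).symm, by rw [coe_neg, trace_neg, h, neg_neg]⟩
  have ha := apply_zero_zero_of_closure htr (hΦ.closure_eq_top hS hB)
  have hdet := B.2
  rw [det_fin_two] at hdet
  rw [trace_fin_two] at htr
  have key : ∀ g : GL (Fin 2) ℤ, SignEq (ModularGroup.S.1 * g.1) (g.1 * ModularGroup.S.1) →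
      SignEq (B.1 * g.1) (g.1 * elliptic.1) →
      ∃ g : GL (Fin 2) ℤ, ∀ x, SignEq ((Φ x).1 * g.1) (g.1 * x.1) := by
    intro g h1 h2
    refine ⟨g, hΦ.signEq_of_closure g.1 closure_S_elliptic ?_⟩
    rintro _ (rfl | rfl)
    · exact ((signEq_coe_iff.mpr hS).mul (SignEq.refl g.1)).trans h1
    · exact ((signEq_coe_iff.mpr hB).mul (SignEq.refl g.1)).trans h2
  have hBm := eta_fin_two B.1
  rcases ha with ha | ha
  all_goals
    have hd : B.1 1 1 = 1 - B.1 0 0 := by linarith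
    rw [ha] at hd
    rw [hd, ha] at hdet
    have hbc : B.1 0 1 * B.1 1 0 = -1 := by linarith
    rcases Int.mul_eq_neg_one_iff_eq_one_or_neg_one.mp hbc with ⟨hb, hc⟩ | ⟨hb, hc⟩
    all_goals rw [ha, hb, hc, hd] at hBm
  · refine key ⟨!![1, 0; 0, -1], !![1, 0; 0, -1], by decide, by decide⟩ ?_ ?_
    · unfold SignEq; decide
    · rw [hBm, coe_elliptic]; unfold SignEq; decide
  · refine key 1 ?_ ?_
    · unfold SignEq; decide
    · rw [hBm, coe_elliptic]; unfold SignEq; decide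
  · refine key ⟨!![0, 1; 1, 0], !![0, 1; 1, 0], by decide, by decide⟩ ?_ ?_
    · unfold SignEq; decide
    · rw [hBm, coe_elliptic]; unfold SignEq; decide
  · refine key (toGL ModularGroup.S) ?_ ?_
    · unfold SignEq; decide
    · rw [hBm, coe_elliptic]; unfold SignEq; decide

theorem exists_conj (hΦ : IsSignAut Φ) :
    ∃ g : GL (Fin 2) ℤ, ∀ x, SignEq ((Φ x).1 * g.1) (g.1 * x.1) := by
  have h2 : SignEq ((Φ ModularGroup.S).1 ^ 2) 1 := by
    have h1 := (hΦ.mul ModularGroup.S ModularGroup.S).symm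
    rw [S_mul_S, ← sq] at h1
    exact signEq_coe_iff.mpr (h1.trans hΦ.map_neg_one)
  have h1 : ¬ SignEq (Φ ModularGroup.S).1 1 := by
    intro h
    rcases hΦ.eq_one _ h with h | h <;> revert h <;> decide
  obtain ⟨h, hh⟩ := exists_conj_of_trace (Or.inl rfl) (Φ ModularGroup.S)
    (trace_eq_zero_of_sq (Φ ModularGroup.S).2 h2 h1)
  obtain ⟨g, hg⟩ := (hΦ.conj h).exists_conj_of_S (by
    rw [← signEq_coe_iff, ModularGroup.coe_S]
    rcases hh with hh | hh
    · exact Or.inl hh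
    · exact Or.inr (by rw [hh]; decide))
  refine ⟨toGL h⁻¹ * g, fun x => ?_⟩
  have h3 := (SignEq.refl (h⁻¹).1).mul (hg x)
  have h4 : (h⁻¹).1 * ((h * Φ x * h⁻¹).1 * g.1) = (Φ x).1 * (toGL h⁻¹ * g).1 := by
    rw [← mul_assoc, ← coe_mul, ← mul_assoc, inv_mul_cancel_left, coe_mul, mul_assoc]
    rfl
  rw [h4, ← mul_assoc] at h3
  exact h3

end IsSignAut

theorem hasRInfty_PSL_two : HasRInfty PSL(2, ℤ) := by
  intro φ
  obtain ⟨Φ, hΦ⟩ := exists_lift φ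
  have hiff := fun {x y : SL(2, ℤ)} =>
    (mk_eq_mk_iff_signEq two_ne_zero (x := x) (y := y)).trans signEq_coe_iff
  have h : IsSignAut Φ := {
    isSignHom_of_lift two_ne_zero φ hΦ with
    neg := fun x => by
      rw [← hiff, hΦ, hΦ]
      exact congrArg φ (hiff.mpr (Or.inr rfl))
    surj := fun y => by
      obtain ⟨x, hx⟩ := QuotientGroup.mk_surjective (φ.symm (QuotientGroup.mk y))
      refine ⟨x, ?_⟩
      rw [← hiff, hΦ, hx, MulEquiv.apply_symm_apply] }
  obtain ⟨g, hg⟩ := h.exists_conj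
  exact infinite_twistedConjClasses_of_conj le_rfl φ hΦ g hg

end PSLTwo

/-! ### The group `PGL(2, ℤ)` -/

/-- Right translation by `p` carries the classes of the modified automorphism to those of `φ`, so
`φ` may be normalized by inner automorphisms. -/
theorem infinite_twistedConjClasses_of_conj_trans {G : Type*} [Group G] (φ : G ≃* G) (p : G)
    (h : Infinite (TwistedConjClasses (φ.trans (MulAut.conj p)).toMonoidHom)) :
    Infinite (TwistedConjClasses φ.toMonoidHom) := by
  have hiff : ∀ x y : G, twistedConj (φ.trans (MulAut.conj p)).toMonoidHom x y ↔
      twistedConj φ.toMonoidHom (x * p) (y * p) := by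
    intro x y
    refine exists_congr fun g => ?_
    change y = g * x * (p * φ g⁻¹ * p⁻¹) ↔ y * p = g * (x * p) * φ g⁻¹
    rw [← mul_left_inj p]
    simp only [mul_assoc, inv_mul_cancel, mul_one]
  refine Infinite.of_injective (Quotient.map (· * p) fun x y hxy => (hiff x y).mp hxy) ?_
  rintro ⟨x⟩ ⟨y⟩ hxy
  exact Quotient.sound ((hiff x y).mpr (Quotient.exact hxy))

section PGLTwo

namespace PGLTwo

theorem mk_eq_mk_iff {g h : GL (Fin 2) ℤ} :
    ProjGenLinGroup.mk g = ProjGenLinGroup.mk h ↔ SignEq g.1 h.1 := by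
  rw [ProjGenLinGroup.mk_eq_mk_iff]
  constructor
  · rintro ⟨r, rfl⟩
    rcases Int.units_eq_one_or r with rfl | rfl
    · left; simp
    · right
      rw [Units.val_mul, GeneralLinearGroup.coe_scalar]
      simp
  · rintro (h1 | h1)
    · exact ⟨1, by rw [map_one, mul_one]; exact Units.ext h1⟩
    · refine ⟨-1, Units.ext ?_⟩
      rw [Units.val_mul, GeneralLinearGroup.coe_scalar, h1]
      simp

/-- The permutation matrix `!![0, 1; 1, 0]`. -/
def swap : GL (Fin 2) ℤ := ⟨!![0, 1; 1, 0], !![0, 1; 1, 0], by decide, by decide⟩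

/-- The diagonal matrix `!![1, 0; 0, -1]`. -/
def reflection : GL (Fin 2) ℤ := ⟨!![1, 0; 0, -1], !![1, 0; 0, -1], by decide, by decide⟩

/-- The matrix `!![0, 1; 1, 1]`. -/
def fibonacci : GL (Fin 2) ℤ := ⟨!![0, 1; 1, 1], !![-1, 1; 1, 0], by decide, by decide⟩

/-- The class of `!![0, -1; 1, 0]`. -/
def s : PGL(2, ℤ) := toPGL ModularGroup.S

/-- The class of `!![0, -1; 1, 1]`. -/
def u : PGL(2, ℤ) := toPGL elliptic

/-- The class of `!![0, 1; 1, 0]`. -/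
def w : PGL(2, ℤ) := ProjGenLinGroup.mk swap

/-- The class of `!![1, 0; 0, -1]`. -/
def v : PGL(2, ℤ) := ProjGenLinGroup.mk reflection

theorem u_cube : u * u * u = 1 := by
  change ProjGenLinGroup.mk (toGL elliptic * toGL elliptic * toGL elliptic) = ProjGenLinGroup.mk 1
  rw [mk_eq_mk_iff]
  unfold SignEq
  decide

theorem w_mul_u : w * u = u⁻¹ * w := by
  change ProjGenLinGroup.mk (swap * toGL elliptic) =
    ProjGenLinGroup.mk ((toGL elliptic)⁻¹ * swap)
  rw [mk_eq_mk_iff]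
  unfold SignEq
  decide

theorem s_mul_w : s * w = v := by
  change ProjGenLinGroup.mk (toGL ModularGroup.S * swap) = ProjGenLinGroup.mk reflection
  rw [mk_eq_mk_iff]
  unfold SignEq
  decide

theorem w_mul_s : w * s = v := by
  change ProjGenLinGroup.mk (swap * toGL ModularGroup.S) = ProjGenLinGroup.mk reflection
  rw [mk_eq_mk_iff]
  unfold SignEq
  decide

theorem v_mul_w : v * w = s := by
  change ProjGenLinGroup.mk (reflection * swap) = ProjGenLinGroup.mk (toGL ModularGroup.S)
  rw [mk_eq_mk_iff]
  unfold SignEq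
  decide

theorem closure_s_u_w : Subgroup.closure {s, u, w} = ⊤ := by
  have hw : w ∈ Subgroup.closure {s, u, w} := Subgroup.subset_closure (by simp)
  have hSL : ∀ x : SL(2, ℤ), toPGL x ∈ Subgroup.closure {s, u, w} := by
    intro x
    have h1 : toPGL x ∈ (Subgroup.closure {ModularGroup.S, elliptic}).map toPGL :=
      ⟨x, closure_S_elliptic ▸ Subgroup.mem_top x, rfl⟩
    rw [MonoidHom.map_closure] at h1
    refine Subgroup.closure_mono ?_ h1
    rintro _ ⟨_, rfl | rfl, rfl⟩
    · exact Or.inl rfl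
    · exact Or.inr (Or.inl rfl)
  rw [eq_top_iff]
  rintro q -
  obtain ⟨g, rfl⟩ := ProjGenLinGroup.mk_surjective q
  rcases det_eq_one_or g with h | h
  · have : g = toGL ⟨g.1, h⟩ := Units.ext rfl
    rw [this]
    exact hSL _
  · have hdet : (g * swap).1.det = 1 := by
      rw [Units.val_mul, det_mul, h]
      decide
    have : g * swap = toGL ⟨(g * swap).1, hdet⟩ := Units.ext rfl
    rw [← Subgroup.mul_mem_cancel_right _ hw, w, ← map_mul, this]
    exact hSL _

theorem hom_ext {φ ψ : PGL(2, ℤ) →* PGL(2, ℤ)} (hs : φ s = ψ s) (hu : φ u = ψ u)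
    (hw : φ w = ψ w) : φ = ψ := by
  refine MonoidHom.eq_of_eqOn_dense closure_s_u_w ?_
  rintro _ (rfl | rfl | rfl)
  exacts [hs, hu, hw]

/-- The absolute value of the trace of a representative. -/
noncomputable def absTrace (q : PGL(2, ℤ)) : ℕ :=
  (Function.surjInv ProjGenLinGroup.mk_surjective q).1.trace.natAbs

theorem absTrace_mk (g : GL (Fin 2) ℤ) : absTrace (ProjGenLinGroup.mk g) = g.1.trace.natAbs := by
  rcases mk_eq_mk_iff.mp (Function.surjInv_eq ProjGenLinGroup.mk_surjective
    (ProjGenLinGroup.mk g)) with h | h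
  · rw [absTrace, h]
  · rw [absTrace, h, trace_neg, Int.natAbs_neg]

theorem absTrace_conj (g x : PGL(2, ℤ)) : absTrace (g * x * g⁻¹) = absTrace x := by
  obtain ⟨g, rfl⟩ := ProjGenLinGroup.mk_surjective g
  obtain ⟨x, rfl⟩ := ProjGenLinGroup.mk_surjective x
  rw [← map_inv, ← map_mul, ← map_mul, absTrace_mk, absTrace_mk, Units.val_mul, trace_mul_comm,
    ← Units.val_mul, inv_mul_cancel_left]

theorem infinite_twistedConjClasses_id : Infinite (TwistedConjClasses (MonoidHom.id PGL(2, ℤ))) := by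
  refine infinite_twistedConjClasses_of_invariant _ absTrace absTrace_conj ?_
  refine Set.infinite_of_injective_forall_mem (f := fun k : ℕ => k) (fun _ _ h => h) fun k => ?_
  refine ⟨toPGL (ModularGroup.T ^ k * ModularGroup.S), ?_⟩
  change absTrace (ProjGenLinGroup.mk (toGL (ModularGroup.T ^ k * ModularGroup.S))) = k
  rw [absTrace_mk]
  change (ModularGroup.T ^ k * ModularGroup.S).1.trace.natAbs = k
  rw [coe_mul, ← zpow_natCast, ModularGroup.coe_T_zpow, ModularGroup.coe_S]
  simp [trace_fin_two]

theorem fibonacci_pow (k : ℕ) : 0 ≤ (fibonacci ^ k).1 0 0 ∧ 0 ≤ (fibonacci ^ k).1 0 1 ∧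
    0 ≤ (fibonacci ^ k).1 1 0 ∧ 1 ≤ (fibonacci ^ k).1 1 1 ∧
      1 ≤ (fibonacci ^ (k + 1)).1 1 0 := by
  have hstep : ∀ k, (fibonacci ^ (k + 1)).1 =
      !![(fibonacci ^ k).1 0 1, (fibonacci ^ k).1 0 0 + (fibonacci ^ k).1 0 1;
        (fibonacci ^ k).1 1 1, (fibonacci ^ k).1 1 0 + (fibonacci ^ k).1 1 1] := by
    intro k
    rw [pow_succ, Units.val_mul, eta_fin_two (fibonacci ^ k).1]
    ext i j
    fin_cases i <;> fin_cases j <;> simp [fibonacci, Matrix.mul_apply, Fin.sum_univ_two]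
  induction k with
  | zero => decide
  | succ k ih =>
    obtain ⟨h1, h2, h3, h4, -⟩ := ih
    rw [hstep (k + 1), hstep k]
    simp [-Units.val_pow_eq_pow_val]
    omega

/-- An automorphism exchanging `s` and `v` and fixing `u` and `w` has infinitely many twisted
conjugacy classes. -/
theorem infinite_twistedConjClasses_of_exchange {φ : PGL(2, ℤ) →* PGL(2, ℤ)} (hs : φ s = v)
    (hu : φ u = u) (hw : φ w = w) : Infinite (TwistedConjClasses φ) := by
  have hinv : φ.comp φ = MonoidHom.id _ := by
    apply hom_ext
    · rw [MonoidHom.comp_apply, hs, ← s_mul_w, map_mul, hs, hw, v_mul_w]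
      rfl
    · rw [MonoidHom.comp_apply, hu, hu]
      rfl
    · rw [MonoidHom.comp_apply, hw, hw]
      rfl
  have hinv' : ∀ x, φ (φ x) = x := fun x => DFunLike.congr_fun hinv x
  -- As `φ` is an involution, replacing `x` by `g x φ(g⁻¹)` conjugates `x φ(x)` by `g`.
  refine infinite_twistedConjClasses_of_invariant _ (fun x => absTrace (x * φ x)) ?_ ?_
  · intro g x
    rw [map_mul, map_mul, hinv', ← absTrace_conj g (x * φ x), map_inv]
    congr 1
    group
  · have hT : φ (toPGL ModularGroup.T) = ProjGenLinGroup.mk fibonacci := by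
      have h : ModularGroup.T = ModularGroup.S⁻¹ * elliptic := by rw [elliptic, inv_mul_cancel_left]
      rw [h, map_mul, map_mul, map_inv, map_inv]
      change (φ s)⁻¹ * φ u = _
      rw [hs, hu]
      change ProjGenLinGroup.mk (reflection⁻¹ * toGL elliptic) = _
      rw [mk_eq_mk_iff]
      unfold SignEq
      decide
    refine Set.infinite_of_forall_exists_gt fun k => ⟨_, ⟨toPGL ModularGroup.T ^ (k + 1), rfl⟩, ?_⟩
    have h1 : toPGL ModularGroup.T ^ (k + 1) * φ (toPGL ModularGroup.T ^ (k + 1)) =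
        ProjGenLinGroup.mk (toGL (ModularGroup.T ^ (k + 1)) * fibonacci ^ (k + 1)) := by
      rw [map_pow φ, hT, map_mul, map_pow, map_pow]
      rfl
    simp only [h1, absTrace_mk]
    have h2 : (toGL (ModularGroup.T ^ (k + 1)) * fibonacci ^ (k + 1)).1.trace =
        (fibonacci ^ (k + 1)).1 0 0 + (k + 1 : ℕ) * (fibonacci ^ (k + 1)).1 1 0 +
          (fibonacci ^ (k + 1)).1 1 1 := by
      change ((ModularGroup.T ^ (k + 1)).1 * (fibonacci ^ (k + 1)).1).trace = _
      rw [← zpow_natCast ModularGroup.T, ModularGroup.coe_T_zpow, trace_fin_two]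
      simp [Matrix.mul_apply, Fin.sum_univ_two]
    obtain ⟨h3, -, -, h4, -⟩ := fibonacci_pow (k + 1)
    obtain ⟨-, -, -, -, h5⟩ := fibonacci_pow k
    rw [h2]
    have h6 : ((k + 1 : ℕ) : ℤ) ≤ (k + 1 : ℕ) * (fibonacci ^ (k + 1)).1 1 0 :=
      le_mul_of_one_le_right (by positivity) h5
    omega

theorem ne_one_of_not_signEq {g : GL (Fin 2) ℤ} (h : ¬ SignEq g.1 1) :
    ProjGenLinGroup.mk g ≠ 1 := fun h1 => h (mk_eq_mk_iff.mp (h1.trans (map_one _).symm))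

/-- A representative of `φ u` has cube `±1`, so determinant `1` and trace `±1`. With trace `1` it is
conjugate in `SL(2, ℤ)` to `elliptic` or to its image under `reflection`. -/
theorem exists_conj_u (φ : PGL(2, ℤ) ≃* PGL(2, ℤ)) : ∃ p, p * φ u * p⁻¹ = u := by
  obtain ⟨Y, hY⟩ := ProjGenLinGroup.mk_surjective (φ u)
  have h3 : SignEq (Y.1 ^ 3) 1 := by
    rw [← Units.val_one, ← Units.val_pow_eq_pow_val, ← mk_eq_mk_iff, map_pow, hY, ← map_pow,
      pow_three', u_cube, map_one, map_one]
  have h1 : ¬ SignEq Y.1 1 := by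
    rw [← Units.val_one, ← mk_eq_mk_iff, hY, map_one, map_eq_one_iff φ φ.injective]
    refine ne_one_of_not_signEq ?_
    unfold SignEq
    decide
  have hdet : Y.1.det = 1 := by
    have h2 : Y.1.det ^ 3 = 1 := by
      rw [← det_pow]
      rcases h3 with h | h <;> rw [h] <;> decide
    rcases det_eq_one_or Y with h | h
    · exact h
    · rw [h] at h2
      exact absurd h2 (by decide)
  obtain ⟨X, hX, htr⟩ : ∃ X : SL(2, ℤ), φ u = toPGL X ∧ X.1.trace = 1 := by
    rcases trace_eq_one_or_of_cube hdet h3 h1 with h | h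
    · refine ⟨⟨Y.1, hdet⟩, ?_, h⟩
      rw [← hY]
      exact mk_eq_mk_iff.mpr (Or.inl rfl)
    · refine ⟨-⟨Y.1, hdet⟩, ?_, ?_⟩
      · rw [← hY]
        exact mk_eq_mk_iff.mpr (Or.inr (neg_neg _).symm)
      · change (-Y.1).trace = 1
        rw [trace_neg, h, neg_neg]
  obtain ⟨h, hh | hh⟩ := exists_conj_of_trace (Or.inr rfl) X htr
  · refine ⟨toPGL h, ?_⟩
    rw [hX, ← map_inv, ← map_mul, ← map_mul]
    exact congrArg toPGL (Subtype.ext (hh.trans coe_elliptic.symm))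
  · refine ⟨v * toPGL h, ?_⟩
    have h2 : toPGL h * φ u * (toPGL h)⁻¹ = v⁻¹ * u * v := by
      rw [hX, ← map_inv, ← map_mul, ← map_mul]
      change ProjGenLinGroup.mk (toGL (h * X * h⁻¹)) =
        ProjGenLinGroup.mk (reflection⁻¹ * toGL elliptic * reflection)
      rw [mk_eq_mk_iff]
      left
      refine hh.trans ?_
      decide
    have h3 : v * toPGL h * φ u * (v * toPGL h)⁻¹ =
        v * (toPGL h * φ u * (toPGL h)⁻¹) * v⁻¹ := by group
    rw [h3, h2]
    group

/-- Solving the equation with sign `+` leaves entries `a`, `b` with determinant `-(a² - a b + b²)`.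
This form takes the value `1` at six points, three up to sign. The sign `-` forces determinant zero.
-/
theorem eq_of_mul_u {q : PGL(2, ℤ)} (hq : q * u = u⁻¹ * q) : q = w ∨ q = u * w ∨ q = u⁻¹ * w := by
  obtain ⟨X, rfl⟩ := ProjGenLinGroup.mk_surjective q
  have h : SignEq (X * toGL elliptic).1 ((toGL elliptic)⁻¹ * X).1 := mk_eq_mk_iff.mp hq
  have hU : (toGL elliptic).1 = !![0, -1; 1, 1] := coe_elliptic
  have hU' : ((toGL elliptic)⁻¹).1 = !![1, 1; -1, 0] := by decide
  rw [Units.val_mul, Units.val_mul, hU, hU'] at h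
  have hm := eta_fin_two X.1
  have hX := det_eq_one_or X
  rw [det_fin_two] at hX
  generalize X.1 0 0 = a at hm hX
  generalize X.1 0 1 = b at hm hX
  generalize X.1 1 0 = c at hm hX
  generalize X.1 1 1 = d at hm hX
  rw [hm] at h
  rcases h with h | h
  all_goals
    have e00 := congrFun (congrFun h 0) 0
    have e01 := congrFun (congrFun h 0) 1
    have e10 := congrFun (congrFun h 1) 0
    have e11 := congrFun (congrFun h 1) 1
    simp [Matrix.mul_apply, Fin.sum_univ_two] at e00 e01 e10 e11
  · obtain rfl : d = -a := by linarith
    obtain rfl : c = b - a := by linarith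
    have h1 : a ^ 2 - a * b + b ^ 2 = 1 := by
      rcases hX with hX | hX
      · nlinarith [sq_nonneg (a - b), sq_nonneg (a + b)]
      · linarith
    have ha : -1 ≤ a ∧ a ≤ 1 := by constructor <;> nlinarith [sq_nonneg (2 * b - a)]
    have hb : -1 ≤ b ∧ b ≤ 1 := by constructor <;> nlinarith [sq_nonneg (2 * a - b)]
    obtain ⟨ha1, ha2⟩ := ha
    obtain ⟨hb1, hb2⟩ := hb
    have hw : SignEq X.1 swap.1 → ProjGenLinGroup.mk X = w := mk_eq_mk_iff.mpr
    have huw : SignEq X.1 (toGL elliptic * swap).1 → ProjGenLinGroup.mk X = u * w :=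
      mk_eq_mk_iff.mpr
    have huw' : SignEq X.1 ((toGL elliptic)⁻¹ * swap).1 → ProjGenLinGroup.mk X = u⁻¹ * w :=
      mk_eq_mk_iff.mpr
    rw [hm] at hw huw huw'
    interval_cases a <;> interval_cases b <;> norm_num at h1
    · exact .inr (.inr (huw' (by unfold SignEq; decide)))
    · exact .inr (.inl (huw (by unfold SignEq; decide)))
    · exact .inl (hw (by unfold SignEq; decide))
    · exact .inl (hw (by unfold SignEq; decide))
    · exact .inr (.inl (huw (by unfold SignEq; decide)))
    · exact .inr (.inr (huw' (by unfold SignEq; decide)))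
  · obtain rfl : a = 0 := by linarith
    obtain rfl : b = 0 := by linarith
    norm_num at hX

/-- The determinant is `±(a - b)(a + b)`, so both factors are units of `ℤ`. -/
theorem eq_of_mul_w {q : PGL(2, ℤ)} (hq : q * w = w * q) : q = 1 ∨ q = w ∨ q = v ∨ q = s := by
  obtain ⟨X, rfl⟩ := ProjGenLinGroup.mk_surjective q
  have h : SignEq (X * swap).1 (swap * X).1 := mk_eq_mk_iff.mp hq
  have hW : swap.1 = !![0, 1; 1, 0] := rfl
  rw [Units.val_mul, Units.val_mul, hW] at h
  have hm := eta_fin_two X.1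
  have hX := det_eq_one_or X
  rw [det_fin_two] at hX
  have h1 : SignEq X.1 (1 : GL (Fin 2) ℤ).1 → ProjGenLinGroup.mk X = 1 := mk_eq_mk_iff.mpr
  have hw : SignEq X.1 swap.1 → ProjGenLinGroup.mk X = w := mk_eq_mk_iff.mpr
  have hv : SignEq X.1 reflection.1 → ProjGenLinGroup.mk X = v := mk_eq_mk_iff.mpr
  have hs : SignEq X.1 (toGL ModularGroup.S).1 → ProjGenLinGroup.mk X = s := mk_eq_mk_iff.mpr
  generalize X.1 0 0 = a at hm hX
  generalize X.1 0 1 = b at hm hX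
  generalize X.1 1 0 = c at hm hX
  generalize X.1 1 1 = d at hm hX
  rw [hm] at h h1 hw hv hs
  have hbound : (a - b) * (a + b) = 1 ∨ (a - b) * (a + b) = -1 →
      a = 0 ∧ b = 1 ∨ a = 0 ∧ b = -1 ∨ a = 1 ∧ b = 0 ∨ a = -1 ∧ b = 0 := by
    rintro (h | h)
    · rcases Int.mul_eq_one_iff_eq_one_or_neg_one.mp h with ⟨h1, h2⟩ | ⟨h1, h2⟩ <;> omega
    · rcases Int.mul_eq_neg_one_iff_eq_one_or_neg_one.mp h with ⟨h1, h2⟩ | ⟨h1, h2⟩ <;> omega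
  rcases h with h | h
  all_goals
    have e00 := congrFun (congrFun h 0) 0
    have e01 := congrFun (congrFun h 0) 1
    have e10 := congrFun (congrFun h 1) 0
    have e11 := congrFun (congrFun h 1) 1
    simp [Matrix.mul_apply, Fin.sum_univ_two] at e00 e01 e10 e11
  · obtain rfl : d = a := by linarith
    obtain rfl : c = b := by linarith
    rcases hbound (hX.imp (fun h => by linarith) (fun h => by linarith)) with
      ⟨rfl, rfl⟩ | ⟨rfl, rfl⟩ | ⟨rfl, rfl⟩ | ⟨rfl, rfl⟩
    · exact .inr (.inl (hw (by unfold SignEq; decide)))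
    · exact .inr (.inl (hw (by unfold SignEq; decide)))
    · exact .inl (h1 (by unfold SignEq; decide))
    · exact .inl (h1 (by unfold SignEq; decide))
  · obtain rfl : d = -a := by linarith
    obtain rfl : c = -b := by linarith
    rcases hbound (hX.symm.imp (fun h => by linarith) (fun h => by linarith)) with
      ⟨rfl, rfl⟩ | ⟨rfl, rfl⟩ | ⟨rfl, rfl⟩ | ⟨rfl, rfl⟩
    · exact .inr (.inr (.inr (hs (by unfold SignEq; decide))))
    · exact .inr (.inr (.inr (hs (by unfold SignEq; decide))))
    · exact .inr (.inr (.inl (hv (by unfold SignEq; decide))))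
    · exact .inr (.inr (.inl (hv (by unfold SignEq; decide))))

theorem s_ne_one : s ≠ 1 := ne_one_of_not_signEq (by unfold SignEq; decide)

theorem s_ne_w : s ≠ w := fun h => by
  have := mk_eq_mk_iff.mp h
  revert this
  unfold SignEq
  decide

/-- `s` commutes with `w`, so `φ s` is one of `1`, `w`, `v`, `s`; injectivity excludes `1` and `w`.
Since `s`, `u`, `w` generate, `φ` is the exchange or the identity. -/
theorem infinite_twistedConjClasses_of_fix {φ : PGL(2, ℤ) ≃* PGL(2, ℤ)} (hu : φ u = u)
    (hw : φ w = w) : Infinite (TwistedConjClasses φ.toMonoidHom) := by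
  have hs : φ s * w = w * φ s := by
    rw [← hw, ← map_mul, ← map_mul, s_mul_w, w_mul_s]
  rcases eq_of_mul_w hs with h | h | h | h
  · exact absurd ((map_eq_one_iff φ φ.injective).mp h) s_ne_one
  · exact absurd (φ.injective (h.trans hw.symm)) s_ne_w
  · exact infinite_twistedConjClasses_of_exchange h hu hw
  · rw [hom_ext (φ := φ.toMonoidHom) (ψ := MonoidHom.id _) h hu hw]
    exact infinite_twistedConjClasses_id

end PGLTwo

open PGLTwo in
theorem hasRInfty_PGL_two : HasRInfty PGL(2, ℤ) := by
  intro φ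
  obtain ⟨p, hp⟩ := exists_conj_u φ
  apply infinite_twistedConjClasses_of_conj_trans φ p
  have hu : (φ.trans (MulAut.conj p)) u = u := hp
  generalize φ.trans (MulAut.conj p) = ψ at hu
  have hw : ψ w * u = u⁻¹ * ψ w := by
    have h := congrArg ψ w_mul_u
    rwa [map_mul, map_mul, map_inv, hu] at h
  -- Conjugation by powers of `u` fixes `u` and permutes `w`, `u w`, `u⁻¹ w` transitively, so `w`
  -- may also be taken to be fixed.
  have key : ∀ r : PGL(2, ℤ), r * u * r⁻¹ = u → r * ψ w * r⁻¹ = w →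
      Infinite (TwistedConjClasses ψ.toMonoidHom) := by
    intro r h1 h2
    apply infinite_twistedConjClasses_of_conj_trans ψ r
    refine infinite_twistedConjClasses_of_fix ?_ h2
    change r * ψ u * r⁻¹ = u
    rw [hu, h1]
  have h1 : w * u⁻¹ = u * w := by
    rw [mul_inv_eq_iff_eq_mul, mul_assoc, w_mul_u, mul_inv_cancel_left]
  rcases eq_of_mul_u hw with h | h | h
  · exact key 1 (by simp) (by simp [h])
  · refine key u (by simp) ?_
    rw [h, mul_assoc, mul_assoc, h1, ← mul_assoc, ← mul_assoc, u_cube, one_mul]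
  · refine key u⁻¹ (by simp) ?_
    rw [h, inv_inv, mul_assoc, mul_assoc, w_mul_u, ← mul_assoc, ← mul_assoc, ← _root_.mul_inv_rev,
      ← _root_.mul_inv_rev, ← mul_assoc, u_cube, inv_one, one_mul]

end PGLTwo

theorem theorem3p1 (n : ℕ) (hn : 2 ≤ n) :
    HasRInfty SL(n, ℤ) ∧ HasRInfty PSL(n, ℤ) ∧
      HasRInfty (GL (Fin n) ℤ) ∧ HasRInfty PGL(n, ℤ) := by
  have hPSL : HasRInfty PSL(n, ℤ) := by
    rcases hn.eq_or_lt with rfl | hn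
    · exact hasRInfty_PSL_two
    · exact hasRInfty_PSL_of_three_le hn
  have hPGL : HasRInfty PGL(n, ℤ) := by
    rcases hn.eq_or_lt with rfl | hn
    · exact hasRInfty_PGL_two
    · exact hasRInfty_PGL_of_three_le hn
  exact ⟨hPSL.of_quotient _, hPSL,
    HasRInfty.of_quotient (Subgroup.center (GL (Fin n) ℤ)) hPGL, hPGL⟩
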